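/- Let $a>0$ and $0<t<\frac1{a+4}$, let $S(x,y)=x+y+\frac1x+\frac1y+axy$ and let $K(x,y)=xy\,(1-tS(x,y))$, a polynomial of bidegree $(2,2)$. Let $\mathcal C=\{(x,y)\in\overline{\mathbb C}\times\overline{\mathbb C}:K(x,y)=0\}$, where $\overline{\mathbb C}=\mathbb C\cup\{\infty\}$ (at points with an infinite coordinate the equation is read bihomogeneously in $\mathbb P^1\times\mathbb P^1$). For $\operatorname{Im}\tau>0$ let $$\vartheta(z|\tau)=\sum_{n\ge 0}(-1)^n e^{i\pi\tau(n+\frac12)^2}\bigl(e^{(2n+1)iz}-e^{-(2n+1)iz}\bigr),$$ and let $\vartheta'$ denote its derivative in $z$. Then there are $c,\gamma,\tau\in\mathbb C$ with $\gamma,\tau\in i\mathbb R$ and $0<\operatorname{Im}(2\gamma)<\operatorname{Im}(\pi\tau)$ such that $$ac^3=-\frac{\vartheta(4\gamma|\tau)}{\vartheta(2\gamma|\tau)},\qquad c^2=\frac{\vartheta(3\gamma|\tau)}{\vartheta(\gamma|\tau)},\qquad \frac ct=4\frac{\vartheta'(\gamma|\tau)\vartheta(2\gamma|\tau)}{\vartheta'(0|\tau)\vartheta(\gamma|\tau)}-2\frac{\vartheta'(2\gamma|\tau)}{\vartheta'(0|\tau)},$$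 and such that the functions $$X(z)=c\,\frac{\vartheta(z|\tau)\vartheta(z+\gamma|\tau)}{\vartheta(z-\gamma|\tau)\vartheta(z+2\gamma|\tau)},\qquad Y(z)=c\,\frac{\vartheta(z|\tau)\vartheta(z-\gamma|\tau)}{\vartheta(z+\gamma|\tau)\vartheta(z-2\gamma|\tau)}=X(-z)$$ have the following properties. (A) $X,Y:\mathbb C\to\overline{\mathbb C}$ are meromorphic and $\mathcal C=\{(X(z),Y(z)):z\in\mathbb C\}$; for all $z$ one has $K(X(z),Y(z))=0$, $X(z)=X(z+\pi)=X(z+\pi\tau)=X(-\gamma-z)$ and $Y(z)=Y(z+\pi)=Y(z+\pi\tau)=Y(\gamma-z)$; moreover $|X(-\frac\gamma2)|<1$ and $|Y(\frac\gamma2)|<1$; and, counted with multiplicity, $X$ and $Y$ each have exactly two roots and two poles in each fundamental domain $\{z_c+r_1\pi+r_2\pi\tau:r_1,r_2\in[0,1)\}$, $z_c\in\mathbb C$. (B) The plane $\mathbb C$ can be partitioned into simply connected regions $(\Omega_s)_{s\in\mathbb Z}$, stacked as a sequence of bands, i.e. $\overline{\Omega_r}\cap\overline{\Omega_s}=\emptyset$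 if $|r-s|\ge2$, with $\bigcup_s\overline{\Omega_{2s}}\cap\overline{\Omega_{2s+1}}=\{|X|=1\}$ and $\bigcup_s\overline{\Omega_{2s-1}}\cap\overline{\Omega_{2s}}=\{|Y|=1\}$, such that $$\bigcup_{s}\Omega_{4s}\cup\Omega_{4s+1}=\{|Y|<1\},\quad \bigcup_{s}\Omega_{4s-2}\cup\Omega_{4s-1}=\{|Y|\ge1\},$$ $$\bigcup_{s}\Omega_{4s-1}\cup\Omega_{4s}=\{|X|<1\},\quad \bigcup_{s}\Omega_{4s+1}\cup\Omega_{4s+2}=\{|X|\ge1\}$$ (with $|\infty|=\infty$), and, for every $s\in\mathbb Z$, $\pi+\Omega_s=\Omega_s$, $$s\pi\tau+\gamma-(\Omega_{2s}\cup\Omega_{2s+1})=\Omega_{2s}\cup\Omega_{2s+1}\supset\tfrac{s\pi\tau+\gamma}2+\mathbb R,$$ $$s\pi\tau-\gamma-(\Omega_{2s}\cup\Omega_{2s-1})=\Omega_{2s}\cup\Omega_{2s-1}\supset\tfrac{s\pi\tau-\gamma}2+\mathbb R.$$ -/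

import Mathlib

open scoped Topology

namespace AModel

noncomputable section

/-- The Jacobi theta function
`ϑ(z|τ) = ∑_{n ≥ 0} (-1)^n e^{iπτ(n+1/2)²} (e^{(2n+1)iz} - e^{-(2n+1)iz})`
(the series converges for `Im τ > 0`). -/
def theta (z τ : ℂ) : ℂ :=
  ∑' n : ℕ, (-1 : ℂ) ^ n * Complex.exp (Complex.I * Real.pi * τ * ((n : ℂ) + 1 / 2) ^ 2) *
    (Complex.exp ((2 * (n : ℂ) + 1) * Complex.I * z) -
      Complex.exp (-((2 * (n : ℂ) + 1) * Complex.I * z)))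

/-- The derivative `ϑ'(z|τ)` with respect to `z`. -/
def thetaDeriv (z τ : ℂ) : ℂ := deriv (fun w => theta w τ) z

/-- The step polynomial `S(x,y) = x + y + 1/x + 1/y + a x y` (for `x, y ≠ 0`). -/
def stepPoly (a x y : ℂ) : ℂ := x + y + 1 / x + 1 / y + a * x * y

/-- The kernel `K(x,y) = x y (1 - t S(x,y))`, expanded as a polynomial so that it makes sense
for all `x` and `y`; see `kernel_eq`. -/
def kernel (a t x y : ℂ) : ℂ :=
  x * y - t * (x ^ 2 * y + x * y ^ 2 + y + x + a * x ^ 2 * y ^ 2)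

theorem kernel_eq (a t x y : ℂ) (hx : x ≠ 0) (hy : y ≠ 0) :
    kernel a t x y = x * y * (1 - t * stepPoly a x y) := by
  unfold kernel stepPoly
  field_simp

/-- The kernel as a form of bidegree `(2,2)` in `([x₀ : x₁], [y₀ : y₁])`. -/
def kernelForm (a t x₀ x₁ y₀ y₁ : ℂ) : ℂ :=
  x₀ * x₁ * y₀ * y₁ -
    t * (x₀ ^ 2 * y₀ * y₁ + x₀ * x₁ * y₀ ^ 2 + x₁ ^ 2 * y₀ * y₁ + x₀ * x₁ * y₁ ^ 2 +
      a * x₀ ^ 2 * y₀ ^ 2)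

theorem kernelForm_eq (a t x₀ x₁ y₀ y₁ : ℂ) (hx : x₁ ≠ 0) (hy : y₁ ≠ 0) :
    kernelForm a t x₀ x₁ y₀ y₁ = x₁ ^ 2 * y₁ ^ 2 * kernel a t (x₀ / x₁) (y₀ / y₁) := by
  unfold kernelForm kernel
  field_simp

/-- Homogeneous coordinates on `ℂ ∪ {∞}`: `x = [x : 1]` and `∞ = [1 : 0]`. -/
def homCoord (p : OnePoint ℂ) : ℂ × ℂ := p.elim (1, 0) (fun x => (x, 1))

/-- The kernel on `(ℂ ∪ {∞}) × (ℂ ∪ {∞})`; only its vanishing is meaningful at infinity. -/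
def kernelExt (a t : ℂ) (p q : OnePoint ℂ) : ℂ :=
  kernelForm a t (homCoord p).1 (homCoord p).2 (homCoord q).1 (homCoord q).2

theorem kernelExt_coe (a t x y : ℂ) :
    kernelExt a t (x : OnePoint ℂ) (y : OnePoint ℂ) = kernel a t x y := by
  simp [kernelExt, homCoord, kernelForm, kernel]

/-- The kernel curve `𝒞 = {(x,y) ∈ (ℂ ∪ {∞})² : K(x,y) = 0}`. -/
def kernelCurve (a t : ℂ) : Set (OnePoint ℂ × OnePoint ℂ) :=
  {p | kernelExt a t p.1 p.2 = 0}

/-- The modulus on `ℂ ∪ {∞}`, with `|∞| = ∞`. -/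
def modulus (p : OnePoint ℂ) : ENNReal := p.elim ⊤ (fun x => ‖x‖ₑ)

/-- The complex value of a point of `ℂ ∪ {∞}`, with the placeholder `0` at `∞`. -/
def finPart (p : OnePoint ℂ) : ℂ := p.elim 0 id

/-- `F : ℂ → ℂ ∪ {∞}` is a meromorphic function: its poles are isolated, it is meromorphic as a
complex-valued function off them, and its values (including `∞` at the poles) are the limits. -/
def IsMeromorphic (F : ℂ → OnePoint ℂ) : Prop :=
  Meromorphic (fun z => finPart (F z)) ∧ Continuous F ∧
    ∀ z, ∀ᶠ w in 𝓝[≠] z, F w ≠ OnePoint.infty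

/-- The order of `F` at `z`: positive at a root, negative at a pole. -/
def orderAt (F : ℂ → OnePoint ℂ) (z : ℂ) : ℤ :=
  (meromorphicOrderAt (fun w => finPart (F w)) z).untop₀

/-- The number of roots of `F` in `D`, counted with multiplicity. -/
def rootCount (F : ℂ → OnePoint ℂ) (D : Set ℂ) : ℤ := ∑ᶠ z ∈ D, max (orderAt F z) 0

/-- The number of poles of `F` in `D`, counted with multiplicity. -/
def poleCount (F : ℂ → OnePoint ℂ) (D : Set ℂ) : ℤ := ∑ᶠ z ∈ D, max (-orderAt F z) 0

/-- The fundamental domain `{z_c + r₁ π + r₂ π τ : r₁, r₂ ∈ [0,1)}`. -/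
def fundDomain (τ zc : ℂ) : Set ℂ :=
  {z | ∃ r₁ ∈ Set.Ico (0 : ℝ) 1, ∃ r₂ ∈ Set.Ico (0 : ℝ) 1,
    z = zc + r₁ * Real.pi + r₂ * Real.pi * τ}

/-- `X(z) = c ϑ(z)ϑ(z+γ) / (ϑ(z-γ)ϑ(z+2γ))`, with value `∞` where the denominator vanishes
(for `0 < Im 2γ < Im πτ` the numerator does not vanish there). -/
def Xfun (c γ τ z : ℂ) : OnePoint ℂ :=
  open Classical in
  if theta (z - γ) τ * theta (z + 2 * γ) τ = 0 then OnePoint.infty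
  else ((c * (theta z τ * theta (z + γ) τ) /
    (theta (z - γ) τ * theta (z + 2 * γ) τ) : ℂ) : OnePoint ℂ)

/-- `Y(z) = c ϑ(z)ϑ(z-γ) / (ϑ(z+γ)ϑ(z-2γ))`, with value `∞` where the denominator vanishes. -/
def Yfun (c γ τ z : ℂ) : OnePoint ℂ :=
  open Classical in
  if theta (z + γ) τ * theta (z - 2 * γ) τ = 0 then OnePoint.infty
  else ((c * (theta z τ * theta (z - γ) τ) /
    (theta (z + γ) τ * theta (z - 2 * γ) τ) : ℂ) : OnePoint ℂ)

/-- `X` and `Y` are meromorphic functions parametrising the kernel curve, with the stated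
symmetries, sizes and numbers of roots and poles. -/
structure ParametrisesKernel (a t : ℝ) (γ τ : ℂ) (X Y : ℂ → OnePoint ℂ) : Prop where
  meromorphic_X : IsMeromorphic X
  meromorphic_Y : IsMeromorphic Y
  curve_eq : kernelCurve a t = Set.range (fun z => (X z, Y z))
  gamma_re : γ.re = 0
  tau_re : τ.re = 0
  gamma_pos : 0 < (2 * γ).im
  gamma_lt : (2 * γ).im < ((Real.pi : ℂ) * τ).im
  kernel_zero : ∀ z, kernelExt a t (X z) (Y z) = 0
  X_add_pi : ∀ z, X (z + Real.pi) = X z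
  X_add_pi_tau : ∀ z, X (z + Real.pi * τ) = X z
  X_reflect : ∀ z, X (-γ - z) = X z
  Y_add_pi : ∀ z, Y (z + Real.pi) = Y z
  Y_add_pi_tau : ∀ z, Y (z + Real.pi * τ) = Y z
  Y_reflect : ∀ z, Y (γ - z) = Y z
  X_small : modulus (X (-γ / 2)) < 1
  Y_small : modulus (Y (γ / 2)) < 1
  roots_X : ∀ zc, rootCount X (fundDomain τ zc) = 2
  poles_X : ∀ zc, poleCount X (fundDomain τ zc) = 2
  roots_Y : ∀ zc, rootCount Y (fundDomain τ zc) = 2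
  poles_Y : ∀ zc, poleCount Y (fundDomain τ zc) = 2

/-- The sets `Ω s` partition the plane into simply connected regions, stacked as a sequence of
bands, according to whether `|X| < 1` and whether `|Y| < 1`, and have the stated symmetries. -/
structure IsOmegaPartition (γ τ : ℂ) (X Y : ℂ → OnePoint ℂ) (Ω : ℤ → Set ℂ) : Prop where
  disjoint : Pairwise (fun r s => Disjoint (Ω r) (Ω s))
  cover : ⋃ s, Ω s = Set.univ
  simplyConnected : ∀ s, SimplyConnectedSpace (Ω s)
  -- Only consecutive bands touch; they are separated by the lines `|X| = 1` and `|Y| = 1`,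
  -- alternately.
  closure_disjoint : ∀ r s : ℤ, r + 1 < s → Disjoint (closure (Ω r)) (closure (Ω s))
  lines_X : ⋃ s : ℤ, closure (Ω (2 * s)) ∩ closure (Ω (2 * s + 1)) = {z | modulus (X z) = 1}
  lines_Y : ⋃ s : ℤ, closure (Ω (2 * s - 1)) ∩ closure (Ω (2 * s)) = {z | modulus (Y z) = 1}
  Y_lt : ⋃ s : ℤ, Ω (4 * s) ∪ Ω (4 * s + 1) = {z | modulus (Y z) < 1}
  Y_ge : ⋃ s : ℤ, Ω (4 * s - 2) ∪ Ω (4 * s - 1) = {z | 1 ≤ modulus (Y z)}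
  X_lt : ⋃ s : ℤ, Ω (4 * s - 1) ∪ Ω (4 * s) = {z | modulus (X z) < 1}
  X_ge : ⋃ s : ℤ, Ω (4 * s + 1) ∪ Ω (4 * s + 2) = {z | 1 ≤ modulus (X z)}
  add_pi : ∀ s, (fun z : ℂ => (Real.pi : ℂ) + z) '' Ω s = Ω s
  reflect_Y : ∀ s : ℤ,
    (fun z : ℂ => (s : ℂ) * Real.pi * τ + γ - z) '' (Ω (2 * s) ∪ Ω (2 * s + 1)) =
      Ω (2 * s) ∪ Ω (2 * s + 1)
  line_Y : ∀ s : ℤ, Set.range (fun r : ℝ => ((s : ℂ) * Real.pi * τ + γ) / 2 + (r : ℂ)) ⊆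
    Ω (2 * s) ∪ Ω (2 * s + 1)
  reflect_X : ∀ s : ℤ,
    (fun z : ℂ => (s : ℂ) * Real.pi * τ - γ - z) '' (Ω (2 * s) ∪ Ω (2 * s - 1)) =
      Ω (2 * s) ∪ Ω (2 * s - 1)
  line_X : ∀ s : ℤ, Set.range (fun r : ℝ => ((s : ℂ) * Real.pi * τ - γ) / 2 + (r : ℂ)) ⊆
    Ω (2 * s) ∪ Ω (2 * s - 1)

end

end AModel

/-!
An entire function with the quasi-periods of a product of theta functions, and with its zeros, is
a constant multiple of that product. Write `X` as the quotient of `c ϑ(z) ϑ(z + γ)` by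
`ϑ(z - γ) ϑ(z + 2γ)` and clear denominators in `S(X(z), X(-z)) = 1 / t`: under the three equations
for `c`, both sides become four-fold theta products that agree by this principle. For given `X(z)`
the kernel is quadratic in `y`, and its two roots are `X(-z)` and `X(z + γ)`; since `X` is onto
`ℂ ∪ {∞}`, the pairs `(X(z), X(-z))` fill the whole curve.

For the existence of the parameters put `πτ = iT` and `γ = ig`. Eliminating `c` from its first two
equations leaves one equation for `g / T`, strictly monotone in `g / T` on `[1/4, 1/3]`, so that
its solution depends continuously on `T`. At `π / 2` one has `X = Y`, with a positive real value
`x`, and the third equation becomes `2 x + 2 / x + a x² = 1 / t`. As `T → 0` the left side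
approaches `S(1, 1) = a + 4`, and as `T → ∞` it is unbounded, so some `T` attains `1 / t`.

On the real axis and on the line `Im z = T / 2` one has `Y = conj X`. There the kernel equation
keeps `|X|` away from `1`. By the symmetry `X(-γ - z) = X(z)` and the maximum principle, `|X| < 1`
on the strip `-g ≤ Im z ≤ 0` and `|X| > 1` on the strip `T / 2 - g ≤ Im z ≤ T / 2`. Between the two
`|X|` is strictly increasing in `Im z`, so `|X| = 1` is the graph of a function there. The
translates and reflections of this graph bound the bands.
-/

namespace AModel

noncomputable section

open Complex (I)
open scoped Real Complex ComplexConjugate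

section QuasiPeriodic

variable {F G m : ℂ → ℂ} {ω : ℂ}

lemma eventually_ne_zero_of_deriv_ne_zero {z : ℂ} (hG : DifferentiableAt ℂ G z)
    (hz : G z = 0 → deriv G z ≠ 0) : ∀ᶠ w in 𝓝[≠] z, G w ≠ 0 := by
  by_cases h : G z = 0
  · exact hG.hasDerivAt.eventually_ne (hz h)
  · exact (hG.continuousAt.eventually_ne h).filter_mono nhdsWithin_le_nhds

lemma deriv_add_of_multiplier {z : ℂ} (hG : Differentiable ℂ G) (hm : DifferentiableAt ℂ m z)
    (h : ∀ z, G (z + ω) = m z * G z) (hz : G z = 0) :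
    deriv G (z + ω) = m z * deriv G z := by
  rw [← deriv_comp_add_const, show (fun w => G (w + ω)) = fun w => m w * G w from funext h,
    deriv_fun_mul hm (hG z), hz, mul_zero, zero_add]

lemma isSimpleZero_add_iff {z : ℂ} (hG : Differentiable ℂ G) (hm : Differentiable ℂ m)
    (hm₀ : ∀ z, m z ≠ 0) (h : ∀ z, G (z + ω) = m z * G z) :
    (G (z + ω) = 0 ∧ deriv G (z + ω) ≠ 0) ↔ (G z = 0 ∧ deriv G z ≠ 0) := by
  rw [h, mul_eq_zero, or_iff_right (hm₀ z)]
  refine and_congr_right fun hz => ?_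
  rw [deriv_add_of_multiplier hG (hm z) h hz, mul_ne_zero_iff, and_iff_right (hm₀ z)]

lemma apply_add_of_mem_span_pair {α : Type*} {f : ℂ → α} {ω₁ ω₂ w : ℂ}
    (h₁ : Function.Periodic f ω₁) (h₂ : Function.Periodic f ω₂)
    (hw : w ∈ Submodule.span ℤ {ω₁, ω₂}) (z : ℂ) : f (z + w) = f z := by
  obtain ⟨k, l, rfl⟩ := Submodule.mem_span_pair.1 hw
  rw [zsmul_eq_mul, zsmul_eq_mul, ← add_assoc, h₂.int_mul l, h₁.int_mul k]

lemma deriv_mul_ne_zero (hF : Differentiable ℂ F) (hG : Differentiable ℂ G)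
    (hF' : ∀ z, F z = 0 → deriv F z ≠ 0) (hG' : ∀ z, G z = 0 → deriv G z ≠ 0)
    (hFG : ∀ z, F z = 0 → G z ≠ 0) (z : ℂ) (hz : F z * G z = 0) :
    deriv (fun w => F w * G w) z ≠ 0 := by
  rw [deriv_fun_mul (hF z) (hG z)]
  by_cases hFz : F z = 0
  · simpa [hFz] using ⟨hF' z hFz, hFG z hFz⟩
  · have hGz : G z = 0 := (mul_eq_zero.1 hz).resolve_left hFz
    simpa [hGz] using ⟨hFz, hG' z hGz⟩

/-- The quotient `F / G` of two entire functions, continued to the zeros of `G` by L'Hôpital's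
rule; it is entire when the zeros of `G` are simple and are zeros of `F`. -/
def continuedQuotient (F G : ℂ → ℂ) (z : ℂ) : ℂ :=
  open Classical in if G z = 0 then deriv F z / deriv G z else F z / G z

lemma continuedQuotient_of_ne {z : ℂ} (hz : G z ≠ 0) : continuedQuotient F G z = F z / G z :=
  if_neg hz

lemma differentiable_dslope {f : ℂ → ℂ} (hf : Differentiable ℂ f) (z : ℂ) :
    Differentiable ℂ (dslope f z) :=
  differentiableOn_univ.1
    ((Complex.differentiableOn_dslope Filter.univ_mem).2 hf.differentiableOn)

lemma differentiable_continuedQuotient (hF : Differentiable ℂ F) (hG : Differentiable ℂ G)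
    (hG' : ∀ z, G z = 0 → deriv G z ≠ 0) (hFG : ∀ z, G z = 0 → F z = 0) :
    Differentiable ℂ (continuedQuotient F G) := by
  intro z
  by_cases hz : G z = 0
  · have hne : dslope G z z ≠ 0 := by rw [dslope_same]; exact hG' z hz
    refine ((differentiable_dslope hF z z).div (differentiable_dslope hG z z)
      hne).congr_of_eventuallyEq ?_
    filter_upwards [eventually_nhdsWithin_iff.1
      (eventually_ne_zero_of_deriv_ne_zero (hG z) (hG' z))] with w hw
    rcases eq_or_ne w z with rfl | hwz
    · simp [continuedQuotient, hz]
    · have hs : w - z ≠ 0 := sub_ne_zero.2 hwz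
      simp only [continuedQuotient_of_ne (hw hwz), Pi.div_apply, dslope_of_ne _ hwz,
        slope_def_field, hz, hFG z hz, sub_zero]
      field_simp
  · refine ((hF z).div (hG z) hz).congr_of_eventuallyEq ?_
    filter_upwards [(hG z).continuousAt.eventually_ne hz] with w hw
    exact continuedQuotient_of_ne hw

lemma periodic_continuedQuotient (hF : Differentiable ℂ F) (hG : Differentiable ℂ G)
    (hG' : ∀ z, G z = 0 → deriv G z ≠ 0) (hFG : ∀ z, G z = 0 → F z = 0) (hm : ∀ z, m z ≠ 0)
    (hFm : ∀ z, F (z + ω) = m z * F z) (hGm : ∀ z, G (z + ω) = m z * G z) :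
    Function.Periodic (continuedQuotient F G) ω := by
  intro z
  have hc := (differentiable_continuedQuotient hF hG hG' hFG).continuous
  have hev : ∀ᶠ w in 𝓝[≠] z, continuedQuotient F G (w + ω) = continuedQuotient F G w := by
    filter_upwards [eventually_ne_zero_of_deriv_ne_zero (hG z) (hG' z)] with w hw
    have hw' : G (w + ω) ≠ 0 := by rw [hGm]; exact mul_ne_zero (hm w) hw
    rw [continuedQuotient_of_ne hw, continuedQuotient_of_ne hw', hFm, hGm,
      mul_div_mul_left _ _ (hm w)]
  have hleft : Filter.Tendsto (fun w => continuedQuotient F G (w + ω)) (𝓝[≠] z)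
      (𝓝 (continuedQuotient F G (z + ω))) :=
    ((hc.comp (continuous_add_const ω)).tendsto z).mono_left nhdsWithin_le_nhds
  exact tendsto_nhds_unique (hleft.congr' hev) ((hc.tendsto z).mono_left nhdsWithin_le_nhds)

variable (L : PeriodPair)

lemma isBounded_range_of_periodic {E : Type*} [PseudoMetricSpace E] {h : ℂ → E} (hc : Continuous h)
    (h₁ : Function.Periodic h L.ω₁) (h₂ : Function.Periodic h L.ω₂) :
    Bornology.IsBounded (Set.range h) := by
  have hcpt := (ZSpan.fundamentalDomain_isBounded L.basis).isCompact_closure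
  refine (hcpt.image hc).isBounded.subset ?_
  rintro _ ⟨z, rfl⟩
  refine ⟨ZSpan.fract L.basis z, subset_closure (ZSpan.fract_mem_fundamentalDomain _ z), ?_⟩
  have hfloor : (ZSpan.floor L.basis z : ℂ) ∈ L.lattice := by
    rw [L.lattice_eq_span_range_basis]
    exact (ZSpan.floor L.basis z).2
  rw [ZSpan.fract_apply, sub_eq_add_neg,
    apply_add_of_mem_span_pair h₁ h₂ (L.lattice.neg_mem hfloor)]

lemma exists_eq_const_mul_of_multipliers {m₁ m₂ : ℂ → ℂ} (hF : Differentiable ℂ F)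
    (hG : Differentiable ℂ G) (hG' : ∀ z, G z = 0 → deriv G z ≠ 0) (hFG : ∀ z, G z = 0 → F z = 0)
    (hm₁ : ∀ z, m₁ z ≠ 0) (hm₂ : ∀ z, m₂ z ≠ 0)
    (hF₁ : ∀ z, F (z + L.ω₁) = m₁ z * F z) (hG₁ : ∀ z, G (z + L.ω₁) = m₁ z * G z)
    (hF₂ : ∀ z, F (z + L.ω₂) = m₂ z * F z) (hG₂ : ∀ z, G (z + L.ω₂) = m₂ z * G z) :
    ∃ k : ℂ, ∀ z, F z = k * G z := by
  have hd := differentiable_continuedQuotient hF hG hG' hFG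
  have hb := isBounded_range_of_periodic L hd.continuous
    (periodic_continuedQuotient hF hG hG' hFG hm₁ hF₁ hG₁)
    (periodic_continuedQuotient hF hG hG' hFG hm₂ hF₂ hG₂)
  refine ⟨continuedQuotient F G 0, fun z => ?_⟩
  by_cases hz : G z = 0
  · rw [hz, hFG z hz, mul_zero]
  · rw [← hd.apply_eq_apply_of_bounded hb z 0, continuedQuotient_of_ne hz, div_mul_cancel₀ _ hz]

end QuasiPeriodic

section Theta

variable {z τ : ℂ}

lemma hasSum_theta (hτ : 0 < τ.im) (z : ℂ) :
    HasSum (fun n : ℕ => (-1 : ℂ) ^ n * cexp (I * π * τ * ((n : ℂ) + 1 / 2) ^ 2) *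
      (cexp ((2 * (n : ℂ) + 1) * I * z) - cexp (-((2 * (n : ℂ) + 1) * I * z))))
      (cexp (I * π * τ / 4 + I * z) * jacobiTheta₂ (z / π + 1 / 2 + τ / 2) τ) := by
  -- The terms of index `n` and `-n - 1` of the two-sided series are the two halves of the `n`-th
  -- term of `theta`.
  refine ((hasSum_jacobiTheta₂_term (z / π + 1 / 2 + τ / 2) hτ).mul_left
    (cexp (I * π * τ / 4 + I * z))).nat_add_neg_add_one.congr_fun fun n => ?_
  rw [mul_sub, jacobiTheta₂_term, jacobiTheta₂_term, ← Complex.exp_add, ← Complex.exp_add,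
    ← Complex.exp_pi_mul_I, ← Complex.exp_nat_mul, ← Complex.exp_add, ← Complex.exp_add,
    ← Complex.exp_add, sub_eq_add_neg]
  congr 1
  · congr 1
    push_cast
    field_simp
    ring
  · rw [← neg_one_mul, ← Complex.exp_pi_mul_I, ← Complex.exp_add,
      Complex.exp_eq_exp_iff_exists_int]
    refine ⟨n + 1, ?_⟩
    push_cast
    field_simp
    ring

lemma theta_eq_jacobiTheta₂ (hτ : 0 < τ.im) (z : ℂ) :
    theta z τ = cexp (I * π * τ / 4 + I * z) * jacobiTheta₂ (z / π + 1 / 2 + τ / 2) τ :=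
  (hasSum_theta hτ z).tsum_eq

lemma theta_neg (z τ : ℂ) : theta (-z) τ = -theta z τ := by
  rw [theta, theta, ← tsum_neg]
  congr! 2 with n
  simp only [mul_neg, neg_neg]
  ring

@[simp]
lemma theta_zero (τ : ℂ) : theta 0 τ = 0 := by simp [theta]

lemma theta_conj (z τ : ℂ) : theta (conj z) (-conj τ) = -conj (theta z τ) := by
  rw [theta, theta, Complex.conj_tsum, ← tsum_neg]
  congr! 2 with n
  simp only [map_mul, map_sub, map_pow, map_neg, map_one, ← Complex.exp_conj, map_add, map_div₀,
    map_ofNat, Complex.conj_ofReal, Complex.conj_I, Complex.conj_natCast]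
  ring_nf

lemma differentiable_theta (hτ : 0 < τ.im) : Differentiable ℂ fun z => theta z τ := by
  intro z
  rw [funext (theta_eq_jacobiTheta₂ hτ)]
  exact DifferentiableAt.mul (by fun_prop)
    ((differentiableAt_jacobiTheta₂_fst _ hτ).comp z (by fun_prop))

lemma continuousAt_theta (hτ : 0 < τ.im) (z : ℂ) :
    ContinuousAt (fun p : ℂ × ℂ => theta p.1 p.2) (z, τ) := by
  have heq : (fun p : ℂ × ℂ => theta p.1 p.2) =ᶠ[𝓝 (z, τ)] fun p =>
      cexp (I * π * p.2 / 4 + I * p.1) * jacobiTheta₂ (p.1 / π + 1 / 2 + p.2 / 2) p.2 := by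
    filter_upwards [(isOpen_lt continuous_const (Complex.continuous_im.comp
      continuous_snd)).mem_nhds hτ] with p hp
    exact theta_eq_jacobiTheta₂ hp p.1
  refine ContinuousAt.congr (ContinuousAt.mul (by fun_prop) ?_) heq.symm
  exact (continuousAt_jacobiTheta₂ (z / π + 1 / 2 + τ / 2) hτ).comp
    (f := fun p : ℂ × ℂ => (p.1 / π + 1 / 2 + p.2 / 2, p.2)) (x := (z, τ)) (by fun_prop)

lemma theta_add_pi (z τ : ℂ) : theta (z + π) τ = -theta z τ := by
  rw [theta, theta, ← tsum_neg]
  congr! 2 with n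
  have hexp : cexp ((2 * (n : ℂ) + 1) * I * (z + π)) = -cexp ((2 * (n : ℂ) + 1) * I * z) := by
    rw [show (2 * (n : ℂ) + 1) * I * (z + π) =
      (2 * (n : ℂ) + 1) * I * z + π * I + n * (2 * π * I) by ring, Complex.exp_add,
      Complex.exp_add, Complex.exp_nat_mul_two_pi_mul_I, Complex.exp_pi_mul_I]
    ring
  rw [Complex.exp_neg, Complex.exp_neg, hexp, inv_neg]
  ring

lemma theta_add_pi_mul (hτ : 0 < τ.im) (z : ℂ) :
    theta (z + π * τ) τ = -cexp (-(I * π * τ) - 2 * I * z) * theta z τ := by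
  rw [theta_eq_jacobiTheta₂ hτ, theta_eq_jacobiTheta₂ hτ,
    show (z + π * τ) / π + 1 / 2 + τ / 2 = (z / π + 1 / 2 + τ / 2) + τ by field_simp; ring,
    jacobiTheta₂_add_left', ← mul_assoc, ← mul_assoc, ← Complex.exp_add,
    show I * π * τ / 4 + I * (z + π * τ) + -π * I * (τ + 2 * (z / π + 1 / 2 + τ / 2)) =
      (-(I * π * τ) - 2 * I * z) + (I * π * τ / 4 + I * z) - π * I by field_simp; ring,
    Complex.exp_sub, Complex.exp_add, Complex.exp_pi_mul_I]
  ring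

lemma neg_one_div_im_pos (hτ : 0 < τ.im) : 0 < (-1 / τ).im := by
  have hτ0 : τ ≠ 0 := fun h => by simp [h] at hτ
  rw [neg_div, Complex.neg_im, one_div, Complex.inv_im, neg_div, neg_neg]
  exact div_pos hτ (Complex.normSq_pos.2 hτ0)

lemma theta_functional_equation (hτ : 0 < τ.im) (z : ℂ) :
    theta z τ = I / (-I * τ) ^ (1 / 2 : ℂ) * cexp (-(I * z ^ 2) / (π * τ)) *
      theta (z / τ) (-1 / τ) := by
  have hτ0 : τ ≠ 0 := fun h => by simp [h] at hτ
  set v : ℂ := z / τ / π + 1 / 2 + -1 / τ / 2 with hv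
  have hshift : jacobiTheta₂ ((z / π + 1 / 2 + τ / 2) / τ) (-1 / τ) =
      cexp (π * I * (2 * v + 1 / τ)) * jacobiTheta₂ v (-1 / τ) := by
    rw [show v = (z / π + 1 / 2 + τ / 2) / τ + -1 / τ by rw [hv]; field_simp; ring,
      jacobiTheta₂_add_left', ← mul_assoc, ← Complex.exp_add]
    ring_nf
    simp
  rw [theta_eq_jacobiTheta₂ hτ, theta_eq_jacobiTheta₂ (neg_one_div_im_pos hτ),
    jacobiTheta₂_functional_equation, hshift]
  have hexp : cexp (I * π * τ / 4 + I * z) * cexp (-π * I * (z / π + 1 / 2 + τ / 2) ^ 2 / τ) *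
      cexp (π * I * (2 * v + 1 / τ)) =
      cexp (π / 2 * I) * cexp (-(I * z ^ 2) / (π * τ)) *
        cexp (I * π * (-1 / τ) / 4 + I * (z / τ)) := by
    simp only [← Complex.exp_add]
    congr 1
    rw [hv]
    field_simp
    ring
  rw [Complex.exp_pi_div_two_mul_I] at hexp
  linear_combination (1 / (-I * τ) ^ (1 / 2 : ℂ) * jacobiTheta₂ v (-1 / τ)) * hexp

lemma integral_jacobiTheta₂_term (n : ℤ) (τ : ℂ) :
    ∫ x in (0 : ℝ)..1, jacobiTheta₂_term n x τ = if n = 0 then 1 else 0 := by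
  split_ifs with hn
  · simp [jacobiTheta₂_term, hn]
  · have hc : 2 * π * I * n ≠ 0 := by simp [Real.pi_ne_zero, hn]
    simp only [jacobiTheta₂_term, Complex.exp_add]
    rw [intervalIntegral.integral_mul_const, integral_exp_mul_complex hc, Complex.ofReal_one,
      mul_one, mul_comm _ (n : ℂ), Complex.exp_int_mul_two_pi_mul_I]
    simp

lemma integral_jacobiTheta₂ (hτ : 0 < τ.im) : ∫ x in (0 : ℝ)..1, jacobiTheta₂ x τ = 1 := by
  let f : ℤ → C(ℝ, ℂ) := fun n =>
    ⟨fun x => jacobiTheta₂_term n x τ, by unfold jacobiTheta₂_term; fun_prop⟩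
  have hsum : Summable fun n =>
      ‖(f n).restrict (⟨Set.uIcc 0 1, isCompact_uIcc⟩ : TopologicalSpace.Compacts ℝ)‖ := by
    refine ((summable_jacobiTheta₂_term_iff 0 τ).2 hτ).norm.of_nonneg_of_le
      (fun _ => norm_nonneg _) fun n => ?_
    refine (ContinuousMap.norm_le _ (norm_nonneg _)).2 fun x => ?_
    simp [f, norm_jacobiTheta₂_term]
  have h := intervalIntegral.hasSum_intervalIntegral_of_summable_norm hsum
  simp only [f, ContinuousMap.coe_mk, integral_jacobiTheta₂_term] at h
  exact h.unique (hasSum_ite_eq 0 1)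

lemma exists_theta_ne_zero (hτ : 0 < τ.im) : ∃ z, theta z τ ≠ 0 := by
  by_contra! h
  have hzero : ∀ w, jacobiTheta₂ w τ = 0 := fun w => by
    have hw := theta_eq_jacobiTheta₂ hτ (π * (w - 1 / 2 - τ / 2))
    rw [h, show π * (w - 1 / 2 - τ / 2) / π + 1 / 2 + τ / 2 = w by field_simp; ring] at hw
    exact (mul_eq_zero.1 hw.symm).resolve_left (Complex.exp_ne_zero _)
  simpa [hzero] using integral_jacobiTheta₂ hτ

end Theta

section QPochhammer

/-- The `q`-Pochhammer symbol `(u; q)_∞ = ∏ₙ (1 - u q ^ n)`, the building block of the product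
expansion of the theta function. -/
def qPochhammer (u q : ℂ) : ℂ := ∏' n : ℕ, (1 - u * q ^ n)

variable {u v q : ℂ}

lemma summable_norm_mul_pow (hq : ‖q‖ < 1) (u : ℂ) : Summable fun n : ℕ => ‖-(u * q ^ n)‖ := by
  simpa only [norm_neg, norm_mul, norm_pow] using
    (summable_geometric_of_lt_one (norm_nonneg q) hq).mul_left ‖u‖

lemma multipliable_qPochhammer (hq : ‖q‖ < 1) (u : ℂ) :
    Multipliable fun n : ℕ => 1 - u * q ^ n := by
  simpa only [sub_eq_add_neg] using multipliable_one_add_of_summable (summable_norm_mul_pow hq u)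

lemma differentiable_qPochhammer (hq : ‖q‖ < 1) :
    Differentiable ℂ fun u => qPochhammer u q := by
  have hprod : HasProdLocallyUniformlyOn (fun (n : ℕ) (u : ℂ) => 1 + -(u * q ^ n))
      (fun u => ∏' n : ℕ, (1 + -(u * q ^ n))) Set.univ := by
    refine hasProdLocallyUniformlyOn_of_forall_compact isOpen_univ fun K _ hK => ?_
    obtain ⟨R, hR⟩ := hK.isBounded.exists_norm_le
    refine ((summable_geometric_of_lt_one (norm_nonneg q) hq).mul_left
      R).hasProdUniformlyOn_nat_one_add hK (.of_forall fun n x hx => ?_) (fun _ => by fun_prop)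
    rw [norm_neg, norm_mul, norm_pow]
    exact mul_le_mul_of_nonneg_right (hR x hx) (by positivity)
  rw [← differentiableOn_univ]
  simpa only [qPochhammer, sub_eq_add_neg] using! hprod.differentiableOn
    (.of_forall fun _ => by
      simpa [Finset.prod_fn] using DifferentiableOn.finsetProd (fun _ _ => by fun_prop))
    isOpen_univ

lemma qPochhammer_eq_mul (hq : ‖q‖ < 1) (u : ℂ) :
    qPochhammer u q = (1 - u) * qPochhammer (q * u) q := by
  have hfun : (fun n : ℕ => 1 - q * u * q ^ n) = fun n => 1 - u * q ^ (n + 1) := by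
    ext n; ring
  rw [qPochhammer, qPochhammer, hfun,
    tprod_eq_zero_mul' (hfun ▸ multipliable_qPochhammer hq (q * u)), pow_zero, mul_one]

lemma qPochhammer_ne_zero (hq : ‖q‖ < 1) (hu : ∀ n : ℕ, u * q ^ n ≠ 1) : qPochhammer u q ≠ 0 := by
  simpa only [qPochhammer, sub_eq_add_neg] using! tprod_one_add_ne_zero_of_summable
    (f := fun n : ℕ => -(u * q ^ n))
    (fun n => by simpa only [← sub_eq_add_neg] using sub_ne_zero.2 (hu n).symm)
    (summable_norm_mul_pow hq u)

lemma norm_one_sub_mul_ofReal_sq (u : ℂ) (s : ℝ) :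
    ‖1 - u * s‖ ^ 2 = 1 - 2 * s * u.re + s ^ 2 * ‖u‖ ^ 2 := by
  rw [← Complex.normSq_eq_norm_sq, ← Complex.normSq_eq_norm_sq, Complex.normSq_apply,
    Complex.normSq_apply]
  simp only [Complex.sub_re, Complex.one_re, Complex.re_mul_ofReal, Complex.sub_im, Complex.one_im,
    Complex.im_mul_ofReal]
  ring

variable {r : ℝ}

lemma norm_qPochhammer_le (h₀ : 0 ≤ r) (h₁ : r < 1) (huv : ‖u‖ = ‖v‖) (hre : v.re ≤ u.re) :
    ‖qPochhammer u r‖ ≤ ‖qPochhammer v r‖ := by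
  have hr : ‖(r : ℂ)‖ < 1 := by rwa [Complex.norm_of_nonneg h₀]
  refine le_of_tendsto_of_tendsto' (multipliable_qPochhammer hr u).hasProd.norm
    (multipliable_qPochhammer hr v).hasProd.norm fun s =>
      Finset.prod_le_prod (fun _ _ => norm_nonneg _) fun n _ => ?_
  refine le_of_sq_le_sq ?_ (norm_nonneg _)
  rw [← Complex.ofReal_pow, norm_one_sub_mul_ofReal_sq, norm_one_sub_mul_ofReal_sq, huv]
  have : 0 ≤ r ^ n := pow_nonneg h₀ n
  nlinarith

lemma norm_qPochhammer_lt (h₀ : 0 ≤ r) (h₁ : r < 1) (huv : ‖u‖ = ‖v‖) (hre : v.re < u.re) :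
    ‖qPochhammer u r‖ < ‖qPochhammer v r‖ := by
  have hr : ‖(r : ℂ)‖ < 1 := by rwa [Complex.norm_of_nonneg h₀]
  have hv : qPochhammer (r * v) r ≠ 0 := by
    -- A zero would make `v` a positive real number, so that `u.re ≤ ‖u‖ = ‖v‖ = v.re`.
    refine qPochhammer_ne_zero hr fun n hn => ?_
    have hv_real : v = ((r ^ (n + 1))⁻¹ : ℝ) := by
      push_cast
      refine eq_inv_of_mul_eq_one_left ?_
      rw [← hn]
      ring
    have hv_norm : ‖v‖ = v.re := by
      rw [hv_real, Complex.ofReal_re, Complex.norm_of_nonneg (by positivity)]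
    linarith [Complex.re_le_norm u]
  have hone : ‖1 - u‖ < ‖1 - v‖ := by
    have hu' := norm_one_sub_mul_ofReal_sq u 1
    have hv' := norm_one_sub_mul_ofReal_sq v 1
    rw [Complex.ofReal_one, mul_one] at hu' hv'
    refine lt_of_pow_lt_pow_left₀ 2 (norm_nonneg _) ?_
    rw [hu', hv', huv]
    linarith
  have hrest : ‖qPochhammer (r * u) r‖ ≤ ‖qPochhammer (r * v) r‖ := by
    refine norm_qPochhammer_le h₀ h₁ (by rw [norm_mul, norm_mul, huv]) ?_
    simpa only [Complex.re_ofReal_mul] using mul_le_mul_of_nonneg_left hre.le h₀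
  rw [qPochhammer_eq_mul hr u, qPochhammer_eq_mul hr v, norm_mul, norm_mul]
  calc ‖1 - u‖ * ‖qPochhammer (r * u) r‖ ≤ ‖1 - u‖ * ‖qPochhammer (r * v) r‖ := by gcongr
    _ < ‖1 - v‖ * ‖qPochhammer (r * v) r‖ := mul_lt_mul_of_pos_right hone (norm_pos_iff.2 hv)

end QPochhammer

section ThetaProduct

/-- The lattice `π ℤ + π τ ℤ` of quasi-periods of `ϑ(·|τ)`. -/
def periodLattice (τ : ℂ) : Submodule ℤ ℂ := Submodule.span ℤ {(π : ℂ), π * τ}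

/-- The square `e^{2πiτ}` of the nome, in which the theta function has its product expansion. -/
def nomeSq (τ : ℂ) : ℂ := cexp (2 * π * I * τ)

/-- The product expansion of `ϑ(·|τ)`, up to a constant factor. -/
def thetaProd (z τ : ℂ) : ℂ :=
  cexp (-(I * z)) * (qPochhammer (cexp (2 * I * z)) (nomeSq τ) *
    qPochhammer (nomeSq τ * cexp (-(2 * I * z))) (nomeSq τ))

variable {z w τ : ℂ}

lemma mem_periodLattice : z ∈ periodLattice τ ↔ ∃ k l : ℤ, k * (π : ℂ) + l * (π * τ) = z := by
  simp only [periodLattice, Submodule.mem_span_pair, zsmul_eq_mul]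

lemma norm_nomeSq (τ : ℂ) : ‖nomeSq τ‖ = rexp (-(2 * π * τ.im)) := by
  rw [nomeSq, Complex.norm_exp]
  simp

lemma norm_nomeSq_lt_one (hτ : 0 < τ.im) : ‖nomeSq τ‖ < 1 := by
  rw [norm_nomeSq, Real.exp_lt_one_iff]
  have := mul_pos Real.two_pi_pos hτ
  linarith

lemma nomeSq_pow (τ : ℂ) (n : ℕ) : nomeSq τ ^ n = cexp (n * (2 * π * I * τ)) := by
  rw [nomeSq, ← Complex.exp_nat_mul]

lemma thetaProd_eq_one_sub_mul (hτ : 0 < τ.im) (z : ℂ) :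
    thetaProd z τ = (1 - cexp (2 * I * z)) * (cexp (-(I * z)) *
      (qPochhammer (nomeSq τ * cexp (2 * I * z)) (nomeSq τ) *
        qPochhammer (nomeSq τ * cexp (-(2 * I * z))) (nomeSq τ))) := by
  rw [thetaProd, qPochhammer_eq_mul (norm_nomeSq_lt_one hτ) (cexp (2 * I * z))]
  ring

lemma differentiable_thetaProd (hτ : 0 < τ.im) : Differentiable ℂ fun z => thetaProd z τ := by
  have hp := differentiable_qPochhammer (norm_nomeSq_lt_one hτ)
  unfold thetaProd
  refine Differentiable.mul (by fun_prop) (Differentiable.mul (hp.comp ?_) (hp.comp ?_)) <;>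
    fun_prop

lemma thetaProd_add_pi (z τ : ℂ) : thetaProd (z + π) τ = -thetaProd z τ := by
  have hplus : cexp (2 * I * (z + π)) = cexp (2 * I * z) := by
    rw [Complex.exp_eq_exp_iff_exists_int]
    exact ⟨1, by push_cast; ring⟩
  have hhalf : cexp (-(I * (z + π))) = -cexp (-(I * z)) := by
    rw [show -(I * (z + π)) = -(I * z) - π * I by ring, Complex.exp_sub, Complex.exp_pi_mul_I]
    ring
  rw [thetaProd, thetaProd, Complex.exp_neg (2 * I * (z + π)), hplus, hhalf,
    ← Complex.exp_neg (2 * I * z)]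
  ring

lemma thetaProd_add_pi_mul (hτ : 0 < τ.im) (z : ℂ) :
    thetaProd (z + π * τ) τ = -cexp (-(I * π * τ) - 2 * I * z) * thetaProd z τ := by
  have hplus : cexp (2 * I * (z + π * τ)) = nomeSq τ * cexp (2 * I * z) := by
    rw [nomeSq, ← Complex.exp_add]
    ring_nf
  have hminus : nomeSq τ * cexp (-(2 * I * (z + π * τ))) = cexp (-(2 * I * z)) := by
    rw [nomeSq, ← Complex.exp_add]
    ring_nf
  have hhalf : cexp (-(I * (z + π * τ))) =
      cexp (-(I * π * τ) - 2 * I * z) * cexp (2 * I * z) * cexp (-(I * z)) := by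
    rw [← Complex.exp_add, ← Complex.exp_add]
    ring_nf
  have hinv : cexp (2 * I * z) * cexp (-(2 * I * z)) = 1 := by
    rw [← Complex.exp_add, add_neg_cancel, Complex.exp_zero]
  rw [thetaProd_eq_one_sub_mul hτ z, thetaProd, hplus, hminus, hhalf,
    qPochhammer_eq_mul (norm_nomeSq_lt_one hτ) (cexp (-(2 * I * z)))]
  linear_combination (-cexp (-(I * π * τ) - 2 * I * z) * cexp (-(I * z)) *
    qPochhammer (nomeSq τ * cexp (2 * I * z)) (nomeSq τ) *
      qPochhammer (nomeSq τ * cexp (-(2 * I * z))) (nomeSq τ)) * hinv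

lemma mem_periodLattice_of_exp_eq_one {k : ℤ} (h : cexp (2 * I * (z + k * (π * τ))) = 1) :
    z ∈ periodLattice τ := by
  obtain ⟨n, hn⟩ := Complex.exp_eq_one_iff.1 h
  refine mem_periodLattice.2 ⟨n, -k, ?_⟩
  have : z + k * (π * τ) = n * π :=
    mul_left_cancel₀ (mul_ne_zero two_ne_zero Complex.I_ne_zero) (by rw [hn]; ring)
  push_cast
  linear_combination -this

lemma mem_periodLattice_of_thetaProd_eq_zero (hτ : 0 < τ.im) (hz : thetaProd z τ = 0) :
    z ∈ periodLattice τ := by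
  by_contra hL
  refine mul_ne_zero (Complex.exp_ne_zero _) (mul_ne_zero ?_ ?_) hz
  · refine qPochhammer_ne_zero (norm_nomeSq_lt_one hτ) fun n hn => hL ?_
    rw [nomeSq_pow, ← Complex.exp_add] at hn
    exact mem_periodLattice_of_exp_eq_one (k := n) (by rw [← hn]; push_cast; ring_nf)
  · refine qPochhammer_ne_zero (norm_nomeSq_lt_one hτ) fun n hn => hL ?_
    rw [mul_right_comm, ← pow_succ', nomeSq_pow, ← Complex.exp_add] at hn
    rw [← neg_mem_iff]
    exact mem_periodLattice_of_exp_eq_one (k := n + 1) (by rw [← hn]; push_cast; ring_nf)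

lemma deriv_thetaProd_zero_ne_zero (hτ : 0 < τ.im) : deriv (fun z => thetaProd z τ) 0 ≠ 0 := by
  have hp := differentiable_qPochhammer (norm_nomeSq_lt_one hτ)
  have hcofactor : Differentiable ℂ fun z => cexp (-(I * z)) *
      (qPochhammer (nomeSq τ * cexp (2 * I * z)) (nomeSq τ) *
        qPochhammer (nomeSq τ * cexp (-(2 * I * z))) (nomeSq τ)) := by
    refine Differentiable.mul (by fun_prop) (Differentiable.mul (hp.comp ?_) (hp.comp ?_)) <;>
      fun_prop
  have hfactor : HasDerivAt (fun z : ℂ => 1 - cexp (2 * I * z)) (-(2 * I)) 0 := by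
    simpa using ((hasDerivAt_id (0 : ℂ)).const_mul (2 * I)).cexp.const_sub 1
  have hq : qPochhammer (nomeSq τ) (nomeSq τ) ≠ 0 := by
    refine qPochhammer_ne_zero (norm_nomeSq_lt_one hτ) fun n hn => ?_
    have hlt := pow_lt_one₀ (norm_nonneg (nomeSq τ)) (norm_nomeSq_lt_one hτ) n.succ_ne_zero
    rw [← norm_pow, pow_succ', hn, norm_one] at hlt
    exact hlt.false
  rw [funext (thetaProd_eq_one_sub_mul hτ), (hfactor.fun_mul (hcofactor 0).hasDerivAt).deriv]
  simp [hq]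

lemma deriv_thetaProd_ne_zero (hτ : 0 < τ.im) (hz : thetaProd z τ = 0) :
    deriv (fun z => thetaProd z τ) z ≠ 0 := by
  have hG := differentiable_thetaProd hτ
  let isSimpleZero : ℂ → Prop := fun z => thetaProd z τ = 0 ∧ deriv (fun z => thetaProd z τ) z ≠ 0
  have hpi : Function.Periodic isSimpleZero π := fun z => propext <|
    isSimpleZero_add_iff hG (m := fun _ => -1) (by fun_prop) (by simp)
      fun z => by rw [thetaProd_add_pi]; ring
  have hpi_mul : Function.Periodic isSimpleZero (π * τ) := fun z => propext <|
    isSimpleZero_add_iff hG (by fun_prop) (by simp [Complex.exp_ne_zero]) (thetaProd_add_pi_mul hτ)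
  have hzero := apply_add_of_mem_span_pair hpi hpi_mul
    (mem_periodLattice_of_thetaProd_eq_zero hτ hz) 0
  rw [zero_add] at hzero
  refine (hzero.mpr ⟨?_, deriv_thetaProd_zero_ne_zero hτ⟩).2
  simp [thetaProd_eq_one_sub_mul hτ]

/-- The quasi-periods of `ϑ(·|τ)` as a pair of `ℝ`-linearly independent periods. -/
def thetaPeriods (hτ : 0 < τ.im) : PeriodPair where
  ω₁ := π
  ω₂ := π * τ
  indep := by
    rw [LinearIndependent.pair_iff]
    intro s t hst
    have him := congrArg Complex.im hst
    have hre := congrArg Complex.re hst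
    have ht : t = 0 := by simpa [Real.pi_ne_zero, hτ.ne'] using him
    have hs : s = 0 := by simpa [ht, Real.pi_ne_zero] using hre
    exact ⟨hs, ht⟩

lemma theta_eq_zero_of_mem_periodLattice (hτ : 0 < τ.im) (hz : z ∈ periodLattice τ) :
    theta z τ = 0 := by
  have hpi : Function.Periodic (fun z => theta z τ = 0) (π : ℂ) := fun z => by
    simp [theta_add_pi]
  have hpi_mul : Function.Periodic (fun z => theta z τ = 0) (π * τ) := fun z => by
    simp [theta_add_pi_mul hτ, Complex.exp_ne_zero]
  have hzero := apply_add_of_mem_span_pair hpi hpi_mul hz 0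
  rw [zero_add] at hzero
  exact hzero.mpr (theta_zero τ)

lemma exists_theta_eq_mul_thetaProd (hτ : 0 < τ.im) :
    ∃ C : ℂ, C ≠ 0 ∧ ∀ z, theta z τ = C * thetaProd z τ := by
  obtain ⟨C, hC⟩ := exists_eq_const_mul_of_multipliers (thetaPeriods hτ) (differentiable_theta hτ)
    (differentiable_thetaProd hτ) (fun z => deriv_thetaProd_ne_zero hτ)
    (fun z hz => theta_eq_zero_of_mem_periodLattice hτ
      (mem_periodLattice_of_thetaProd_eq_zero hτ hz))
    (m₁ := fun _ => -1) (m₂ := fun z => -cexp (-(I * π * τ) - 2 * I * z))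
    (by simp) (by simp [Complex.exp_ne_zero])
    (fun z => (theta_add_pi z τ).trans (neg_one_mul _).symm)
    (fun z => (thetaProd_add_pi z τ).trans (neg_one_mul _).symm)
    (theta_add_pi_mul hτ) (thetaProd_add_pi_mul hτ)
  obtain ⟨w, hw⟩ := exists_theta_ne_zero hτ
  exact ⟨C, left_ne_zero_of_mul (hC w ▸ hw), hC⟩

lemma theta_eq_zero_iff (hτ : 0 < τ.im) : theta z τ = 0 ↔ z ∈ periodLattice τ := by
  refine ⟨fun h => ?_, theta_eq_zero_of_mem_periodLattice hτ⟩
  obtain ⟨C, hC, heq⟩ := exists_theta_eq_mul_thetaProd hτ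
  rw [heq, mul_eq_zero] at h
  exact mem_periodLattice_of_thetaProd_eq_zero hτ (h.resolve_left hC)

lemma deriv_theta_ne_zero (hτ : 0 < τ.im) (hz : theta z τ = 0) :
    deriv (fun w => theta w τ) z ≠ 0 := by
  obtain ⟨C, hC, heq⟩ := exists_theta_eq_mul_thetaProd hτ
  rw [heq, mul_eq_zero] at hz
  rw [funext heq, deriv_const_mul _ (differentiable_thetaProd hτ z)]
  exact mul_ne_zero hC (deriv_thetaProd_ne_zero hτ (hz.resolve_left hC))

end ThetaProduct

section ThetaIdentities

variable {a b c d γ z w τ : ℂ}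

lemma hasDerivAt_theta (hτ : 0 < τ.im) (z : ℂ) :
    HasDerivAt (fun w => theta w τ) (thetaDeriv z τ) z :=
  (differentiable_theta hτ z).hasDerivAt

lemma thetaDeriv_neg (z τ : ℂ) : thetaDeriv (-z) τ = thetaDeriv z τ := by
  have h : deriv (fun w => theta (-w) τ) z = -thetaDeriv (-z) τ :=
    deriv_comp_neg (fun w => theta w τ) z
  rw [funext (theta_neg · τ), deriv.fun_neg] at h
  exact (neg_injective h).symm

lemma theta_add_eq_zero_iff (hτ : 0 < τ.im) :
    theta (z + a) τ = 0 ↔ z - -a ∈ periodLattice τ := by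
  rw [theta_eq_zero_iff hτ, sub_neg_eq_add]

lemma deriv_theta_add_ne_zero (hτ : 0 < τ.im) (hz : theta (z + a) τ = 0) :
    deriv (fun z => theta (z + a) τ) z ≠ 0 := by
  rw [deriv_comp_add_const (fun z => theta z τ)]
  exact deriv_theta_ne_zero hτ hz

lemma theta_add_ne_zero_of_sub_notMem (hτ : 0 < τ.im) (hab : a - b ∉ periodLattice τ)
    (hz : theta (z + a) τ = 0) : theta (z + b) τ ≠ 0 := fun h => hab <| by
  simpa using sub_mem ((theta_eq_zero_iff hτ).1 hz) ((theta_eq_zero_iff hτ).1 h)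

/-- The product `ϑ(z + a) ϑ(z + b)` as a function of `z`; the numerators and denominators of `X`
and `Y` are of this form. -/
def thetaPair (τ a b z : ℂ) : ℂ := theta (z + a) τ * theta (z + b) τ

lemma differentiable_thetaPair (hτ : 0 < τ.im) (a b : ℂ) : Differentiable ℂ (thetaPair τ a b) :=
  ((differentiable_theta hτ).comp (differentiable_id.add_const a)).mul
    ((differentiable_theta hτ).comp (differentiable_id.add_const b))

lemma hasDerivAt_thetaPair_zero (hτ : 0 < τ.im) (a b : ℂ) :
    HasDerivAt (thetaPair τ a b) (thetaDeriv a τ * theta b τ + theta a τ * thetaDeriv b τ) 0 := by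
  have h (a : ℂ) : HasDerivAt (fun z => theta (z + a) τ) (thetaDeriv a τ) 0 := by
    simpa using (hasDerivAt_theta hτ (0 + a)).comp_add_const 0 a
  simpa using! (h a).fun_mul (h b)

lemma thetaPair_zero (τ a b : ℂ) : thetaPair τ a b 0 = theta a τ * theta b τ := by
  simp [thetaPair]

lemma thetaPair_sub (τ a b w z : ℂ) :
    thetaPair τ a b (w - z) = thetaPair τ (-w - a) (-w - b) z := by
  rw [thetaPair, thetaPair, show w - z + a = -(z + (-w - a)) by ring,
    show w - z + b = -(z + (-w - b)) by ring, theta_neg, theta_neg, neg_mul_neg]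

lemma thetaPair_add_pi (τ a b z : ℂ) : thetaPair τ a b (z + π) = thetaPair τ a b z := by
  rw [thetaPair, thetaPair, add_right_comm, theta_add_pi, add_right_comm, theta_add_pi, neg_mul_neg]

lemma thetaPair_add_pi_mul (hτ : 0 < τ.im) (a b z : ℂ) :
    thetaPair τ a b (z + π * τ) =
      cexp (-(2 * I * π * τ) - 4 * I * z - 2 * I * (a + b)) * thetaPair τ a b z := by
  rw [thetaPair, thetaPair, add_right_comm, theta_add_pi_mul hτ, add_right_comm,
    theta_add_pi_mul hτ]
  rw [show -(2 * I * π * τ) - 4 * I * z - 2 * I * (a + b) =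
    (-(I * π * τ) - 2 * I * (z + a)) + (-(I * π * τ) - 2 * I * (z + b)) by ring, Complex.exp_add]
  ring

lemma thetaPair_mul_thetaPair_add_pi_mul (hτ : 0 < τ.im) (a b c d z : ℂ) :
    thetaPair τ a b (z + π * τ) * thetaPair τ c d (z + π * τ) =
      cexp (-(4 * I * π * τ) - 8 * I * z - 2 * I * (a + b + (c + d))) *
        (thetaPair τ a b z * thetaPair τ c d z) := by
  rw [thetaPair_add_pi_mul hτ, thetaPair_add_pi_mul hτ, mul_mul_mul_comm, ← Complex.exp_add]
  ring_nf

lemma thetaPair_eq_zero_iff (hτ : 0 < τ.im) :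
    thetaPair τ a b z = 0 ↔ z - -a ∈ periodLattice τ ∨ z - -b ∈ periodLattice τ := by
  rw [thetaPair, mul_eq_zero, theta_add_eq_zero_iff hτ, theta_add_eq_zero_iff hτ]

lemma deriv_thetaPair_ne_zero (hτ : 0 < τ.im) (hab : a - b ∉ periodLattice τ)
    (hz : thetaPair τ a b z = 0) : deriv (thetaPair τ a b) z ≠ 0 :=
  deriv_mul_ne_zero ((differentiable_theta hτ).comp (differentiable_id.add_const a))
    ((differentiable_theta hτ).comp (differentiable_id.add_const b))
    (fun _ => deriv_theta_add_ne_zero hτ) (fun _ => deriv_theta_add_ne_zero hτ)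
    (fun _ => theta_add_ne_zero_of_sub_notMem hτ hab) z hz

lemma thetaPair_ne_zero_of_sub_notMem (hτ : 0 < τ.im) (hac : a - c ∉ periodLattice τ)
    (had : a - d ∉ periodLattice τ) (hbc : b - c ∉ periodLattice τ)
    (hbd : b - d ∉ periodLattice τ) (hz : thetaPair τ a b z = 0) : thetaPair τ c d z ≠ 0 := by
  rcases mul_eq_zero.1 hz with h | h
  · exact mul_ne_zero (theta_add_ne_zero_of_sub_notMem hτ hac h)
      (theta_add_ne_zero_of_sub_notMem hτ had h)
  · exact mul_ne_zero (theta_add_ne_zero_of_sub_notMem hτ hbc h)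
      (theta_add_ne_zero_of_sub_notMem hτ hbd h)

lemma eq_zero_of_sub_mem_periodLattice {F m : ℂ → ℂ} (hm : ∀ z, m z ≠ 0)
    (hpi : ∀ z, F (z + π) = F z) (hpi_mul : ∀ z, F (z + π * τ) = m z * F z)
    (hzw : z - w ∈ periodLattice τ) (hw : F w = 0) : F z = 0 := by
  have hpi' : Function.Periodic (fun z => F z = 0) (π : ℂ) := fun z => by simp [hpi]
  have hpi_mul' : Function.Periodic (fun z => F z = 0) (π * τ) := fun z => by simp [hpi_mul, hm]
  have h := apply_add_of_mem_span_pair hpi' hpi_mul' hzw w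
  rw [add_sub_cancel] at h
  exact h.mpr hw

lemma exists_eq_const_mul_thetaPair {F : ℂ → ℂ} (hτ : 0 < τ.im) (hab : a - b ∉ periodLattice τ)
    (hF : Differentiable ℂ F) (hpi : ∀ z, F (z + π) = F z)
    (hpi_mul : ∀ z, F (z + π * τ) =
      cexp (-(2 * I * π * τ) - 4 * I * z - 2 * I * (a + b)) * F z)
    (ha : F (-a) = 0) (hb : F (-b) = 0) : ∃ k : ℂ, ∀ z, F z = k * thetaPair τ a b z :=
  exists_eq_const_mul_of_multipliers (thetaPeriods hτ) hF (differentiable_thetaPair hτ a b)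
    (fun _ => deriv_thetaPair_ne_zero hτ hab)
    (fun z hz => by
      rcases (thetaPair_eq_zero_iff hτ).1 hz with h | h
      · exact eq_zero_of_sub_mem_periodLattice (fun _ => Complex.exp_ne_zero _) hpi hpi_mul h ha
      · exact eq_zero_of_sub_mem_periodLattice (fun _ => Complex.exp_ne_zero _) hpi hpi_mul h hb)
    (fun _ => one_ne_zero) (fun _ => Complex.exp_ne_zero _)
    (fun z => (hpi z).trans (one_mul _).symm)
    (fun z => (thetaPair_add_pi τ a b z).trans (one_mul _).symm)
    hpi_mul (thetaPair_add_pi_mul hτ a b)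

lemma thetaPair_three_term (hτ : 0 < τ.im) (h₁ : γ ∉ periodLattice τ)
    (h₂ : 2 * γ ∉ periodLattice τ) (z : ℂ) :
    thetaPair τ (-2 * γ) (3 * γ) z =
      theta (3 * γ) τ / theta γ τ * thetaPair τ (-γ) (2 * γ) z -
        theta (4 * γ) τ / theta (2 * γ) τ * thetaPair τ 0 γ z := by
  have hϑ₁ : theta γ τ ≠ 0 := (theta_eq_zero_iff hτ).not.2 h₁
  have hϑ₂ : theta (2 * γ) τ ≠ 0 := (theta_eq_zero_iff hτ).not.2 h₂
  have hd := differentiable_thetaPair hτ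
  obtain ⟨k, hk⟩ := exists_eq_const_mul_thetaPair (a := 0) (b := γ)
    (F := fun z => theta γ τ * thetaPair τ (-2 * γ) (3 * γ) z -
      theta (3 * γ) τ * thetaPair τ (-γ) (2 * γ) z)
    hτ (by rwa [zero_sub, neg_mem_iff]) (((hd _ _).const_mul _).sub ((hd _ _).const_mul _))
    (fun z => by simp only [thetaPair_add_pi])
    (fun z => by simp only [thetaPair_add_pi_mul hτ]; ring_nf)
    (by simp only [neg_zero, thetaPair_zero, neg_mul, theta_neg]; ring)
    (by
      rw [thetaPair, thetaPair, show -γ + -2 * γ = -(3 * γ) by ring,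
        show -γ + 3 * γ = 2 * γ by ring, show -γ + -γ = -(2 * γ) by ring,
        show -γ + 2 * γ = γ by ring, theta_neg, theta_neg]
      ring)
  have hkγ := hk γ
  simp only [thetaPair, add_neg_cancel, add_zero, theta_zero] at hkγ
  rw [show γ + -2 * γ = -γ by ring, show γ + 3 * γ = 4 * γ by ring, ← two_mul, theta_neg] at hkγ
  have hk' : k = -(theta γ τ * (theta (4 * γ) τ / theta (2 * γ) τ)) := by
    rw [mul_div_assoc', ← neg_div, eq_div_iff hϑ₂]
    exact mul_right_cancel₀ hϑ₁ (by linear_combination -hkγ)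
  refine mul_left_cancel₀ hϑ₁ ?_
  rw [mul_sub, ← mul_assoc, ← mul_assoc, mul_div_cancel₀ _ hϑ₁]
  linear_combination hk z + thetaPair τ 0 γ z * hk'

/-- The theta-constant expression for `c / t`. -/
def thetaRatio (γ τ : ℂ) : ℂ :=
  4 * (thetaDeriv γ τ * theta (2 * γ) τ / (thetaDeriv 0 τ * theta γ τ)) -
    2 * (thetaDeriv (2 * γ) τ / thetaDeriv 0 τ)

/-- The sum of the four-fold theta products arising from the monomials of `S(X, Y)` once the
denominators are cleared; it is a theta function of degree four. -/
def stepSum (γ τ z : ℂ) : ℂ :=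
  theta (3 * γ) τ / theta γ τ * (thetaPair τ 0 γ z * thetaPair τ 0 γ z) +
    thetaPair τ (-γ) (2 * γ) z * thetaPair τ (-γ) (2 * γ) z +
    thetaPair τ 0 (3 * γ) z * thetaPair τ 0 (-γ) z +
    thetaPair τ γ (-2 * γ) z * thetaPair τ γ (2 * γ) z

lemma differentiable_stepSum (hτ : 0 < τ.im) (γ : ℂ) : Differentiable ℂ (stepSum γ τ) := by
  have hd := fun a b => differentiable_thetaPair hτ a b
  unfold stepSum
  fun_prop (disch := assumption)

lemma stepSum_add_pi (γ τ z : ℂ) : stepSum γ τ (z + π) = stepSum γ τ z := by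
  simp only [stepSum, thetaPair_add_pi]

lemma stepSum_add_pi_mul (hτ : 0 < τ.im) (γ z : ℂ) :
    stepSum γ τ (z + π * τ) =
      cexp (-(4 * I * π * τ) - 8 * I * z - 2 * I * (0 + γ + (-γ + 2 * γ))) * stepSum γ τ z := by
  simp only [stepSum, thetaPair_mul_thetaPair_add_pi_mul hτ]
  ring_nf

lemma stepSum_reflect (γ τ z : ℂ) : stepSum γ τ (-γ - z) = stepSum γ τ z := by
  simp only [stepSum, thetaPair_sub]
  simp only [thetaPair]
  ring_nf

lemma stepSum_zero (γ τ : ℂ) : stepSum γ τ 0 = 0 := by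
  simp only [stepSum, thetaPair_zero, theta_zero, neg_mul, theta_neg]
  ring

lemma stepSum_self (γ τ : ℂ) : stepSum γ τ γ = 0 := by
  simp only [stepSum, thetaPair]
  rw [add_neg_cancel, theta_zero, add_zero, show γ + -2 * γ = -γ by ring, theta_neg,
    show γ + γ = 2 * γ by ring, show γ + 2 * γ = 3 * γ by ring]
  field_simp
  ring

lemma stepSum_eq_zero (hτ : 0 < τ.im)
    (hz : thetaPair τ 0 γ z * thetaPair τ (-γ) (2 * γ) z = 0) : stepSum γ τ z = 0 := by
  have hzero {w : ℂ} (hzw : z - w ∈ periodLattice τ) (hw : stepSum γ τ w = 0) :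
      stepSum γ τ z = 0 :=
    eq_zero_of_sub_mem_periodLattice (fun _ => Complex.exp_ne_zero _) (stepSum_add_pi γ τ)
      (stepSum_add_pi_mul hτ γ) hzw hw
  have h₀ := stepSum_zero γ τ
  have h₁ := stepSum_self γ τ
  rcases mul_eq_zero.1 hz with hz | hz <;> rcases (thetaPair_eq_zero_iff hτ).1 hz with h | h
  · exact hzero h (by rwa [neg_zero])
  · exact hzero h (by rwa [← sub_zero (-γ), stepSum_reflect])
  · exact hzero h (by rwa [neg_neg])
  · exact hzero h (by rwa [show -(2 * γ) = -γ - γ by ring, stepSum_reflect])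

lemma exists_stepSum_eq_const_mul (hτ : 0 < τ.im) (h₁ : γ ∉ periodLattice τ)
    (h₂ : 2 * γ ∉ periodLattice τ) (h₃ : 3 * γ ∉ periodLattice τ) :
    ∃ k : ℂ, ∀ z, stepSum γ τ z = k * (thetaPair τ 0 γ z * thetaPair τ (-γ) (2 * γ) z) := by
  have hd := differentiable_thetaPair hτ
  have hneg {w : ℂ} (hw : w ∉ periodLattice τ) : -w ∉ periodLattice τ := by rwa [neg_mem_iff]
  have hsimple (z) : thetaPair τ 0 γ z * thetaPair τ (-γ) (2 * γ) z = 0 →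
      deriv (fun z => thetaPair τ 0 γ z * thetaPair τ (-γ) (2 * γ) z) z ≠ 0 := by
    refine deriv_mul_ne_zero (hd _ _) (hd _ _)
      (fun _ => deriv_thetaPair_ne_zero hτ ?_) (fun _ => deriv_thetaPair_ne_zero hτ ?_)
      (fun _ => thetaPair_ne_zero_of_sub_notMem hτ ?_ ?_ ?_ ?_) z
    · rw [zero_sub]; exact hneg h₁
    · rw [show -γ - 2 * γ = -(3 * γ) by ring]; exact hneg h₃
    · rwa [zero_sub, neg_neg]
    · rw [zero_sub]; exact hneg h₂
    · rwa [sub_neg_eq_add, ← two_mul]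
    · rw [show γ - 2 * γ = -γ by ring]; exact hneg h₁
  exact exists_eq_const_mul_of_multipliers (thetaPeriods hτ) (differentiable_stepSum hτ γ)
    ((hd _ _).mul (hd _ _)) hsimple
    (fun _ => stepSum_eq_zero hτ)
    (fun _ => one_ne_zero) (fun _ => Complex.exp_ne_zero _)
    (fun z => (stepSum_add_pi γ τ z).trans (one_mul _).symm)
    (fun z => by simp only [thetaPeriods, thetaPair_add_pi, one_mul])
    (stepSum_add_pi_mul hτ γ)
    (fun z => thetaPair_mul_thetaPair_add_pi_mul hτ 0 γ (-γ) (2 * γ) z)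

lemma hasDerivAt_stepSum_zero (hτ : 0 < τ.im) (hϑ : theta γ τ ≠ 0) :
    HasDerivAt (stepSum γ τ) (thetaRatio γ τ *
      (thetaDeriv 0 τ * theta γ τ * (-theta γ τ * theta (2 * γ) τ))) 0 := by
  have h₀ : thetaDeriv 0 τ ≠ 0 := deriv_theta_ne_zero hτ (theta_zero τ)
  have hp := hasDerivAt_thetaPair_zero hτ
  have hd := (((((hp 0 γ).fun_mul (hp 0 γ)).const_mul (theta (3 * γ) τ / theta γ τ)).fun_add
    ((hp (-γ) (2 * γ)).fun_mul (hp (-γ) (2 * γ)))).fun_add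
    ((hp 0 (3 * γ)).fun_mul (hp 0 (-γ)))).fun_add
    ((hp γ (-2 * γ)).fun_mul (hp γ (2 * γ)))
  refine hd.congr_deriv ?_
  simp only [thetaPair_zero, theta_zero, theta_neg, neg_mul, thetaDeriv_neg, thetaRatio]
  field_simp
  ring

lemma stepSum_eq (hτ : 0 < τ.im) (h₁ : γ ∉ periodLattice τ) (h₂ : 2 * γ ∉ periodLattice τ)
    (h₃ : 3 * γ ∉ periodLattice τ) (z : ℂ) :
    stepSum γ τ z = thetaRatio γ τ * (thetaPair τ 0 γ z * thetaPair τ (-γ) (2 * γ) z) := by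
  have hϑ₁ : theta γ τ ≠ 0 := (theta_eq_zero_iff hτ).not.2 h₁
  have hϑ₂ : theta (2 * γ) τ ≠ 0 := (theta_eq_zero_iff hτ).not.2 h₂
  have h₀ : thetaDeriv 0 τ ≠ 0 := deriv_theta_ne_zero hτ (theta_zero τ)
  obtain ⟨k, hk⟩ := exists_stepSum_eq_const_mul hτ h₁ h₂ h₃
  have hp := hasDerivAt_thetaPair_zero hτ
  have hderiv := (hasDerivAt_stepSum_zero hτ hϑ₁).unique
    (((hp 0 γ).fun_mul (hp (-γ) (2 * γ))).const_mul k |>.congr_of_eventuallyEq (.of_forall hk))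
  have hk' : k = thetaRatio γ τ := by
    have hne : thetaDeriv 0 τ * theta γ τ * (-theta γ τ * theta (2 * γ) τ) ≠ 0 := by simp [*]
    refine mul_right_cancel₀ hne ?_
    simp only [thetaPair_zero, theta_zero, theta_neg] at hderiv
    linear_combination -hderiv
  rw [← hk', hk]

end ThetaIdentities

section ProjectiveLine

variable {n d : ℂ}

/-- The point `[n : d]` of `ℂ ∪ {∞}`, with the convention `[0 : 0] = ∞`. -/
def projPoint (n d : ℂ) : OnePoint ℂ :=
  open Classical in if d = 0 then OnePoint.infty else ((n / d : ℂ) : OnePoint ℂ)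

lemma projPoint_of_eq (h : d = 0) : projPoint n d = OnePoint.infty := if_pos h

lemma projPoint_of_ne (h : d ≠ 0) : projPoint n d = ((n / d : ℂ) : OnePoint ℂ) := if_neg h

lemma projPoint_ne_infty (h : d ≠ 0) : projPoint n d ≠ OnePoint.infty := by
  rw [projPoint_of_ne h]
  exact OnePoint.coe_ne_infty _

lemma projPoint_mul {k : ℂ} (hk : k ≠ 0) (n d : ℂ) :
    projPoint (k * n) (k * d) = projPoint n d := by
  by_cases h : d = 0
  · rw [projPoint_of_eq h, projPoint_of_eq (by rw [h, mul_zero])]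
  · rw [projPoint_of_ne h, projPoint_of_ne (mul_ne_zero hk h), mul_div_mul_left _ _ hk]

lemma finPart_projPoint (n d : ℂ) : finPart (projPoint n d) = n / d := by
  by_cases h : d = 0
  · rw [projPoint_of_eq h, h, div_zero]
    rfl
  · rw [projPoint_of_ne h]
    rfl

lemma homCoord_infty : homCoord OnePoint.infty = (1, 0) := rfl

lemma homCoord_coe (x : ℂ) : homCoord (x : OnePoint ℂ) = (x, 1) := rfl

lemma exists_eq_mul_homCoord_projPoint (h : n = 0 → d ≠ 0) : ∃ k : ℂ, k ≠ 0 ∧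
    n = k * (homCoord (projPoint n d)).1 ∧ d = k * (homCoord (projPoint n d)).2 := by
  by_cases hd : d = 0
  · refine ⟨n, fun hn => h hn hd, ?_, ?_⟩ <;> rw [projPoint_of_eq hd, homCoord_infty] <;> simp [hd]
  · refine ⟨d, hd, ?_, ?_⟩ <;> simp [projPoint_of_ne hd, homCoord_coe, mul_div_cancel₀ _ hd]

lemma eq_projPoint {p : OnePoint ℂ} (h : n = 0 → d ≠ 0)
    (hp : (homCoord p).1 * d = (homCoord p).2 * n) : p = projPoint n d := by
  induction p using OnePoint.rec with
  | infty =>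
    rw [homCoord_infty] at hp
    exact (projPoint_of_eq (by simpa using hp)).symm
  | coe x =>
    rw [homCoord_coe, one_mul] at hp
    have hd : d ≠ 0 := fun hd => h (by rw [← hp, hd, mul_zero]) hd
    rw [projPoint_of_ne hd, ← hp, mul_div_cancel_right₀ _ hd]

lemma kernelForm_mul (a t k l x₀ x₁ y₀ y₁ : ℂ) :
    kernelForm a t (k * x₀) (k * x₁) (l * y₀) (l * y₁) =
      k ^ 2 * l ^ 2 * kernelForm a t x₀ x₁ y₀ y₁ := by
  unfold kernelForm
  ring

lemma kernelExt_projPoint_eq_zero_iff {a t : ℂ} {q : OnePoint ℂ} (h : n = 0 → d ≠ 0) :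
    kernelExt a t (projPoint n d) q = 0 ↔
      kernelForm a t n d (homCoord q).1 (homCoord q).2 = 0 := by
  obtain ⟨k, hk, hn, hd⟩ := exists_eq_mul_homCoord_projPoint h
  have hmul := kernelForm_mul a t k 1 (homCoord (projPoint n d)).1 (homCoord (projPoint n d)).2
    (homCoord q).1 (homCoord q).2
  rw [one_mul, one_mul, ← hn, ← hd] at hmul
  rw [kernelExt, hmul]
  simp [hk]

lemma modulus_projPoint_lt_one_iff : modulus (projPoint n d) < 1 ↔ ‖n‖ < ‖d‖ := by
  by_cases hd : d = 0
  · rw [projPoint_of_eq hd, hd, norm_zero]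
    exact iff_of_false (not_lt.2 le_top) (not_lt.2 (norm_nonneg _))
  · rw [projPoint_of_ne hd]
    change ‖n / d‖ₑ < 1 ↔ _
    rw [enorm_eq_nnnorm, ← ENNReal.coe_one, ENNReal.coe_lt_coe, ← NNReal.coe_lt_coe, coe_nnnorm,
      norm_div, NNReal.coe_one, div_lt_one (norm_pos_iff.2 hd)]

lemma modulus_projPoint_eq_one_iff (h : n = 0 → d ≠ 0) :
    modulus (projPoint n d) = 1 ↔ ‖n‖ = ‖d‖ := by
  by_cases hd : d = 0
  · have hn : ‖n‖ ≠ 0 := norm_ne_zero_iff.2 fun hn => h hn hd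
    rw [projPoint_of_eq hd, hd, norm_zero]
    exact iff_of_false ENNReal.top_ne_one hn
  · rw [projPoint_of_ne hd]
    change ‖n / d‖ₑ = 1 ↔ _
    rw [enorm_eq_nnnorm, ← ENNReal.coe_one, ENNReal.coe_inj, ← NNReal.coe_inj, coe_nnnorm,
      norm_div, NNReal.coe_one, div_eq_one_iff_eq (norm_ne_zero_iff.2 hd)]

end ProjectiveLine

section Divisor

open scoped Classical in
lemma meromorphicOrderAt_of_simple_zeros {f : ℂ → ℂ} {z : ℂ} (hf : AnalyticAt ℂ f z)
    (hf' : f z = 0 → deriv f z ≠ 0) :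
    meromorphicOrderAt f z = ((if f z = 0 then 1 else 0 : ℤ) : WithTop ℤ) := by
  rw [hf.meromorphicOrderAt_eq]
  by_cases h : f z = 0
  · rw [hf.analyticOrderAt_eq_one_of_zero_deriv_ne_zero h (hf' h), if_pos h]
    rfl
  · rw [hf.analyticOrderAt_eq_zero.2 h, if_neg h]
    rfl

lemma tendsto_projPoint_infty {X : Type*} [TopologicalSpace X] {n d : X → ℂ} {x : X}
    (hn : ContinuousAt n x) (hd : ContinuousAt d x) (hnx : n x ≠ 0) (hdx : d x = 0) :
    Filter.Tendsto (fun w => projPoint (n w) (d w)) (𝓝 x) (𝓝 OnePoint.infty) := by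
  rw [OnePoint.hasBasis_nhds_infty.tendsto_right_iff]
  rintro K ⟨_, hK⟩
  obtain ⟨R, hR⟩ := hK.isBounded.exists_norm_le
  have hx : R * ‖d x‖ < ‖n x‖ := by
    rw [hdx, norm_zero, mul_zero]
    exact norm_pos_iff.2 hnx
  filter_upwards [(hd.norm.const_mul R).eventually_lt hn.norm hx] with w hw
  by_cases hdw : d w = 0
  · exact .inr (projPoint_of_eq hdw)
  · rw [projPoint_of_ne hdw]
    refine .inl ⟨_, fun hmem => hw.not_ge ?_, rfl⟩
    rw [← div_le_iff₀ (norm_pos_iff.2 hdw), ← norm_div]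
    exact hR _ hmem

lemma continuousAt_projPoint {X : Type*} [TopologicalSpace X] {n d : X → ℂ} {x : X}
    (hn : ContinuousAt n x) (hd : ContinuousAt d x) (h : n x = 0 → d x ≠ 0) :
    ContinuousAt (fun w => projPoint (n w) (d w)) x := by
  by_cases hx : d x = 0
  · rw [ContinuousAt, projPoint_of_eq hx]
    exact tendsto_projPoint_infty hn hd (fun hn => h hn hx) hx
  · refine (OnePoint.continuous_coe.continuousAt.comp (hn.div hd hx)).congr ?_
    filter_upwards [hd.eventually_ne hx] with w hw
    exact (projPoint_of_ne hw).symm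

variable {n d : ℂ → ℂ}

lemma isMeromorphic_projPoint (hn : Differentiable ℂ n) (hd : Differentiable ℂ d)
    (hd' : ∀ z, d z = 0 → deriv d z ≠ 0) (h : ∀ z, n z = 0 → d z ≠ 0) :
    IsMeromorphic fun z => projPoint (n z) (d z) := by
  refine ⟨fun z => ?_, continuous_iff_continuousAt.2 fun z =>
    continuousAt_projPoint hn.continuous.continuousAt hd.continuous.continuousAt (h z),
    fun z => ?_⟩
  · simp only [finPart_projPoint]
    exact (hn.analyticAt z).meromorphicAt.div (hd.analyticAt z).meromorphicAt
  · filter_upwards [eventually_ne_zero_of_deriv_ne_zero (hd z) (hd' z)] with w hw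
    exact projPoint_ne_infty hw

open scoped Classical in
lemma orderAt_projPoint (hn : Differentiable ℂ n) (hd : Differentiable ℂ d)
    (hn' : ∀ z, n z = 0 → deriv n z ≠ 0) (hd' : ∀ z, d z = 0 → deriv d z ≠ 0) (z : ℂ) :
    orderAt (fun z => projPoint (n z) (d z)) z =
      (if n z = 0 then 1 else 0) - (if d z = 0 then 1 else 0) := by
  have hdiv : meromorphicOrderAt (fun w => n w / d w) z =
      ((if n z = 0 then 1 else 0 : ℤ) : WithTop ℤ) -
        ((if d z = 0 then 1 else 0 : ℤ) : WithTop ℤ) := by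
    rw [← meromorphicOrderAt_of_simple_zeros (hn.analyticAt z) (hn' z),
      ← meromorphicOrderAt_of_simple_zeros (hd.analyticAt z) (hd' z)]
    exact meromorphicOrderAt_div (hn.analyticAt z).meromorphicAt (hd.analyticAt z).meromorphicAt
  simp only [orderAt, finPart_projPoint]
  rw [hdiv, ← WithTop.LinearOrderedAddCommGroup.coe_sub]
  rfl

open scoped Classical in
lemma finsum_mem_ite_one_eq_ncard (s : Set ℂ) (p : ℂ → Prop) :
    ∑ᶠ z ∈ s, (if p z then 1 else 0 : ℤ) = {z ∈ s | p z}.ncard := by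
  rw [← finsum_one, ← Nat.coe_castAddMonoidHom, finsum_mem_def, finsum_mem_def,
    AddMonoidHom.map_finsum_of_injective _ Nat.cast_injective]
  refine finsum_congr fun z => ?_
  by_cases hz : z ∈ s <;> by_cases hp : p z <;> simp [hz, hp]

lemma rootCount_projPoint (hn : Differentiable ℂ n) (hd : Differentiable ℂ d)
    (hn' : ∀ z, n z = 0 → deriv n z ≠ 0) (hd' : ∀ z, d z = 0 → deriv d z ≠ 0)
    (h : ∀ z, n z = 0 → d z ≠ 0) (s : Set ℂ) :
    rootCount (fun z => projPoint (n z) (d z)) s = {z ∈ s | n z = 0}.ncard := by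
  classical
  rw [← finsum_mem_ite_one_eq_ncard]
  refine finsum_mem_congr rfl fun z _ => ?_
  rw [orderAt_projPoint hn hd hn' hd']
  specialize h z
  split_ifs <;> simp_all

lemma poleCount_projPoint (hn : Differentiable ℂ n) (hd : Differentiable ℂ d)
    (hn' : ∀ z, n z = 0 → deriv n z ≠ 0) (hd' : ∀ z, d z = 0 → deriv d z ≠ 0)
    (h : ∀ z, n z = 0 → d z ≠ 0) (s : Set ℂ) :
    poleCount (fun z => projPoint (n z) (d z)) s = {z ∈ s | d z = 0}.ncard := by
  classical
  rw [← finsum_mem_ite_one_eq_ncard]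
  refine finsum_mem_congr rfl fun z _ => ?_
  rw [orderAt_projPoint hn hd hn' hd']
  specialize h z
  split_ifs <;> simp_all

end Divisor

section FundamentalDomain

variable {a b τ : ℂ}

lemma mem_fundDomain_iff (hτ : 0 < τ.im) {z zc : ℂ} :
    z ∈ fundDomain τ zc ↔ z - zc ∈ ZSpan.fundamentalDomain (thetaPeriods hτ).basis := by
  set B := (thetaPeriods hτ).basis with hB
  have hsum (v : Fin 2 → ℝ) : ∑ i, v i • B i = v 0 * π + v 1 * π * τ := by
    simp [Fin.sum_univ_two, hB, thetaPeriods, mul_assoc]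
  rw [ZSpan.mem_fundamentalDomain]
  constructor
  · rintro ⟨r, hr, s, hs, rfl⟩ i
    have hv : zc + r * π + s * π * τ - zc = ∑ i, (![r, s] i) • B i := by
      rw [hsum]
      simp
      ring
    rw [hv, B.repr_sum_self]
    fin_cases i
    exacts [hr, hs]
  · intro h
    refine ⟨_, h 0, _, h 1, ?_⟩
    rw [add_assoc, ← hsum, B.sum_repr, add_sub_cancel]

lemma existsUnique_mem_fundDomain (hτ : 0 < τ.im) (zc w : ℂ) :
    ∃! z, z ∈ fundDomain τ zc ∧ z - w ∈ periodLattice τ := by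
  have hL : periodLattice τ = Submodule.span ℤ (Set.range (thetaPeriods hτ).basis) :=
    (thetaPeriods hτ).lattice_eq_span_range_basis
  obtain ⟨v, hv, huniq⟩ := ZSpan.exist_unique_vadd_mem_fundamentalDomain
    (thetaPeriods hτ).basis (w - zc)
  refine ⟨v + w, ⟨?_, ?_⟩, fun z hz => ?_⟩
  · rwa [mem_fundDomain_iff hτ, add_sub_assoc]
  · rw [add_sub_cancel_right, hL]
    exact v.2
  · have := huniq ⟨z - w, hL ▸ hz.2⟩ (by
      change z - w + (w - zc) ∈ _
      rw [sub_add_sub_cancel, ← mem_fundDomain_iff hτ]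
      exact hz.1)
    rw [← this, sub_add_cancel]

lemma ncard_thetaPair_zeros (hτ : 0 < τ.im) (hab : a - b ∉ periodLattice τ) (zc : ℂ) :
    {z ∈ fundDomain τ zc | thetaPair τ a b z = 0}.ncard = 2 := by
  obtain ⟨z₁, ⟨hz₁, h₁⟩, huniq₁⟩ := existsUnique_mem_fundDomain hτ zc (-a)
  obtain ⟨z₂, ⟨hz₂, h₂⟩, huniq₂⟩ := existsUnique_mem_fundDomain hτ zc (-b)
  have hne : z₁ ≠ z₂ := by
    rintro rfl
    exact hab (by simpa using sub_mem h₁ h₂)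
  rw [← Set.ncard_pair hne]
  congr 1
  ext z
  simp only [Set.mem_ofPred_eq, thetaPair_eq_zero_iff hτ, Set.mem_insert_iff,
    Set.mem_singleton_iff]
  constructor
  · rintro ⟨hz, h | h⟩
    exacts [.inl (huniq₁ z ⟨hz, h⟩), .inr (huniq₂ z ⟨hz, h⟩)]
  · rintro (rfl | rfl)
    exacts [⟨hz₁, .inl h₁⟩, ⟨hz₂, .inr h₂⟩]

end FundamentalDomain

section KernelParametrization

variable {a c t x γ z τ : ℂ}

/-- The numerator `c ϑ(z) ϑ(z + γ)` of `X`. -/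
def numerX (c γ τ z : ℂ) : ℂ := c * thetaPair τ 0 γ z

/-- The denominator `ϑ(z - γ) ϑ(z + 2γ)` of `X`. -/
def denomX (γ τ z : ℂ) : ℂ := thetaPair τ (-γ) (2 * γ) z

lemma Xfun_eq_projPoint (c γ τ z : ℂ) :
    Xfun c γ τ z = projPoint (numerX c γ τ z) (denomX γ τ z) := by
  rw [numerX, denomX, thetaPair, thetaPair, add_zero, ← sub_eq_add_neg]
  rfl

lemma Yfun_eq_Xfun_neg_param (c γ τ z : ℂ) : Yfun c γ τ z = Xfun c (-γ) τ z := by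
  simp only [Xfun, Yfun, sub_neg_eq_add, mul_neg, ← sub_eq_add_neg]

lemma numerX_neg (c γ τ z : ℂ) : numerX c γ τ (-z) = numerX c (-γ) τ z := by
  rw [numerX, numerX, ← zero_sub z, thetaPair_sub]
  simp

lemma denomX_neg (γ τ z : ℂ) : denomX γ τ (-z) = denomX (-γ) τ z := by
  rw [denomX, denomX, ← zero_sub z, thetaPair_sub]
  simp

lemma Yfun_eq_Xfun_neg (c γ τ z : ℂ) : Yfun c γ τ z = Xfun c γ τ (-z) := by
  rw [Yfun_eq_Xfun_neg_param, Xfun_eq_projPoint, Xfun_eq_projPoint, numerX_neg, denomX_neg]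

lemma numerX_reflect (c γ τ z : ℂ) : numerX c γ τ (-γ - z) = numerX c γ τ z := by
  simp only [numerX, thetaPair_sub]
  simp only [thetaPair]
  ring_nf

lemma denomX_reflect (γ τ z : ℂ) : denomX γ τ (-γ - z) = denomX γ τ z := by
  simp only [denomX, thetaPair_sub]
  simp only [thetaPair]
  ring_nf

lemma numerX_add_pi (c γ τ z : ℂ) : numerX c γ τ (z + π) = numerX c γ τ z := by
  simp only [numerX, thetaPair_add_pi]

lemma denomX_add_pi (γ τ z : ℂ) : denomX γ τ (z + π) = denomX γ τ z :=
  thetaPair_add_pi _ _ _ _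

lemma numerX_add_pi_mul (hτ : 0 < τ.im) (c γ z : ℂ) :
    numerX c γ τ (z + π * τ) =
      cexp (-(2 * I * π * τ) - 4 * I * z - 2 * I * γ) * numerX c γ τ z := by
  rw [numerX, numerX, thetaPair_add_pi_mul hτ]
  ring_nf

lemma denomX_add_pi_mul (hτ : 0 < τ.im) (γ z : ℂ) :
    denomX γ τ (z + π * τ) = cexp (-(2 * I * π * τ) - 4 * I * z - 2 * I * γ) * denomX γ τ z := by
  rw [denomX, denomX, thetaPair_add_pi_mul hτ]
  ring_nf

lemma Xfun_reflect (c γ τ z : ℂ) : Xfun c γ τ (-γ - z) = Xfun c γ τ z := by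
  rw [Xfun_eq_projPoint, Xfun_eq_projPoint, numerX_reflect, denomX_reflect]

lemma Xfun_add_pi (c γ τ z : ℂ) : Xfun c γ τ (z + π) = Xfun c γ τ z := by
  rw [Xfun_eq_projPoint, Xfun_eq_projPoint, numerX_add_pi, denomX_add_pi]

lemma Xfun_add_pi_mul (hτ : 0 < τ.im) (c γ z : ℂ) : Xfun c γ τ (z + π * τ) = Xfun c γ τ z := by
  rw [Xfun_eq_projPoint, Xfun_eq_projPoint, numerX_add_pi_mul hτ, denomX_add_pi_mul hτ,
    projPoint_mul (Complex.exp_ne_zero _)]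

lemma differentiable_numerX (hτ : 0 < τ.im) (c γ : ℂ) : Differentiable ℂ (numerX c γ τ) :=
  (differentiable_thetaPair hτ _ _).const_mul _

lemma differentiable_denomX (hτ : 0 < τ.im) (γ : ℂ) : Differentiable ℂ (denomX γ τ) :=
  differentiable_thetaPair hτ _ _

lemma numerX_zero (c γ τ : ℂ) : numerX c γ τ 0 = 0 := by simp [numerX, thetaPair]

lemma denomX_self (γ τ : ℂ) : denomX γ τ γ = 0 := by simp [denomX, thetaPair]

/-- The theta parameters `(c, γ, τ)` uniformise the kernel with weight `a`: none of `γ`, `2γ`, `3γ`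
is a period, and `c² = ϑ(3γ) / ϑ(γ)`, `a c³ = -ϑ(4γ) / ϑ(2γ)`. The remaining parameter `t` of the
kernel is then determined by `c / t = thetaRatio γ τ`. -/
structure IsKernelParameter (a c γ τ : ℂ) : Prop where
  im_pos : 0 < τ.im
  notMem : γ ∉ periodLattice τ
  two_mul_notMem : 2 * γ ∉ periodLattice τ
  three_mul_notMem : 3 * γ ∉ periodLattice τ
  sq_eq : c ^ 2 = theta (3 * γ) τ / theta γ τ
  mul_cube_eq : a * c ^ 3 = -(theta (4 * γ) τ / theta (2 * γ) τ)

namespace IsKernelParameter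

lemma neg (h : IsKernelParameter a c γ τ) : IsKernelParameter a c (-γ) τ where
  im_pos := h.im_pos
  notMem := by simpa using h.notMem
  two_mul_notMem := by simpa using h.two_mul_notMem
  three_mul_notMem := by simpa using h.three_mul_notMem
  sq_eq := by simpa only [mul_neg, theta_neg, neg_div_neg_eq] using h.sq_eq
  mul_cube_eq := by simpa only [mul_neg, theta_neg, neg_div_neg_eq] using h.mul_cube_eq

lemma ne_zero (h : IsKernelParameter a c γ τ) : c ≠ 0 := by
  refine (pow_ne_zero_iff two_ne_zero).1 (h.sq_eq ▸ div_ne_zero ?_ ?_)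
  exacts [(theta_eq_zero_iff h.im_pos).not.2 h.three_mul_notMem,
    (theta_eq_zero_iff h.im_pos).not.2 h.notMem]

lemma denomX_ne_zero (h : IsKernelParameter a c γ τ) (hz : numerX c γ τ z = 0) :
    denomX γ τ z ≠ 0 := by
  refine thetaPair_ne_zero_of_sub_notMem h.im_pos ?_ ?_ ?_ ?_
    ((mul_eq_zero.1 hz).resolve_left h.ne_zero)
  · simpa using h.notMem
  · simpa using h.two_mul_notMem
  · simpa [← two_mul] using h.two_mul_notMem
  · rw [show γ - 2 * γ = -γ by ring, neg_mem_iff]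
    exact h.notMem

lemma deriv_numerX_ne_zero (h : IsKernelParameter a c γ τ) (hz : numerX c γ τ z = 0) :
    deriv (numerX c γ τ) z ≠ 0 := by
  unfold numerX at hz ⊢
  rw [deriv_const_mul _ (differentiable_thetaPair h.im_pos 0 γ z)]
  refine mul_ne_zero h.ne_zero (deriv_thetaPair_ne_zero h.im_pos ?_
    ((mul_eq_zero.1 hz).resolve_left h.ne_zero))
  simpa using h.notMem

lemma neg_sub_two_mul_notMem (h : IsKernelParameter a c γ τ) :
    -γ - 2 * γ ∉ periodLattice τ := by
  rw [show -γ - 2 * γ = -(3 * γ) by ring, neg_mem_iff]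
  exact h.three_mul_notMem

lemma deriv_denomX_ne_zero (h : IsKernelParameter a c γ τ) (hz : denomX γ τ z = 0) :
    deriv (denomX γ τ) z ≠ 0 :=
  deriv_thetaPair_ne_zero h.im_pos h.neg_sub_two_mul_notMem hz

lemma isMeromorphic_Xfun (h : IsKernelParameter a c γ τ) : IsMeromorphic (Xfun c γ τ) := by
  rw [funext (Xfun_eq_projPoint c γ τ)]
  exact isMeromorphic_projPoint (differentiable_numerX h.im_pos c γ)
    (differentiable_denomX h.im_pos γ) (fun _ => h.deriv_denomX_ne_zero)
    (fun _ => h.denomX_ne_zero)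

lemma rootCount_Xfun (h : IsKernelParameter a c γ τ) (zc : ℂ) :
    rootCount (Xfun c γ τ) (fundDomain τ zc) = 2 := by
  rw [funext (Xfun_eq_projPoint c γ τ), rootCount_projPoint (differentiable_numerX h.im_pos c γ)
    (differentiable_denomX h.im_pos γ) (fun _ => h.deriv_numerX_ne_zero)
    (fun _ => h.deriv_denomX_ne_zero) (fun _ => h.denomX_ne_zero)]
  simp only [numerX, mul_eq_zero, h.ne_zero, false_or]
  rw [ncard_thetaPair_zeros h.im_pos (by simpa using h.notMem), Nat.cast_ofNat]

lemma poleCount_Xfun (h : IsKernelParameter a c γ τ) (zc : ℂ) :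
    poleCount (Xfun c γ τ) (fundDomain τ zc) = 2 := by
  rw [funext (Xfun_eq_projPoint c γ τ), poleCount_projPoint (differentiable_numerX h.im_pos c γ)
    (differentiable_denomX h.im_pos γ) (fun _ => h.deriv_numerX_ne_zero)
    (fun _ => h.deriv_denomX_ne_zero) (fun _ => h.denomX_ne_zero)]
  simp only [denomX]
  rw [ncard_thetaPair_zeros h.im_pos h.neg_sub_two_mul_notMem, Nat.cast_ofNat]

lemma exists_Xfun_eq (h : IsKernelParameter a c γ τ) (p : OnePoint ℂ) : ∃ z, Xfun c γ τ z = p := by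
  simp only [Xfun_eq_projPoint]
  induction p using OnePoint.rec with
  | infty => exact ⟨γ, projPoint_of_eq (denomX_self γ τ)⟩
  | coe x =>
    by_contra! hne
    -- If `X` omitted the value `x`, then `numerX / (numerX - x * denomX)` would be constant.
    have hG (z : ℂ) : numerX c γ τ z - x * denomX γ τ z ≠ 0 := fun hz => by
      have hd : denomX γ τ z ≠ 0 := fun hd => h.denomX_ne_zero (by simpa [hd] using hz) hd
      refine hne z ?_
      rw [projPoint_of_ne hd, sub_eq_zero.1 hz, mul_div_cancel_right₀ _ hd]
    obtain ⟨k, hk⟩ := exists_eq_const_mul_of_multipliers (thetaPeriods h.im_pos)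
      (F := numerX c γ τ) (G := fun z => numerX c γ τ z - x * denomX γ τ z)
      (m₁ := fun _ => 1) (m₂ := fun z => cexp (-(2 * I * π * τ) - 4 * I * z - 2 * I * γ))
      (differentiable_numerX h.im_pos c γ)
      ((differentiable_numerX h.im_pos c γ).sub ((differentiable_denomX h.im_pos γ).const_mul x))
      (fun z hz => absurd hz (hG z)) (fun z hz => absurd hz (hG z))
      (fun _ => one_ne_zero) (fun _ => Complex.exp_ne_zero _)
      (fun z => (numerX_add_pi c γ τ z).trans (one_mul _).symm)
      (fun z => by simp only [thetaPeriods, numerX_add_pi, denomX_add_pi, one_mul])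
      (numerX_add_pi_mul h.im_pos c γ)
      (fun z => by
        simp only [thetaPeriods, numerX_add_pi_mul h.im_pos, denomX_add_pi_mul h.im_pos]
        ring)
    have hk₀ : k = 0 := by
      have := hk 0
      rw [numerX_zero, zero_eq_mul] at this
      exact this.resolve_right (by simpa [numerX_zero] using hG 0)
    exact h.denomX_ne_zero (by rw [hk, hk₀, zero_mul]) (denomX_self γ τ)

-- The second factor comes from the first by `z ↦ -γ - z`, which leaves `X(z)` unchanged.
lemma kernel_factor (h : IsKernelParameter a c γ τ) (z y₀ y₁ : ℂ) :
    thetaRatio γ τ * (numerX c γ τ z * denomX γ τ z * y₀ * y₁) -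
      c * (numerX c γ τ z ^ 2 * y₀ * y₁ + numerX c γ τ z * denomX γ τ z * y₀ ^ 2 +
        denomX γ τ z ^ 2 * y₀ * y₁ + numerX c γ τ z * denomX γ τ z * y₁ ^ 2 +
        a * numerX c γ τ z ^ 2 * y₀ ^ 2) =
    -((y₀ * denomX γ τ (-z) - y₁ * numerX c γ τ (-z)) *
      (y₀ * denomX γ τ (z + γ) - y₁ * numerX c γ τ (z + γ))) := by
  have h₃ := thetaPair_three_term h.im_pos h.notMem h.two_mul_notMem z
  have h₄ := stepSum_eq h.im_pos h.notMem h.two_mul_notMem h.three_mul_notMem z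
  rw [sub_eq_add_neg, ← neg_mul, ← h.sq_eq, ← h.mul_cube_eq] at h₃
  rw [stepSum, ← h.sq_eq] at h₄
  have hn : numerX c γ τ (z + γ) = c * thetaPair τ γ (2 * γ) z := by
    simp only [numerX, thetaPair]
    ring_nf
  have hd : denomX γ τ (z + γ) = thetaPair τ 0 (3 * γ) z := by
    simp only [denomX, thetaPair]
    ring_nf
  rw [hn, hd, numerX_neg, denomX_neg, numerX, denomX, numerX, denomX, neg_neg,
    show 2 * -γ = -2 * γ by ring]
  simp only [thetaPair, add_zero] at h₃ h₄ ⊢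
  linear_combination (y₀ ^ 2 * theta z τ * theta (z + γ) τ) * h₃ - c * y₀ * y₁ * h₄

lemma thetaRatio_eq_of_diagonal (h : IsKernelParameter a c γ τ) (hx : x ≠ 0)
    (hz : numerX c γ τ z = x * denomX γ τ z)
    (hz' : numerX c γ τ (-z) = x * denomX γ τ (-z)) :
    thetaRatio γ τ = c * (2 * x + 2 / x + a * x ^ 2) := by
  have hd : denomX γ τ z ≠ 0 := fun h₀ => h.denomX_ne_zero (by rw [hz, h₀, mul_zero]) h₀
  have hfactor := h.kernel_factor z (numerX c γ τ z) (denomX γ τ z)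
  have h₀ : numerX c γ τ z * denomX γ τ (-z) - denomX γ τ z * numerX c γ τ (-z) = 0 := by
    rw [hz, hz']
    ring
  rw [h₀, zero_mul, neg_zero, hz] at hfactor
  refine mul_right_cancel₀ (show x ^ 2 * denomX γ τ z ^ 4 ≠ 0 by positivity) ?_
  rw [div_eq_mul_inv]
  linear_combination hfactor - 2 * c * x * denomX γ τ z ^ 4 * mul_inv_cancel₀ hx

lemma kernelForm_eq (h : IsKernelParameter a c γ τ) (ht : t ≠ 0) (hct : thetaRatio γ τ = c / t)
    (z y₀ y₁ : ℂ) :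
    kernelForm a t (numerX c γ τ z) (denomX γ τ z) y₀ y₁ =
      -(t / c) * ((y₀ * denomX γ τ (-z) - y₁ * numerX c γ τ (-z)) *
        (y₀ * denomX γ τ (z + γ) - y₁ * numerX c γ τ (z + γ))) := by
  have hc := h.ne_zero
  have hfactor := h.kernel_factor z y₀ y₁
  rw [hct] at hfactor
  rw [neg_mul, ← mul_neg, ← hfactor, kernelForm]
  field_simp

lemma kernelExt_Xfun_eq_zero_iff (h : IsKernelParameter a c γ τ) (ht : t ≠ 0)
    (hct : thetaRatio γ τ = c / t) {q : OnePoint ℂ} :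
    kernelExt a t (Xfun c γ τ z) q = 0 ↔ q = Xfun c γ τ (-z) ∨ q = Xfun c γ τ (z + γ) := by
  have hq (w : ℂ) : (homCoord q).1 * denomX γ τ w - (homCoord q).2 * numerX c γ τ w = 0 ↔
      q = Xfun c γ τ w := by
    rw [Xfun_eq_projPoint]
    refine ⟨fun hw => eq_projPoint h.denomX_ne_zero (sub_eq_zero.1 hw), ?_⟩
    rintro rfl
    obtain ⟨k, -, hn, hd⟩ := exists_eq_mul_homCoord_projPoint
      (n := numerX c γ τ w) (d := denomX γ τ w) h.denomX_ne_zero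
    linear_combination (homCoord (projPoint (numerX c γ τ w) (denomX γ τ w))).1 * hd -
      (homCoord (projPoint (numerX c γ τ w) (denomX γ τ w))).2 * hn
  rw [Xfun_eq_projPoint, kernelExt_projPoint_eq_zero_iff h.denomX_ne_zero,
    h.kernelForm_eq ht hct, mul_eq_zero_iff_left (neg_ne_zero.2 (div_ne_zero ht h.ne_zero)),
    mul_eq_zero, hq, hq]

lemma kernelExt_Xfun_Yfun (h : IsKernelParameter a c γ τ) (ht : t ≠ 0)
    (hct : thetaRatio γ τ = c / t) (z : ℂ) : kernelExt a t (Xfun c γ τ z) (Yfun c γ τ z) = 0 :=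
  (h.kernelExt_Xfun_eq_zero_iff ht hct).2 (.inl (Yfun_eq_Xfun_neg c γ τ z))

lemma kernelCurve_eq_range (h : IsKernelParameter a c γ τ) (ht : t ≠ 0)
    (hct : thetaRatio γ τ = c / t) :
    kernelCurve a t = Set.range fun z => (Xfun c γ τ z, Yfun c γ τ z) := by
  refine subset_antisymm ?_ ?_
  · rintro ⟨p, q⟩ (hpq : kernelExt a t p q = 0)
    obtain ⟨z, rfl⟩ := h.exists_Xfun_eq p
    rcases (h.kernelExt_Xfun_eq_zero_iff ht hct).1 hpq with rfl | rfl
    · exact ⟨z, by simp only [Yfun_eq_Xfun_neg]⟩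
    · exact ⟨-γ - z, by simp only [Yfun_eq_Xfun_neg, Xfun_reflect, neg_sub, sub_neg_eq_add]⟩
  · rintro _ ⟨z, rfl⟩
    exact h.kernelExt_Xfun_Yfun ht hct z

end IsKernelParameter

end KernelParametrization

section RectangularTheta

/-- The modulus `τ` with `πτ = iT`, for which the period lattice is rectangular. -/
def rectTau (T : ℝ) : ℂ := I * T / π

/-- The modulus of `ϑ(x + iy | rectTau T)`, normalised so as to be periodic in `y`. -/
def normTheta (T x y : ℝ) : ℝ := ‖theta (x + I * y) (rectTau T)‖ * rexp (-(y ^ 2 / T))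

variable {T : ℝ} {x x' y y' : ℝ}

@[simp]
lemma pi_mul_rectTau (T : ℝ) : π * rectTau T = I * T := by
  unfold rectTau
  field_simp

lemma mul_pi_mul_rectTau (s : ℤ) (T : ℝ) : s * π * rectTau T = (s * T : ℝ) * I := by
  rw [mul_assoc, pi_mul_rectTau]
  push_cast
  ring

lemma rectTau_im_pos (hT : 0 < T) : 0 < (rectTau T).im := by
  have : rectTau T = I * (T / π : ℝ) := by simp [rectTau, mul_div_assoc]
  rw [this, Complex.I_mul_im, Complex.ofReal_re]
  positivity

lemma neg_conj_rectTau (T : ℝ) : -conj (rectTau T) = rectTau T := by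
  simp [rectTau, neg_div]

lemma neg_one_div_rectTau (T : ℝ) : -1 / rectTau T = rectTau (π ^ 2 / T) := by
  rcases eq_or_ne T 0 with rfl | hT
  · simp [rectTau]
  · have : (T : ℂ) ≠ 0 := Complex.ofReal_ne_zero.2 hT
    unfold rectTau
    push_cast
    field_simp
    simp

lemma nomeSq_rectTau (T : ℝ) : nomeSq (rectTau T) = (rexp (-(2 * T)) : ℝ) := by
  rw [nomeSq, show 2 * π * I * rectTau T = 2 * I * (π * rectTau T) by ring, pi_mul_rectTau,
    Complex.ofReal_exp]
  congr 1
  push_cast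
  linear_combination 2 * T * Complex.I_sq

lemma theta_conj_rectTau (T : ℝ) (z : ℂ) :
    theta (-conj z) (rectTau T) = conj (theta z (rectTau T)) := by
  have h := theta_conj z (rectTau T)
  rw [neg_conj_rectTau] at h
  rw [theta_neg, h, neg_neg]

lemma theta_add_I_mul (hT : 0 < T) (z : ℂ) :
    theta (z + I * T) (rectTau T) = -cexp (T - 2 * I * z) * theta z (rectTau T) := by
  rw [← pi_mul_rectTau, theta_add_pi_mul (rectTau_im_pos hT), mul_assoc I, pi_mul_rectTau]
  congr 3
  linear_combination -T * Complex.I_sq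

lemma norm_theta_lt (hT : 0 < T) (v : ℝ) (h₀ : 0 ≤ x) (h : x < x') (h₁ : x' ≤ π / 2) :
    ‖theta (x + I * v) (rectTau T)‖ < ‖theta (x' + I * v) (rectTau T)‖ := by
  obtain ⟨C, hC, hprod⟩ := exists_theta_eq_mul_thetaProd (rectTau_im_pos hT)
  have hcos : Real.cos (2 * x') < Real.cos (2 * x) :=
    Real.cos_lt_cos_of_nonneg_of_le_pi (by linarith) (by linarith) (by linarith)
  have exp_add (s t u : ℝ) : cexp (s * (2 * I * (t + I * u))) =
      cexp ((-(2 * s * u) : ℝ) + (2 * s * t : ℝ) * I) := by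
    congr 1
    push_cast
    linear_combination 2 * s * u * Complex.I_sq
  have norm_exp (s t : ℝ) : ‖cexp (s + t * I)‖ = rexp s := by simp [Complex.norm_exp]
  have exp_re (s t : ℝ) : (cexp (s + t * I)).re = rexp s * Real.cos t := by simp [Complex.exp_re]
  have hpos (t : ℝ) : cexp (2 * I * (t + I * v)) =
      cexp ((-(2 * v) : ℝ) + (2 * t : ℝ) * I) := by simpa using exp_add 1 t v
  have hneg (t : ℝ) : cexp (-(2 * I * (t + I * v))) =
      cexp ((2 * v : ℝ) + (-(2 * t) : ℝ) * I) := by simpa using exp_add (-1) t v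
  have hfactor (t : ℝ) : ‖cexp (-(I * (t + I * v)))‖ = rexp v := by simp [Complex.norm_exp]
  have hq : rexp (-(2 * T)) < 1 := by simpa using hT
  simp only [hprod, thetaProd, norm_mul, hfactor, nomeSq_rectTau]
  gcongr
  · apply norm_qPochhammer_lt (Real.exp_pos _).le hq
    · simp only [hpos, norm_exp]
    · simp only [hpos, exp_re]
      gcongr
  · apply norm_qPochhammer_lt (Real.exp_pos _).le hq
    · simp only [hneg, norm_mul, norm_exp]
    · simp only [hneg, Complex.re_ofReal_mul, exp_re, Real.cos_neg]
      gcongr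

lemma normTheta_nonneg (T x y : ℝ) : 0 ≤ normTheta T x y := by unfold normTheta; positivity

lemma norm_theta_eq_normTheta_mul (T x y : ℝ) :
    ‖theta (x + I * y) (rectTau T)‖ = normTheta T x y * rexp (y ^ 2 / T) := by
  rw [normTheta, mul_assoc, ← Real.exp_add, neg_add_cancel, Real.exp_zero, mul_one]

@[simp]
lemma normTheta_zero_zero (T : ℝ) : normTheta T 0 0 = 0 := by simp [normTheta]

lemma normTheta_neg_left (T x y : ℝ) : normTheta T (-x) y = normTheta T x y := by
  have : ((-x : ℝ) : ℂ) + I * y = -conj (x + I * y) := by simp [add_comm]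
  rw [normTheta, this, theta_conj_rectTau, RCLike.norm_conj, normTheta]

lemma normTheta_neg (T x y : ℝ) : normTheta T x (-y) = normTheta T x y := by
  have : (x : ℂ) + I * (-y : ℝ) = -((-x : ℝ) + I * y) := by push_cast; ring
  rw [normTheta, this, theta_neg, norm_neg, neg_sq, ← normTheta, normTheta_neg_left]

lemma normTheta_add_pi (T x y : ℝ) : normTheta T (x + π) y = normTheta T x y := by
  have : ((x + π : ℝ) : ℂ) + I * y = x + I * y + π := by push_cast; ring
  rw [normTheta, this, theta_add_pi, norm_neg, normTheta]

lemma normTheta_add (hT : 0 < T) (x y : ℝ) : normTheta T x (y + T) = normTheta T x y := by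
  have : (x : ℂ) + I * (y + T : ℝ) = x + I * y + I * T := by push_cast; ring
  have hre : ((T : ℂ) - 2 * I * (x + I * y)).re = T + 2 * y := by simp
  rw [normTheta, this, theta_add_I_mul hT, norm_mul, norm_neg, Complex.norm_exp, hre,
    mul_right_comm, ← Real.exp_add, mul_comm, normTheta]
  congr 2
  field_simp
  ring

lemma normTheta_sub (hT : 0 < T) (x y : ℝ) : normTheta T x (T - y) = normTheta T x y := by
  rw [← normTheta_neg T x y, ← normTheta_add hT x (-y), neg_add_eq_sub]

lemma normTheta_eq_mul_norm_theta (hT : 0 < T) (x y : ℝ) :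
    normTheta T x y = √(π / T) * rexp (-(x ^ 2 / T)) *
      ‖theta ((π / T * y : ℝ) + I * (-(π / T * x) : ℝ)) (rectTau (π ^ 2 / T))‖ := by
  have hT' : (T : ℂ) ≠ 0 := Complex.ofReal_ne_zero.2 hT.ne'
  have hπ : (π : ℂ) ≠ 0 := Complex.ofReal_ne_zero.2 Real.pi_ne_zero
  have hconst : ‖I / (-I * rectTau T) ^ (1 / 2 : ℂ)‖ = √(π / T) := by
    have : -I * rectTau T = (T / π : ℝ) := by
      rw [rectTau]
      push_cast
      linear_combination -(T / π) * Complex.I_sq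
    rw [this, norm_div, Complex.norm_I, Complex.norm_cpow_eq_rpow_re_of_pos (by positivity),
      show (1 / 2 : ℂ).re = 1 / 2 by norm_num, ← Real.sqrt_eq_rpow, ← Real.sqrt_one,
      ← Real.sqrt_div zero_le_one, one_div_div]
  have hexp : ‖cexp (-(I * (x + I * y) ^ 2) / (π * rectTau T))‖ =
      rexp (-(x ^ 2 / T)) * rexp (y ^ 2 / T) := by
    have : -(I * (x + I * y) ^ 2) / (π * rectTau T) =
        ((-(x ^ 2 / T) + y ^ 2 / T : ℝ) : ℂ) + (-(2 * x * y / T) : ℝ) * I := by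
      rw [pi_mul_rectTau]
      push_cast
      field_simp
      linear_combination -(y : ℂ) ^ 2 * Complex.I_sq
    rw [this, Complex.norm_exp, ← Real.exp_add, Complex.add_re, Complex.ofReal_re,
      Complex.re_ofReal_mul, Complex.I_re, mul_zero, add_zero]
  have harg : (x + I * y) / rectTau T = (π / T * y : ℝ) + I * (-(π / T * x) : ℝ) := by
    rw [rectTau]
    push_cast
    field_simp
    linear_combination (x : ℂ) * Complex.I_sq
  rw [normTheta, theta_functional_equation (rectTau_im_pos hT), norm_mul, norm_mul, hconst, hexp,
    harg, neg_one_div_rectTau, Real.exp_neg (y ^ 2 / T)]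
  field_simp

lemma normTheta_lt (hT : 0 < T) (x : ℝ) (h₀ : 0 ≤ y) (h : y < y') (h₁ : y' ≤ T / 2) :
    normTheta T x y < normTheta T x y' := by
  rw [normTheta_eq_mul_norm_theta hT, normTheta_eq_mul_norm_theta hT]
  gcongr
  refine norm_theta_lt (by positivity) _ (by positivity) (by gcongr) ?_
  calc π / T * y' ≤ π / T * (T / 2) := by gcongr
    _ = π / 2 := by field_simp

lemma normTheta_le (hT : 0 < T) (x : ℝ) (h₀ : 0 ≤ y) (h : y ≤ y') (h₁ : y' ≤ T / 2) :
    normTheta T x y ≤ normTheta T x y' := by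
  rcases h.eq_or_lt with rfl | h
  · rfl
  · exact (normTheta_lt hT x h₀ h h₁).le

lemma normTheta_lt_of_half_le (hT : 0 < T) (x : ℝ) (h₀ : T / 2 ≤ y) (h : y < y') (h₁ : y' ≤ T) :
    normTheta T x y' < normTheta T x y := by
  rw [← normTheta_sub hT x y, ← normTheta_sub hT x y']
  exact normTheta_lt hT x (by linarith) (by linarith) (by linarith)

lemma normTheta_pos (hT : 0 < T) (x : ℝ) (h₀ : 0 < y) (h₁ : y < T) : 0 < normTheta T x y := by
  rcases le_total y (T / 2) with h | h
  · exact (normTheta_nonneg T x 0).trans_lt (normTheta_lt hT x le_rfl h₀ h)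
  · exact (normTheta_nonneg T x T).trans_lt (normTheta_lt_of_half_le hT x h h₁ le_rfl)

lemma theta_ne_zero_of_im_mem_Ioo (hT : 0 < T) {z : ℂ} (hz : z.im ∈ Set.Ioo 0 T) :
    theta z (rectTau T) ≠ 0 := by
  have hpos := normTheta_pos hT z.re hz.1 hz.2
  rw [← norm_pos_iff, ← Complex.re_add_im z, mul_comm (z.im : ℂ), norm_theta_eq_normTheta_mul]
  positivity

lemma continuousAt_normTheta {X : Type*} [TopologicalSpace X] {f g h : X → ℝ} {p : X}
    (hf : ContinuousAt f p) (hg : ContinuousAt g p) (hh : ContinuousAt h p) (h₀ : 0 < f p) :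
    ContinuousAt (fun q => normTheta (f q) (g q) (h q)) p := by
  unfold normTheta
  refine ContinuousAt.mul (ContinuousAt.norm ?_) ?_
  · refine (continuousAt_theta (rectTau_im_pos h₀) (g p + I * h p)).comp
      (f := fun q => (g q + I * h q, rectTau (f q))) (x := p) ?_
    unfold rectTau
    fun_prop
  · exact Real.continuous_exp.continuousAt.comp ((hh.pow 2).div hf h₀.ne').neg

/-- The values of `ϑ( · | rectTau T)` on the imaginary axis, which are real. -/
def axisTheta (T y : ℝ) : ℝ := (theta (I * y) (rectTau T)).re

lemma theta_I_mul (T y : ℝ) : theta (I * y) (rectTau T) = axisTheta T y := by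
  have h := theta_conj_rectTau T (I * y)
  rw [map_mul, Complex.conj_I, Complex.conj_ofReal, neg_mul, neg_neg] at h
  exact (Complex.conj_eq_iff_re.1 h.symm).symm

lemma abs_axisTheta (T y : ℝ) : |axisTheta T y| = normTheta T 0 y * rexp (y ^ 2 / T) := by
  rw [← norm_theta_eq_normTheta_mul, Complex.ofReal_zero, zero_add, theta_I_mul,
    Complex.norm_real, Real.norm_eq_abs]

lemma axisTheta_add (hT : 0 < T) (y : ℝ) :
    axisTheta T (y + T) = -rexp (T + 2 * y) * axisTheta T y := by
  have h := theta_add_I_mul hT (I * y)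
  have hexp : (T : ℂ) - 2 * I * (I * y) = (T + 2 * y : ℝ) := by
    push_cast
    linear_combination -(2 * y) * Complex.I_sq
  rw [← mul_add, ← Complex.ofReal_add, theta_I_mul, theta_I_mul, hexp] at h
  exact_mod_cast h

lemma axisTheta_div_pos (hT : 0 < T) (hy : y ∈ Set.Ioo 0 T) (hy' : y' ∈ Set.Ioo 0 T) :
    0 < axisTheta T y / axisTheta T y' := by
  have hne (w : ℝ) (hw : w ∈ Set.Ioo 0 T) : axisTheta T w ≠ 0 := by
    have hpos := normTheta_pos hT 0 hw.1 hw.2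
    rw [← abs_pos, abs_axisTheta]
    positivity
  have hcont : Continuous (axisTheta T) := by
    have := (differentiable_theta (rectTau_im_pos hT)).continuous
    unfold axisTheta
    fun_prop
  by_contra! hle
  have hzero : (0 : ℝ) ∈ Set.uIcc (axisTheta T y) (axisTheta T y') := by
    rw [Set.mem_uIcc]
    rcases div_nonpos_iff.1 hle with h | h
    · exact Or.inr ⟨h.2, h.1⟩
    · exact Or.inl h
  obtain ⟨w, hw, hw₀⟩ := intermediate_value_uIcc hcont.continuousOn hzero
  exact hne w (Set.ordConnected_Ioo.uIcc_subset hy hy' hw) hw₀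

lemma axisTheta_div_eq (h : 0 < axisTheta T y / axisTheta T y') :
    axisTheta T y / axisTheta T y' =
      normTheta T 0 y / normTheta T 0 y' * rexp ((y ^ 2 - y' ^ 2) / T) := by
  rw [← abs_of_pos h, abs_div, abs_axisTheta, abs_axisTheta, sub_div, Real.exp_sub]
  field_simp

lemma hasSum_theta_pi_div_two (hT : 0 < T) (y : ℝ) :
    HasSum (fun n : ℕ => I * (rexp (-T * (n + 1 / 2) ^ 2) *
      (rexp ((2 * n + 1) * y) + rexp (-((2 * n + 1) * y))) : ℝ))
      (theta (π / 2 + I * y) (rectTau T)) := by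
  rw [theta_eq_jacobiTheta₂ (rectTau_im_pos hT)]
  refine (hasSum_theta (rectTau_im_pos hT) _).congr_fun fun n => ?_
  have hnome : I * π * rectTau T = -T := by
    rw [mul_assoc, pi_mul_rectTau]
    linear_combination T * Complex.I_sq
  have hexp : cexp ((2 * n + 1) * I * (π / 2 + I * y)) =
      (-1) ^ n * I * cexp (-((2 * n + 1) * y)) := by
    have : (2 * n + 1) * I * (π / 2 + I * y) = n * (π * I) + π / 2 * I + -((2 * n + 1) * y) := by
      linear_combination (2 * n + 1) * y * Complex.I_sq
    rw [this, Complex.exp_add, Complex.exp_add, Complex.exp_nat_mul, Complex.exp_pi_mul_I,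
      Complex.exp_pi_div_two_mul_I]
  have hsign : (-1 : ℂ) ^ n * (-1) ^ n = 1 := by rw [← mul_pow]; simp
  rw [hnome, Complex.exp_neg ((2 * n + 1) * I * (π / 2 + I * y)), hexp, mul_inv, mul_inv,
    ← Complex.exp_neg, Complex.inv_I, neg_neg, ← inv_pow, show (-1 : ℂ)⁻¹ = -1 by norm_num]
  push_cast
  linear_combination (-(I * cexp (-T * ((n : ℂ) + 1 / 2) ^ 2) *
    (cexp ((2 * n + 1) * y) + cexp (-((2 * n + 1) * y))))) * hsign

lemma theta_pi_div_two (hT : 0 < T) (y : ℝ) : theta (π / 2 + I * y) (rectTau T) =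
    I * (normTheta T (π / 2) y * rexp (y ^ 2 / T) : ℝ) := by
  have h := hasSum_theta_pi_div_two hT y
  obtain ⟨r, hr⟩ := Complex.summable_ofReal.1
    ((summable_mul_left_iff Complex.I_ne_zero).1 h.summable)
  have hr₀ : 0 ≤ r := hr.nonneg fun n => by positivity
  have hval := h.unique ((Complex.hasSum_ofReal.2 hr).mul_left I)
  rw [← norm_theta_eq_normTheta_mul, Complex.ofReal_div, Complex.ofReal_ofNat, hval, norm_mul,
    Complex.norm_I, one_mul, Complex.norm_real, Real.norm_of_nonneg hr₀]

lemma hasSum_normTheta_pi_div_two (hT : 0 < T) (y : ℝ) :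
    HasSum (fun n : ℕ => rexp (-T * (n + 1 / 2) ^ 2) *
      (rexp ((2 * n + 1) * y) + rexp (-((2 * n + 1) * y))) * rexp (-(y ^ 2 / T)))
      (normTheta T (π / 2) y) := by
  have h := hasSum_theta_pi_div_two hT y
  rw [theta_pi_div_two hT, hasSum_mul_left_iff Complex.I_ne_zero, Complex.hasSum_ofReal] at h
  have hscale : normTheta T (π / 2) y * rexp (y ^ 2 / T) * rexp (-(y ^ 2 / T)) =
      normTheta T (π / 2) y := by
    rw [mul_assoc, ← Real.exp_add, add_neg_cancel, Real.exp_zero, mul_one]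
  exact hscale ▸ h.mul_right (rexp (-(y ^ 2 / T)))

lemma normTheta_pi_div_two_pos (hT : 0 < T) (y : ℝ) : 0 < normTheta T (π / 2) y := by
  have h := hasSum_normTheta_pi_div_two hT y
  rw [← h.tsum_eq]
  exact h.summable.tsum_pos (fun n => by positivity) 0 (by positivity)

end RectangularTheta

lemma exists_continuous_zero {X : Type*} [TopologicalSpace X] (F : X → ℝ → ℝ) {p q : ℝ}
    (hpq : p < q) (hF : ∀ y, Continuous fun x => F x y) (hF' : ∀ x, Continuous (F x))
    (hp : ∀ x, F x p < 0) (hq : ∀ x, 0 < F x q) (hmono : ∀ x, StrictMonoOn (F x) (Set.Icc p q)) :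
    ∃ η : X → ℝ, Continuous η ∧ ∀ x, η x ∈ Set.Ioo p q ∧ F x (η x) = 0 := by
  choose η hη hzero using fun x =>
    intermediate_value_Ioo hpq.le (hF' x).continuousOn ⟨hp x, hq x⟩
  have hIcc (x : X) : η x ∈ Set.Icc p q := Set.Ioo_subset_Icc_self (hη x)
  have lt_iff {x : X} {y : ℝ} (hy : y ∈ Set.Icc p q) : y < η x ↔ F x y < 0 := by
    rw [← hzero x, (hmono x).lt_iff_lt hy (hIcc x)]
  have gt_iff {x : X} {y : ℝ} (hy : y ∈ Set.Icc p q) : η x < y ↔ 0 < F x y := by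
    rw [← hzero x, (hmono x).lt_iff_lt (hIcc x) hy]
  refine ⟨η, continuous_iff_continuousAt.2 fun x => tendsto_order.2
    ⟨fun l hl => ?_, fun u hu => ?_⟩, fun x => ⟨hη x, hzero x⟩⟩
  · have hmem : max l p ∈ Set.Icc p q :=
      ⟨le_max_right _ _, max_le (hl.le.trans (hη x).2.le) hpq.le⟩
    have hneg := (lt_iff hmem).1 (max_lt hl (hη x).1)
    filter_upwards [(hF (max l p)).continuousAt.eventually_lt_const hneg] with w hw
    exact (le_max_left l p).trans_lt ((lt_iff hmem).2 hw)
  · have hmem : min u q ∈ Set.Icc p q :=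
      ⟨le_min ((hη x).1.le.trans hu.le) hpq.le, min_le_right _ _⟩
    have hpos := (gt_iff hmem).1 (lt_min hu (hη x).2)
    filter_upwards [(hF (min u q)).continuousAt.eventually_const_lt hpos] with w hw
    exact ((gt_iff hmem).2 hw).trans_le (min_le_left u q)

section RealParameters

variable {a T g : ℝ}

/-- Parameters `τ = rectTau T` and `γ = ig` on the imaginary axis, with `γ` in the range that is
needed for the bands, and `c > 0`. -/
structure IsRealParameter (a T g c : ℝ) : Prop
    extends IsKernelParameter a c (I * g) (rectTau T) where
  a_pos : 0 < a
  T_pos : 0 < T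
  lt_g : T / 4 < g
  g_lt : g < T / 3
  c_pos : 0 < c

/-- The coefficient `c`, normalised like `normTheta`: `c = normCoeff T g * exp (4 g² / T)`. -/
def normCoeff (T g : ℝ) : ℝ := √(normTheta T 0 (3 * g) / normTheta T 0 g)

/-- The modulus of `X(x + iy)`, written with `normTheta`; the Gaussian factors cancel. -/
def normX (T g x y : ℝ) : ℝ :=
  normCoeff T g * (normTheta T x y * normTheta T x (y + g)) /
    (normTheta T x (y - g) * normTheta T x (y + 2 * g))

/-- The step polynomial on the diagonal `x = y`. -/
def diagonalStep (a x : ℝ) : ℝ := 2 * x + 2 / x + a * x ^ 2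

/-- The difference of the two sides of the equation for `g = ρ T` that results from eliminating
`c` from the equations for `c²` and `a c³`. -/
def balance (a T ρ : ℝ) : ℝ :=
  normTheta T 0 (4 * (ρ * T)) ^ 2 * normTheta T 0 (ρ * T) ^ 3 -
    a ^ 2 * (normTheta T 0 (3 * (ρ * T)) ^ 3 * normTheta T 0 (2 * (ρ * T)) ^ 2)

lemma normCoeff_pos (hT : 0 < T) (h₁ : T / 4 < g) (h₂ : g < T / 3) : 0 < normCoeff T g :=
  Real.sqrt_pos.2 (div_pos (normTheta_pos hT 0 (by linarith) (by linarith))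
    (normTheta_pos hT 0 (by linarith) (by linarith)))

lemma normCoeff_sq (T g : ℝ) : normCoeff T g ^ 2 = normTheta T 0 (3 * g) / normTheta T 0 g :=
  Real.sq_sqrt (div_nonneg (normTheta_nonneg _ _ _) (normTheta_nonneg _ _ _))

lemma sq_normCoeff_mul_exp (hT : 0 < T) (h₁ : T / 4 < g) (h₂ : g < T / 3) :
    (normCoeff T g * rexp (4 * g ^ 2 / T)) ^ 2 = axisTheta T (3 * g) / axisTheta T g := by
  rw [axisTheta_div_eq (axisTheta_div_pos hT ⟨by linarith, by linarith⟩
    ⟨by linarith, by linarith⟩), mul_pow, normCoeff_sq, ← Real.exp_nat_mul]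
  congr 2
  push_cast
  ring

lemma mul_cube_normCoeff_mul_exp (ha : 0 < a) (hT : 0 < T) (h₁ : T / 4 < g) (h₂ : g < T / 3)
    (h : normTheta T 0 (4 * g) ^ 2 * normTheta T 0 g ^ 3 =
      a ^ 2 * (normTheta T 0 (3 * g) ^ 3 * normTheta T 0 (2 * g) ^ 2)) :
    a * (normCoeff T g * rexp (4 * g ^ 2 / T)) ^ 3 =
      -(axisTheta T (4 * g) / axisTheta T (2 * g)) := by
  have hθ₁ := normTheta_pos hT 0 (y := g) (by linarith) (by linarith)
  have hθ₂ := normTheta_pos hT 0 (y := 2 * g) (by linarith) (by linarith)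
  have hcoeff := normCoeff_pos hT h₁ h₂
  have hpos : 0 < -(axisTheta T (4 * g) / axisTheta T (2 * g)) := by
    have hquot := axisTheta_div_pos hT (y := 4 * g - T) (y' := 2 * g)
      ⟨by linarith, by linarith⟩ ⟨by linarith, by linarith⟩
    rw [← sub_add_cancel (4 * g) T, axisTheta_add hT, neg_mul, neg_div, neg_neg, mul_div_assoc]
    positivity
  have habs : -(axisTheta T (4 * g) / axisTheta T (2 * g)) =
      normTheta T 0 (4 * g) / normTheta T 0 (2 * g) * rexp (4 * g ^ 2 / T) ^ 3 := by
    rw [← abs_of_pos hpos, abs_neg, abs_div, abs_axisTheta, abs_axisTheta, ← Real.exp_nat_mul,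
      show ((3 : ℕ) : ℝ) * (4 * g ^ 2 / T) = (4 * g) ^ 2 / T - (2 * g) ^ 2 / T by
        push_cast; ring, Real.exp_sub]
    field_simp
  rw [habs, mul_pow, ← mul_assoc]
  congr 1
  refine (sq_eq_sq₀ (by positivity) (div_nonneg (normTheta_nonneg _ _ _) hθ₂.le)).1 ?_
  calc (a * normCoeff T g ^ 3) ^ 2 = a ^ 2 * (normCoeff T g ^ 2) ^ 3 := by ring
    _ = (normTheta T 0 (4 * g) / normTheta T 0 (2 * g)) ^ 2 := by
      rw [normCoeff_sq, div_pow, div_pow, mul_div_assoc', div_eq_div_iff (by positivity)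
        (by positivity)]
      linear_combination -h

lemma isRealParameter_of_balance_eq_zero {ρ : ℝ} (ha : 0 < a) (hT : 0 < T)
    (hρ : ρ ∈ Set.Ioo (1 / 4) (1 / 3)) (h : balance a T ρ = 0) :
    IsRealParameter a T (ρ * T) (normCoeff T (ρ * T) * rexp (4 * (ρ * T) ^ 2 / T)) := by
  have h₁ : T / 4 < ρ * T := by nlinarith [hρ.1]
  have h₂ : ρ * T < T / 3 := by nlinarith [hρ.2]
  set g := ρ * T
  have hcoeff := normCoeff_pos hT h₁ h₂
  have h2 : 2 * (I * g) = I * (2 * g : ℝ) := by push_cast; ring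
  have h3 : 3 * (I * g) = I * (3 * g : ℝ) := by push_cast; ring
  have h4 : 4 * (I * g) = I * (4 * g : ℝ) := by push_cast; ring
  have notMem (y : ℝ) (h₀ : 0 < y) (hy : y < T) : I * y ∉ periodLattice (rectTau T) := by
    rw [← theta_eq_zero_iff (rectTau_im_pos hT)]
    exact theta_ne_zero_of_im_mem_Ioo hT (by simpa using ⟨h₀, hy⟩)
  refine ⟨⟨rectTau_im_pos hT, notMem g (by linarith) (by linarith), ?_, ?_, ?_, ?_⟩,
    ha, hT, h₁, h₂, by positivity⟩
  · exact h2 ▸ notMem (2 * g) (by linarith) (by linarith)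
  · exact h3 ▸ notMem (3 * g) (by linarith) (by linarith)
  · rw [h3, theta_I_mul, theta_I_mul]
    exact_mod_cast sq_normCoeff_mul_exp hT h₁ h₂
  · rw [h4, h2, theta_I_mul, theta_I_mul]
    exact_mod_cast mul_cube_normCoeff_mul_exp ha hT h₁ h₂ (sub_eq_zero.1 h)

lemma normTheta_four_mul (hT : 0 < T) (ρ : ℝ) :
    normTheta T 0 (4 * (ρ * T)) = normTheta T 0 ((4 * ρ - 1) * T) := by
  rw [← normTheta_add hT _ ((4 * ρ - 1) * T)]
  congr 1
  ring

lemma balance_strictMonoOn (ha : 0 < a) (hT : 0 < T) :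
    StrictMonoOn (balance a T) (Set.Icc (1 / 4) (1 / 3)) := by
  intro r hr s hs hrs
  have hr₁ := hr.1
  have hs₂ := hs.2
  have h4 : normTheta T 0 (4 * (r * T)) < normTheta T 0 (4 * (s * T)) := by
    rw [normTheta_four_mul hT, normTheta_four_mul hT]
    exact normTheta_lt hT 0 (mul_nonneg (by linarith) hT.le) (by gcongr) (by nlinarith)
  have h1 : normTheta T 0 (r * T) < normTheta T 0 (s * T) :=
    normTheta_lt hT 0 (mul_nonneg (by linarith) hT.le) (by gcongr) (by nlinarith)
  have h3 : normTheta T 0 (3 * (s * T)) < normTheta T 0 (3 * (r * T)) :=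
    normTheta_lt_of_half_le hT 0 (by nlinarith) (by gcongr) (by nlinarith)
  have h2 : normTheta T 0 (2 * (s * T)) < normTheta T 0 (2 * (r * T)) :=
    normTheta_lt_of_half_le hT 0 (by nlinarith) (by gcongr) (by nlinarith)
  have nonneg := normTheta_nonneg T 0
  have := nonneg (4 * (r * T))
  have := nonneg (r * T)
  have := nonneg (3 * (s * T))
  have := nonneg (2 * (s * T))
  have := this.trans_lt h2
  unfold balance
  gcongr

lemma balance_quarter_neg (ha : 0 < a) (hT : 0 < T) : balance a T (1 / 4) < 0 := by
  have h3 := normTheta_pos hT 0 (y := 3 * (1 / 4 * T)) (by linarith) (by linarith)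
  have h2 := normTheta_pos hT 0 (y := 2 * (1 / 4 * T)) (by linarith) (by linarith)
  have h4 : normTheta T 0 (4 * (1 / 4 * T)) = 0 := by
    rw [normTheta_four_mul hT, show (4 * (1 / 4) - 1) * T = 0 by ring, normTheta_zero_zero]
  rw [balance, h4, sub_neg, zero_pow two_ne_zero, zero_mul]
  positivity

lemma balance_third_pos (hT : 0 < T) : 0 < balance a T (1 / 3) := by
  have h1 := normTheta_pos hT 0 (y := 1 / 3 * T) (by linarith) (by linarith)
  have h3 : normTheta T 0 (3 * (1 / 3 * T)) = 0 := by
    rw [show 3 * (1 / 3 * T) = 0 + T by ring, normTheta_add hT, normTheta_zero_zero]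
  have h4 : 0 < normTheta T 0 (4 * (1 / 3 * T)) := by
    rw [normTheta_four_mul hT]
    exact normTheta_pos hT 0 (by linarith) (by linarith)
  rw [balance, h3, sub_pos, zero_pow three_ne_zero, zero_mul, mul_zero]
  positivity

lemma continuousAt_balance {X : Type*} [TopologicalSpace X] {f g : X → ℝ} {p : X}
    (hf : ContinuousAt f p) (hg : ContinuousAt g p) (h₀ : 0 < f p) :
    ContinuousAt (fun q => balance a (f q) (g q)) p := by
  have hθ {k : X → ℝ} (hk : ContinuousAt k p) : ContinuousAt (fun q => normTheta (f q) 0 (k q)) p :=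
    continuousAt_normTheta hf continuousAt_const hk h₀
  exact (((hθ (continuousAt_const.mul (hg.mul hf))).pow 2).mul ((hθ (hg.mul hf)).pow 3)).sub
    (continuousAt_const.mul (((hθ (continuousAt_const.mul (hg.mul hf))).pow 3).mul
      ((hθ (continuousAt_const.mul (hg.mul hf))).pow 2)))

lemma exists_continuous_isRealParameter (ha : 0 < a) :
    ∃ g c : Set.Ioi (0 : ℝ) → ℝ, Continuous g ∧
      ∀ T : Set.Ioi (0 : ℝ), IsRealParameter a T (g T) (c T) := by
  obtain ⟨ρ, hcont, hρ⟩ := exists_continuous_zero (fun (T : Set.Ioi (0 : ℝ)) ρ => balance a T ρ)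
    (p := 1 / 4) (q := 1 / 3) (by norm_num)
    (fun ρ => continuous_iff_continuousAt.2 fun T =>
      continuousAt_balance (by fun_prop) continuousAt_const T.2)
    (fun T => continuous_iff_continuousAt.2 fun ρ =>
      continuousAt_balance continuousAt_const continuousAt_id T.2)
    (fun T => balance_quarter_neg ha T.2) (fun T => balance_third_pos T.2)
    (fun T => balance_strictMonoOn ha T.2)
  exact ⟨fun T => ρ T * T, _, by fun_prop,
    fun T => isRealParameter_of_balance_eq_zero ha T.2 (hρ T).1 (hρ T).2⟩

end RealParameters

section DiagonalValues

variable {a T g c : ℝ}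

namespace IsRealParameter

lemma g_pos (h : IsRealParameter a T g c) : 0 < g := by linarith [h.T_pos, h.lt_g]

lemma normCoeff_pos (h : IsRealParameter a T g c) : 0 < normCoeff T g :=
  AModel.normCoeff_pos h.T_pos h.lt_g h.g_lt

lemma c_eq (h : IsRealParameter a T g c) : c = normCoeff T g * rexp (4 * g ^ 2 / T) := by
  refine (sq_eq_sq₀ h.c_pos.le (mul_pos h.normCoeff_pos (Real.exp_pos _)).le).1 ?_
  rw [sq_normCoeff_mul_exp h.T_pos h.lt_g h.g_lt]
  have hsq := h.sq_eq
  rw [show 3 * (I * g) = I * (3 * g : ℝ) by push_cast; ring, theta_I_mul, theta_I_mul] at hsq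
  exact_mod_cast hsq

lemma normX_pi_div_two_pos (h : IsRealParameter a T g c) (y : ℝ) : 0 < normX T g (π / 2) y := by
  have := h.normCoeff_pos
  have := normTheta_pi_div_two_pos h.T_pos
  exact div_pos (mul_pos ‹_› (mul_pos (this _) (this _))) (mul_pos (this _) (this _))

lemma numerX_pi_div_two (h : IsRealParameter a T g c) (y : ℝ) :
    numerX c (I * g) (rectTau T) (π / 2 + I * y) =
      normX T g (π / 2) y * denomX (I * g) (rectTau T) (π / 2 + I * y) := by
  have hT := h.T_pos
  have hθ₁ := normTheta_pi_div_two_pos hT (y - g)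
  have hθ₂ := normTheta_pi_div_two_pos hT (y + 2 * g)
  rw [numerX, denomX, thetaPair, thetaPair, add_zero,
    show π / 2 + I * y + I * g = π / 2 + I * (y + g : ℝ) by push_cast; ring,
    show π / 2 + I * y + -(I * g) = π / 2 + I * (y - g : ℝ) by push_cast; ring,
    show π / 2 + I * y + 2 * (I * g) = π / 2 + I * (y + 2 * g : ℝ) by push_cast; ring,
    theta_pi_div_two hT, theta_pi_div_two hT, theta_pi_div_two hT, theta_pi_div_two hT]
  have hexp : rexp (4 * g ^ 2 / T) * (rexp (y ^ 2 / T) * rexp ((y + g) ^ 2 / T)) =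
      rexp ((y - g) ^ 2 / T) * rexp ((y + 2 * g) ^ 2 / T) := by
    simp only [← Real.exp_add]
    ring_nf
  have hreal : c * ((normTheta T (π / 2) y * rexp (y ^ 2 / T)) *
      (normTheta T (π / 2) (y + g) * rexp ((y + g) ^ 2 / T))) =
      normX T g (π / 2) y * ((normTheta T (π / 2) (y - g) * rexp ((y - g) ^ 2 / T)) *
        (normTheta T (π / 2) (y + 2 * g) * rexp ((y + 2 * g) ^ 2 / T))) := by
    rw [h.c_eq, normX, div_mul_eq_mul_div, eq_div_iff (by positivity)]
    linear_combination (normCoeff T g * (normTheta T (π / 2) y * normTheta T (π / 2) (y + g)) *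
      (normTheta T (π / 2) (y - g) * normTheta T (π / 2) (y + 2 * g))) * hexp
  have hcomplex := congrArg ((↑) : ℝ → ℂ) hreal
  push_cast at hcomplex ⊢
  linear_combination I ^ 2 * hcomplex

lemma normX_pi_div_two_zero (h : IsRealParameter a T g c) : normX T g (π / 2) 0 =
    normCoeff T g * normTheta T (π / 2) 0 / normTheta T (π / 2) (2 * g) := by
  rw [normX, zero_sub, zero_add, zero_add, normTheta_neg, ← mul_assoc,
    mul_comm (normTheta T (π / 2) g) (normTheta T (π / 2) (2 * g)),
    mul_div_mul_right _ _ (normTheta_pi_div_two_pos h.T_pos g).ne']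

lemma normX_pi_div_two_half (h : IsRealParameter a T g c) : normX T g (π / 2) (T / 2) =
    normCoeff T g * normTheta T (π / 2) (T / 2) / normTheta T (π / 2) (2 * g - T / 2) := by
  have hreflect : normTheta T (π / 2) (T / 2 + 2 * g) = normTheta T (π / 2) (2 * g - T / 2) := by
    rw [← normTheta_add h.T_pos _ (2 * g - T / 2)]
    ring_nf
  have hreflect' : normTheta T (π / 2) (T / 2 - g) = normTheta T (π / 2) (T / 2 + g) := by
    rw [← normTheta_sub h.T_pos]
    ring_nf
  rw [normX, hreflect, hreflect', mul_comm (normTheta T (π / 2) (T / 2 + g)), ← mul_assoc,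
    mul_div_mul_right _ _ (normTheta_pi_div_two_pos h.T_pos _).ne']

lemma thetaRatio_eq_normX_zero (h : IsRealParameter a T g c) :
    thetaRatio (I * g) (rectTau T) = (c * diagonalStep a (normX T g (π / 2) 0) : ℝ) := by
  have hvalue := h.numerX_pi_div_two 0
  rw [Complex.ofReal_zero, mul_zero, add_zero] at hvalue
  rw [h.thetaRatio_eq_of_diagonal (Complex.ofReal_ne_zero.2 (h.normX_pi_div_two_pos 0).ne') hvalue,
    diagonalStep]
  · push_cast
    ring
  · rwa [← numerX_add_pi, ← denomX_add_pi, show -(π / 2 : ℂ) + π = π / 2 by ring]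

lemma thetaRatio_eq_normX_half (h : IsRealParameter a T g c) :
    thetaRatio (I * g) (rectTau T) = (c * diagonalStep a (normX T g (π / 2) (T / 2)) : ℝ) := by
  have hvalue := h.numerX_pi_div_two (T / 2)
  rw [h.thetaRatio_eq_of_diagonal (Complex.ofReal_ne_zero.2 (h.normX_pi_div_two_pos _).ne') hvalue,
    diagonalStep]
  · push_cast
    ring
  · have hperiod : (π / 2 + I * (T / 2 : ℝ) : ℂ) =
        -(π / 2 + I * (T / 2 : ℝ)) + π + π * rectTau T := by
      rw [pi_mul_rectTau]
      push_cast
      ring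
    rw [hperiod, numerX_add_pi_mul h.im_pos, denomX_add_pi_mul h.im_pos, numerX_add_pi,
      denomX_add_pi, mul_left_comm] at hvalue
    exact mul_left_cancel₀ (Complex.exp_ne_zero _) (by rw [hvalue]; ring_nf)

lemma diagonalStep_normX_half_eq (h : IsRealParameter a T g c) :
    diagonalStep a (normX T g (π / 2) (T / 2)) = diagonalStep a (normX T g (π / 2) 0) :=
  mul_left_cancel₀ h.c_pos.ne' (by
    exact_mod_cast h.thetaRatio_eq_normX_half.symm.trans h.thetaRatio_eq_normX_zero)

lemma normX_zero_lt_normX_half (h : IsRealParameter a T g c) :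
    normX T g (π / 2) 0 < normX T g (π / 2) (T / 2) := by
  have hT := h.T_pos
  have hcoeff := h.normCoeff_pos
  have hθ := normTheta_pi_div_two_pos hT
  have hlow : normTheta T (π / 2) 0 < normTheta T (π / 2) (2 * g) := by
    rw [← normTheta_sub hT _ (2 * g)]
    exact normTheta_lt hT _ le_rfl (by linarith [h.g_lt]) (by linarith [h.lt_g])
  have hhigh : normTheta T (π / 2) (2 * g - T / 2) < normTheta T (π / 2) (T / 2) :=
    normTheta_lt hT _ (by linarith [h.lt_g]) (by linarith [h.g_lt]) le_rfl
  calc normX T g (π / 2) 0 < normCoeff T g := by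
        rw [h.normX_pi_div_two_zero, div_lt_iff₀ (hθ _)]
        gcongr
    _ < normX T g (π / 2) (T / 2) := by
        rw [h.normX_pi_div_two_half, lt_div_iff₀ (hθ _)]
        gcongr

end IsRealParameter

lemma hasSum_normTheta_pi_div_two_zero (hT : 0 < T) :
    HasSum (fun n : ℕ => 2 * rexp (-T * (n + 1 / 2) ^ 2)) (normTheta T (π / 2) 0) := by
  refine (hasSum_normTheta_pi_div_two hT 0).congr_fun fun n => ?_
  simp only [mul_zero, neg_zero, Real.exp_zero, zero_pow two_ne_zero, zero_div]
  ring

lemma hasSum_exp_sub_exp (hT : 0 < T) :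
    HasSum (fun n : ℕ => rexp (-T * n ^ 2) - rexp (-T * (n + 1) ^ 2)) 1 := by
  have hlim : Filter.Tendsto (fun n : ℕ => rexp (-T * n ^ 2)) Filter.atTop (𝓝 0) :=
    Real.tendsto_exp_atBot.comp (Filter.Tendsto.const_mul_atTop_of_neg (by linarith)
      ((Filter.tendsto_pow_atTop two_ne_zero).comp tendsto_natCast_atTop_atTop))
  rw [hasSum_iff_tendsto_nat_of_nonneg]
  · have htelescope (n : ℕ) := Finset.sum_range_sub' (fun n : ℕ => rexp (-T * n ^ 2)) n
    push_cast at htelescope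
    simp_rw [htelescope]
    simpa using hlim.const_sub 1
  · intro n
    rw [sub_nonneg, Real.exp_le_exp]
    have : (0 : ℝ) ≤ n := n.cast_nonneg
    nlinarith

/- The terms at height `T / 2` are `exp (-T n²) + exp (-T (n + 1)²)`, those at height `0` are
`2 exp (-T (n + 1/2)²)`: their differences are bounded by a telescoping series. -/
lemma normTheta_pi_div_two_half_le (hT : 0 < T) :
    normTheta T (π / 2) (T / 2) ≤ normTheta T (π / 2) 0 + 1 := by
  refine hasSum_le (fun n => ?_) (hasSum_normTheta_pi_div_two hT (T / 2))
    ((hasSum_normTheta_pi_div_two_zero hT).add (hasSum_exp_sub_exp hT))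
  have : (0 : ℝ) ≤ n := n.cast_nonneg
  have hterm : rexp (-T * (n + 1 / 2) ^ 2) *
      (rexp ((2 * n + 1) * (T / 2)) + rexp (-((2 * n + 1) * (T / 2)))) *
      rexp (-((T / 2) ^ 2 / T)) = rexp (-T * n ^ 2) + rexp (-T * (n + 1) ^ 2) := by
    rw [mul_add, add_mul, ← Real.exp_add, ← Real.exp_add, ← Real.exp_add, ← Real.exp_add]
    congr 2 <;> field_simp <;> ring
  have hmono : rexp (-T * (n + 1) ^ 2) ≤ rexp (-T * (n + 1 / 2) ^ 2) := by
    rw [Real.exp_le_exp]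
    nlinarith
  rw [hterm]
  linarith

lemma exists_lt_normTheta_pi_div_two_zero (M : ℝ) : ∃ T > 0, M < normTheta T (π / 2) 0 := by
  obtain ⟨N, hN⟩ := exists_nat_gt M
  have hcont : Continuous fun T : ℝ => ∑ n ∈ Finset.range N, 2 * rexp (-T * (n + 1 / 2) ^ 2) := by
    fun_prop
  have hzero : M < ∑ n ∈ Finset.range N, 2 * rexp (-0 * ((n : ℝ) + 1 / 2) ^ 2) := by
    simp only [neg_zero, zero_mul, Real.exp_zero, mul_one, Finset.sum_const, Finset.card_range,
      nsmul_eq_mul]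
    linarith [(N.cast_nonneg : (0 : ℝ) ≤ N)]
  have hsmall : ∀ᶠ T in 𝓝[>] 0,
      M < ∑ n ∈ Finset.range N, 2 * rexp (-T * ((n : ℝ) + 1 / 2) ^ 2) :=
    nhdsWithin_le_nhds (hcont.continuousAt.eventually_const_lt hzero)
  obtain ⟨T, hM, hT⟩ := (hsmall.and self_mem_nhdsWithin).exists
  exact ⟨T, hT, hM.trans_le (sum_le_hasSum _ (fun n _ => by positivity)
    (hasSum_normTheta_pi_div_two_zero hT))⟩

lemma normTheta_pi_div_two_zero_le (hT : 1 ≤ T) : normTheta T (π / 2) 0 ≤ 4 * rexp (-T / 4) := by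
  have hT₀ : 0 < T := by linarith
  have hgeom := (hasSum_geometric_of_lt_one (r := 1 / 2) (by norm_num) (by norm_num)).mul_left
    (2 * rexp (-T / 4))
  refine (hasSum_le (fun n => ?_) (hasSum_normTheta_pi_div_two_zero hT₀) hgeom).trans
    (by norm_num; linarith)
  have hn : (0 : ℝ) ≤ n := n.cast_nonneg
  rw [mul_assoc]
  gcongr
  calc rexp (-T * (n + 1 / 2) ^ 2) ≤ rexp (-T / 4 + n * -1) := by
        rw [Real.exp_le_exp]
        nlinarith [mul_nonneg hn (sub_nonneg.2 hT), mul_nonneg (mul_nonneg hn hn) hT₀.le]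
    _ = rexp (-T / 4) * rexp (-1) ^ n := by rw [Real.exp_add, Real.exp_nat_mul]
    _ ≤ rexp (-T / 4) * (1 / 2) ^ n := by
        gcongr
        rw [Real.exp_neg, one_div]
        gcongr
        linarith [Real.exp_one_gt_d9]

lemma exp_mul_normTheta_zero_le (hT : 1 ≤ T) :
    rexp (2 * T / 9) / 4 * normTheta T (π / 2) 0 ≤ normTheta T (π / 2) (T / 3) := by
  have hT₀ : 0 < T := by linarith
  have hfirst : rexp (-T / 4 + 2 * T / 9) ≤ normTheta T (π / 2) (T / 3) := by
    refine le_trans ?_ (le_hasSum (hasSum_normTheta_pi_div_two hT₀ (T / 3)) 0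
      fun n _ => by positivity)
    rw [mul_add, add_mul, ← Real.exp_add, ← Real.exp_add, Nat.cast_zero,
      show -T * (0 + 1 / 2) ^ 2 + (2 * 0 + 1) * (T / 3) + -((T / 3) ^ 2 / T) =
        -T / 4 + 2 * T / 9 by field_simp; ring]
    exact le_add_of_nonneg_right (by positivity)
  calc rexp (2 * T / 9) / 4 * normTheta T (π / 2) 0
      ≤ rexp (2 * T / 9) / 4 * (4 * rexp (-T / 4)) := by
        gcongr
        exact normTheta_pi_div_two_zero_le hT
    _ = rexp (-T / 4 + 2 * T / 9) := by rw [Real.exp_add]; ring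
    _ ≤ normTheta T (π / 2) (T / 3) := hfirst

end DiagonalValues

section ChoiceOfParameters

variable {a T g c E x x₁ x₂ ε : ℝ}

lemma mul_diagonalStep_sub (h₁ : 0 < x₁) (h₂ : x₁ < x₂) (hx : 0 < x)
    (h : diagonalStep a x₁ = diagonalStep a x₂) :
    x * (diagonalStep a x - diagonalStep a x₁) =
      (x - x₁) * (x - x₂) * (a * x + 2 + a * (x₁ + x₂)) := by
  have h₃ : 0 < x₂ := h₁.trans h₂
  have hvieta : x₁ * x₂ * (2 + a * (x₁ + x₂)) = 2 := by
    unfold diagonalStep at h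
    field_simp at h
    refine mul_left_cancel₀ (sub_ne_zero.2 h₂.ne') ?_
    linear_combination -h
  unfold diagonalStep
  field_simp
  linear_combination (x - x₁) * hvieta

lemma mem_Ioo_of_diagonalStep_lt (ha : 0 < a) (h₁ : 0 < x₁) (h₂ : x₁ < x₂) (hx : 0 < x)
    (h : diagonalStep a x₁ = diagonalStep a x₂) (hlt : diagonalStep a x < diagonalStep a x₁) :
    x ∈ Set.Ioo x₁ x₂ := by
  have hneg : (x - x₁) * (x - x₂) * (a * x + 2 + a * (x₁ + x₂)) < 0 := by
    rw [← mul_diagonalStep_sub h₁ h₂ hx h]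
    exact mul_neg_of_pos_of_neg hx (sub_neg.2 hlt)
  have h₃ : 0 < x₂ := h₁.trans h₂
  have hfactor : (x - x₁) * (x - x₂) < 0 := neg_of_mul_neg_left hneg (by positivity)
  constructor <;> nlinarith

lemma continuousAt_diagonalStep (a : ℝ) (hx : x ≠ 0) : ContinuousAt (diagonalStep a) x := by
  unfold diagonalStep
  fun_prop (disch := assumption)

lemma exists_diagonalStep_lt (hE : a + 4 < E) :
    ∃ δ, 0 < δ ∧ δ < 1 ∧ diagonalStep a (1 - δ) < E ∧ diagonalStep a (1 + δ) < E := by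
  have hone : diagonalStep a 1 < E := by
    unfold diagonalStep
    linarith
  have hnear : ∀ᶠ x in 𝓝 1, diagonalStep a x < E :=
    (continuousAt_diagonalStep a one_ne_zero).eventually_lt_const hone
  obtain ⟨r, hr, hball⟩ := Metric.eventually_nhds_iff.1 hnear
  have hmin : min (r / 2) (1 / 2) < r := (min_le_left _ _).trans_lt (half_lt_self hr)
  refine ⟨min (r / 2) (1 / 2), by positivity, (min_le_right _ _).trans_lt (by norm_num),
    hball ?_, hball ?_⟩
  · rwa [Real.dist_eq, sub_sub_cancel_left, abs_neg, abs_of_pos (by positivity)]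
  · rwa [Real.dist_eq, add_sub_cancel_left, abs_of_pos (by positivity)]

namespace IsRealParameter

lemma normX_half_le (h : IsRealParameter a T g c)
    (hε : normTheta T (π / 2) (T / 2) ≤ (1 + ε) * normTheta T (π / 2) 0) :
    normX T g (π / 2) (T / 2) ≤ (1 + ε) ^ 2 * normX T g (π / 2) 0 := by
  have hT := h.T_pos
  have hcoeff := h.normCoeff_pos
  have hθ := normTheta_pi_div_two_pos hT
  have hε₀ : 0 < 1 + ε := pos_of_mul_pos_left ((hθ _).trans_le hε) (hθ _).le
  have hhigh : normX T g (π / 2) (T / 2) ≤ (1 + ε) * normCoeff T g := by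
    rw [h.normX_pi_div_two_half, div_le_iff₀ (hθ _), mul_comm (1 + ε), mul_assoc]
    gcongr
    refine hε.trans ?_
    gcongr
    exact normTheta_le hT _ le_rfl (by linarith [h.lt_g]) (by linarith [h.g_lt])
  have hlow : normCoeff T g ≤ (1 + ε) * normX T g (π / 2) 0 := by
    rw [h.normX_pi_div_two_zero, mul_div_assoc', le_div_iff₀ (hθ _), mul_left_comm]
    gcongr
    refine le_trans ?_ hε
    rw [← normTheta_sub hT _ (2 * g)]
    exact normTheta_le hT _ (by linarith [h.g_lt]) (by linarith [h.lt_g]) le_rfl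
  calc _ ≤ (1 + ε) * normCoeff T g := hhigh
    _ ≤ (1 + ε) * ((1 + ε) * normX T g (π / 2) 0) := by gcongr
    _ = _ := by ring

lemma exp_mul_normX_zero_le (h : IsRealParameter a T g c) (hT₁ : 1 ≤ T) :
    rexp (2 * T / 9) / 4 * normX T g (π / 2) 0 ≤ normX T g (π / 2) (T / 2) := by
  have hT := h.T_pos
  have hcoeff := h.normCoeff_pos
  have hθ := normTheta_pi_div_two_pos hT
  refine le_trans (b := normCoeff T g) ?_ ?_
  · rw [h.normX_pi_div_two_zero, mul_div_assoc', div_le_iff₀ (hθ _), mul_left_comm]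
    gcongr
    refine (exp_mul_normTheta_zero_le hT₁).trans ?_
    rw [← normTheta_sub hT _ (2 * g)]
    exact normTheta_le hT _ (by linarith) (by linarith [h.g_lt]) (by linarith [h.lt_g])
  · rw [h.normX_pi_div_two_half, le_div_iff₀ (hθ _)]
    gcongr
    exact normTheta_le hT _ (by linarith [h.lt_g]) (by linarith [h.g_lt]) le_rfl

end IsRealParameter

/- As `T → 0` the values of `X` at `π/2` and `π/2 + iT/2` both tend to `1`; these are the two
solutions of `diagonalStep a x = E`, and `diagonalStep a 1 = a + 4`. -/
lemma exists_diagonalStep_normX_le (ha : 0 < a) (hE : a + 4 < E) :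
    ∃ T > 0, ∀ g c, IsRealParameter a T g c → diagonalStep a (normX T g (π / 2) 0) ≤ E := by
  obtain ⟨δ, hδ, hδ₁, hsub, hadd⟩ := exists_diagonalStep_lt hE
  obtain ⟨T, hT, hlarge⟩ := exists_lt_normTheta_pi_div_two_zero (2 / δ)
  refine ⟨T, hT, fun g c h => ?_⟩
  by_contra! hlt
  have hratio : normX T g (π / 2) (T / 2) ≤ (1 + δ / 2) ^ 2 * normX T g (π / 2) 0 := by
    refine h.normX_half_le ((normTheta_pi_div_two_half_le hT).trans ?_)
    rw [div_lt_iff₀ hδ] at hlarge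
    linarith
  have hmem {x : ℝ} (hx : 0 < x) (hxE : diagonalStep a x < E) :=
    mem_Ioo_of_diagonalStep_lt ha (h.normX_pi_div_two_pos 0) h.normX_zero_lt_normX_half hx
      h.diagonalStep_normX_half_eq.symm (hxE.trans hlt)
  have hlow := (hmem (by linarith) hsub).1
  have hhigh := (hmem (by linarith) hadd).2
  have : (1 + δ / 2) ^ 2 * normX T g (π / 2) 0 ≤ (1 + δ / 2) ^ 2 * (1 - δ) := by gcongr
  nlinarith [pow_pos hδ 3]

lemma exists_le_diagonalStep_normX (ha : 0 < a) (hE : 0 < E) :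
    ∃ T > 0, ∀ g c, IsRealParameter a T g c → E ≤ diagonalStep a (normX T g (π / 2) 0) := by
  set T : ℝ := 1 + 9 / 2 * E ^ 2 with hTE
  refine ⟨T, by positivity, fun g c h => ?_⟩
  by_contra! hlow
  have hhigh := h.diagonalStep_normX_half_eq ▸ hlow
  have hratio := h.exp_mul_normX_zero_le (by nlinarith)
  have hx := h.normX_pi_div_two_pos 0
  have hy := h.normX_pi_div_two_pos (T / 2)
  set x := normX T g (π / 2) 0
  set y := normX T g (π / 2) (T / 2)
  unfold diagonalStep at hlow hhigh
  have hxE : 2 / x < E := by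
    have : 0 < a * x ^ 2 := by positivity
    linarith
  have hyE : 2 * y < E := by
    have : 0 < a * y ^ 2 := by positivity
    have : 0 < 2 / y := by positivity
    linarith
  rw [div_lt_iff₀ hx] at hxE
  have hexp : E ^ 2 + 1 ≤ rexp (2 * T / 9) :=
    le_trans (by rw [hTE]; linarith) (Real.add_one_le_exp _)
  have : (E ^ 2 + 1) / 4 * x ≤ y := le_trans (by gcongr) hratio
  nlinarith

lemma continuous_normX {g c : Set.Ioi (0 : ℝ) → ℝ} (hg : Continuous g)
    (h : ∀ T : Set.Ioi (0 : ℝ), IsRealParameter a T (g T) (c T)) :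
    Continuous fun T : Set.Ioi (0 : ℝ) => normX T (g T) (π / 2) 0 := by
  refine continuous_iff_continuousAt.2 fun T => ?_
  have hT := (h T).T_pos
  have hθ (x : ℝ) {k : Set.Ioi (0 : ℝ) → ℝ} (hk : Continuous k) :
      ContinuousAt (fun T : Set.Ioi (0 : ℝ) => normTheta T x (k T)) T :=
    continuousAt_normTheta (by fun_prop) continuousAt_const hk.continuousAt hT
  have hθ₁ := normTheta_pos hT 0 (h T).g_pos (by linarith [(h T).g_lt])
  have hpos := normTheta_pi_div_two_pos hT
  unfold normX normCoeff
  exact ((((hθ 0 (by fun_prop)).div (hθ 0 hg) hθ₁.ne').sqrt).mul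
    ((hθ _ (by fun_prop)).mul (hθ _ (by fun_prop)))).div
    ((hθ _ (by fun_prop)).mul (hθ _ (by fun_prop))) (mul_pos (hpos _) (hpos _)).ne'

lemma exists_isRealParameter_thetaRatio_eq (ha : 0 < a) (hE : a + 4 < E) :
    ∃ T g c, IsRealParameter a T g c ∧ thetaRatio (I * g) (rectTau T) = (c * E : ℝ) := by
  obtain ⟨g, c, hg, h⟩ := exists_continuous_isRealParameter ha
  have hcont : Continuous fun T : Set.Ioi (0 : ℝ) =>
      diagonalStep a (normX T (g T) (π / 2) 0) :=
    continuous_iff_continuousAt.2 fun T =>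
      ContinuousAt.comp (g := diagonalStep a)
        (continuousAt_diagonalStep a ((h T).normX_pi_div_two_pos 0).ne')
        (continuous_normX hg h).continuousAt
  obtain ⟨T₀, hT₀, hle⟩ := exists_diagonalStep_normX_le ha hE
  obtain ⟨T₁, hT₁, hge⟩ := exists_le_diagonalStep_normX (E := E) ha (by linarith)
  have : PreconnectedSpace (Set.Ioi (0 : ℝ)) := Subtype.preconnectedSpace isPreconnected_Ioi
  obtain ⟨T, hT : diagonalStep a (normX T (g T) (π / 2) 0) = E⟩ :=
    mem_range_of_exists_le_of_exists_ge hcont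
      ⟨⟨T₀, hT₀⟩, hle _ _ (h ⟨T₀, hT₀⟩)⟩ ⟨⟨T₁, hT₁⟩, hge _ _ (h ⟨T₁, hT₁⟩)⟩
  exact ⟨T, g T, c T, h T, by rw [(h T).thetaRatio_eq_normX_zero, hT]⟩

end ChoiceOfParameters

section PeriodicStrip

variable {f : ℂ → ℂ} {p q C : ℝ}

lemma exists_norm_le_of_periodic_strip (hf : ∀ z : ℂ, p ≤ z.im → z.im ≤ q → ContinuousAt f z)
    (hper : Function.Periodic f (π : ℂ)) : ∃ M, ∀ z : ℂ, p ≤ z.im → z.im ≤ q → ‖f z‖ ≤ M := by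
  have hcompact : IsCompact (Set.Icc (0 : ℝ) π ×ℂ Set.Icc p q) :=
    isCompact_Icc.reProdIm isCompact_Icc
  obtain ⟨M, hM⟩ := hcompact.exists_bound_of_continuousOn fun w hw =>
    (hf w hw.2.1 hw.2.2).continuousWithinAt
  refine ⟨M, fun w hwp hwq => ?_⟩
  have hre : (w - (⌊w.re / π⌋ : ℤ) * (π : ℂ)).re = Int.fract (w.re / π) * π := by
    rw [← Int.self_sub_floor, sub_mul, div_mul_cancel₀ _ Real.pi_ne_zero]
    simp
  rw [← hper.sub_int_mul_eq ⌊w.re / π⌋]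
  refine hM _ ⟨?_, by simpa using ⟨hwp, hwq⟩⟩
  rw [Set.mem_preimage, hre]
  exact ⟨mul_nonneg (Int.fract_nonneg _) Real.pi_pos.le,
    mul_le_of_le_one_left Real.pi_pos.le (Int.fract_lt_one _).le⟩

lemma norm_le_of_periodic_strip (hpq : p < q)
    (hf : ∀ z : ℂ, p ≤ z.im → z.im ≤ q → DifferentiableAt ℂ f z)
    (hper : Function.Periodic f (π : ℂ)) (hp : ∀ z : ℂ, z.im = p → ‖f z‖ ≤ C)
    (hq : ∀ z : ℂ, z.im = q → ‖f z‖ ≤ C) {z : ℂ} (hzp : p ≤ z.im) (hzq : z.im ≤ q) :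
    ‖f z‖ ≤ C := by
  obtain ⟨M, hM⟩ :=
    exists_norm_le_of_periodic_strip (fun w hwp hwq => (hf w hwp hwq).continuousAt) hper
  have hclosure : closure (Complex.im ⁻¹' Set.Ioo p q) ⊆ Complex.im ⁻¹' Set.Icc p q :=
    closure_minimal (Set.preimage_mono Set.Ioo_subset_Icc_self)
      (isClosed_Icc.preimage Complex.continuous_im)
  refine PhragmenLindelof.horizontal_strip ⟨?_, ?_⟩ ?_ hp hq hzp hzq
  · exact fun w hw => (hf w hw.1.le hw.2.le).differentiableWithinAt
  · exact fun w hw =>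
      (hf w (hclosure hw).1 (hclosure hw).2).continuousAt.continuousWithinAt
  · refine ⟨0, div_pos Real.pi_pos (sub_pos.2 hpq), 0, .of_bound M ?_⟩
    refine Filter.Eventually.filter_mono inf_le_right (Filter.eventually_principal.2 fun w hw => ?_)
    simpa using hM w hw.1.le hw.2.le

end PeriodicStrip

section Gap

variable {a T g c : ℝ}

/-- The difference `‖numerX‖ - ‖denomX‖` at `x + I * y`, up to the positive factor of
`IsRealParameter.norm_numerX_sub_norm_denomX`. Its zeros form the level curve `|X| = 1`. -/
def gap (T g x y : ℝ) : ℝ :=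
  normCoeff T g * (normTheta T x y * normTheta T x (y + g)) -
    normTheta T x (y - g) * normTheta T x (y + 2 * g)

lemma gap_neg_left (x y : ℝ) : gap T g (-x) y = gap T g x y := by
  simp only [gap, normTheta_neg_left]

lemma gap_add_pi (x y : ℝ) : gap T g (x + π) y = gap T g x y := by
  simp only [gap, normTheta_add_pi]

lemma gap_add (hT : 0 < T) (x y : ℝ) : gap T g x (y + T) = gap T g x y := by
  simp only [gap, add_right_comm y T, add_sub_right_comm y T, normTheta_add hT]

lemma gap_reflect (x y : ℝ) : gap T g x (-g - y) = gap T g x y := by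
  simp only [gap]
  rw [← normTheta_neg T x (-g - y), ← normTheta_neg T x (-g - y + g),
    ← normTheta_neg T x (-g - y - g), ← normTheta_neg T x (-g - y + 2 * g)]
  ring_nf

lemma continuous_gap (hT : 0 < T) {f h : ℝ → ℝ} (hf : Continuous f) (hh : Continuous h) :
    Continuous fun q => gap T g (f q) (h q) := by
  have hcont (k : ℝ → ℝ) (hk : Continuous k) : Continuous fun q => normTheta T (f q) (k q) :=
    continuous_iff_continuousAt.2 fun q =>
      continuousAt_normTheta continuousAt_const hf.continuousAt hk.continuousAt hT
  exact (continuous_const.mul ((hcont h hh).mul (hcont _ (hh.add_const g)))).sub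
    ((hcont _ (hh.sub continuous_const)).mul (hcont _ (hh.add_const (2 * g))))

namespace IsRealParameter

lemma norm_numerX_sub_norm_denomX (h : IsRealParameter a T g c) (x y : ℝ) :
    ‖numerX c (I * g) (rectTau T) (x + I * y)‖ - ‖denomX (I * g) (rectTau T) (x + I * y)‖ =
      rexp ((y - g) ^ 2 / T) * rexp ((y + 2 * g) ^ 2 / T) * gap T g x y := by
  rw [numerX, denomX, thetaPair, thetaPair, add_zero,
    show x + I * y + I * g = x + I * (y + g : ℝ) by push_cast; ring,
    show x + I * y + -(I * g) = x + I * (y - g : ℝ) by push_cast; ring,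
    show x + I * y + 2 * (I * g) = x + I * (y + 2 * g : ℝ) by push_cast; ring,
    norm_mul, norm_mul, norm_mul, norm_theta_eq_normTheta_mul, norm_theta_eq_normTheta_mul,
    norm_theta_eq_normTheta_mul, norm_theta_eq_normTheta_mul, Complex.norm_real,
    Real.norm_of_nonneg h.c_pos.le, gap]
  have hexp : rexp (4 * g ^ 2 / T) * (rexp (y ^ 2 / T) * rexp ((y + g) ^ 2 / T)) =
      rexp ((y - g) ^ 2 / T) * rexp ((y + 2 * g) ^ 2 / T) := by
    simp only [← Real.exp_add]
    ring_nf
  rw [h.c_eq]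
  linear_combination (normCoeff T g * (normTheta T x y * normTheta T x (y + g))) * hexp

lemma norm_numerX_lt_iff (h : IsRealParameter a T g c) (x y : ℝ) :
    ‖numerX c (I * g) (rectTau T) (x + I * y)‖ < ‖denomX (I * g) (rectTau T) (x + I * y)‖ ↔
      gap T g x y < 0 := by
  rw [← sub_neg, h.norm_numerX_sub_norm_denomX, ← neg_pos, ← mul_neg,
    mul_pos_iff_of_pos_left (by positivity), neg_pos]

lemma norm_numerX_eq_iff (h : IsRealParameter a T g c) (x y : ℝ) :
    ‖numerX c (I * g) (rectTau T) (x + I * y)‖ = ‖denomX (I * g) (rectTau T) (x + I * y)‖ ↔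
      gap T g x y = 0 := by
  rw [← sub_eq_zero, h.norm_numerX_sub_norm_denomX, mul_eq_zero]
  exact or_iff_right (by positivity)

lemma norm_denomX_lt_iff (h : IsRealParameter a T g c) (x y : ℝ) :
    ‖denomX (I * g) (rectTau T) (x + I * y)‖ < ‖numerX c (I * g) (rectTau T) (x + I * y)‖ ↔
      0 < gap T g x y := by
  rw [← sub_pos, h.norm_numerX_sub_norm_denomX, mul_pos_iff_of_pos_left (by positivity)]

lemma gap_strictMonoOn (h : IsRealParameter a T g c) (x : ℝ) :
    StrictMonoOn (gap T g x) (Set.Icc 0 (T / 2 - g)) := by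
  intro y hy y' hy' hlt
  have hT := h.T_pos
  have := h.lt_g
  have := h.g_lt
  obtain ⟨hy0, -⟩ := hy
  obtain ⟨-, hy1⟩ := hy'
  have hθ₁ : normTheta T x y < normTheta T x y' := normTheta_lt hT x hy0 hlt (by linarith)
  have hθ₂ : normTheta T x (y + g) < normTheta T x (y' + g) :=
    normTheta_lt hT x (by linarith) (by linarith) (by linarith)
  have hθ₃ : normTheta T x (y' - g) < normTheta T x (y - g) := by
    rw [← normTheta_neg T x (y - g), ← normTheta_neg T x (y' - g)]
    exact normTheta_lt hT x (by linarith) (by linarith) (by linarith)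
  have hθ₄ : normTheta T x (y' + 2 * g) < normTheta T x (y + 2 * g) :=
    normTheta_lt_of_half_le hT x (by linarith) (by linarith) (by linarith)
  have hnonneg := normTheta_nonneg T x
  exact sub_lt_sub
    (mul_lt_mul_of_pos_left (mul_lt_mul'' hθ₁ hθ₂ (hnonneg _) (hnonneg _)) h.normCoeff_pos)
    (mul_lt_mul'' hθ₃ hθ₄ (hnonneg _) (hnonneg _))

end IsRealParameter

end Gap

section LevelCurve

variable {a T g c E : ℝ}

lemma numerX_neg_conj (T g c : ℝ) (z : ℂ) : numerX c (I * g) (rectTau T) (-conj z) =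
    conj (numerX c (I * g) (rectTau T) z) := by
  simp only [numerX, thetaPair, map_mul, Complex.conj_ofReal, ← theta_conj_rectTau]
  simp [add_comm]

lemma denomX_neg_conj (T g : ℝ) (z : ℂ) : denomX (I * g) (rectTau T) (-conj z) =
    conj (denomX (I * g) (rectTau T) z) := by
  simp only [denomX, thetaPair, map_mul, ← theta_conj_rectTau]
  simp [add_comm, map_ofNat]

namespace IsRealParameter

lemma denomX_ne_zero_of_im_mem_Icc (h : IsRealParameter a T g c) {z : ℂ}
    (hz : z.im ∈ Set.Icc (-g) 0) : denomX (I * g) (rectTau T) z ≠ 0 := by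
  have := h.g_lt
  have := h.g_pos
  obtain ⟨h₀, h₁⟩ := hz
  refine mul_ne_zero ?_ (theta_ne_zero_of_im_mem_Ioo h.T_pos ⟨?_, ?_⟩)
  · rw [← neg_neg (z + -(I * g)), theta_neg, neg_ne_zero]
    refine theta_ne_zero_of_im_mem_Ioo h.T_pos ⟨?_, ?_⟩ <;> simp <;> linarith
  all_goals simp; linarith

lemma numerX_ne_zero_of_im_mem_Icc (h : IsRealParameter a T g c) {z : ℂ}
    (hz : z.im ∈ Set.Icc (T / 2 - g) (T / 2)) : numerX c (I * g) (rectTau T) z ≠ 0 := by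
  have := h.g_lt
  have := h.lt_g
  have := h.T_pos
  obtain ⟨h₀, h₁⟩ := hz
  refine mul_ne_zero (Complex.ofReal_ne_zero.2 h.c_pos.ne') (mul_ne_zero
    (theta_ne_zero_of_im_mem_Ioo h.T_pos ⟨?_, ?_⟩) (theta_ne_zero_of_im_mem_Ioo h.T_pos ⟨?_, ?_⟩))
  all_goals simp; linarith

lemma denomX_ne_zero_of_im_eq_half (h : IsRealParameter a T g c) {z : ℂ} (hz : z.im = T / 2) :
    denomX (I * g) (rectTau T) z ≠ 0 := by
  have := h.g_lt
  have := h.lt_g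
  have := h.T_pos
  refine mul_ne_zero (theta_ne_zero_of_im_mem_Ioo h.T_pos ⟨?_, ?_⟩) ?_
  · simp; linarith
  · simp; linarith
  · rw [← sub_add_cancel (z + 2 * (I * g)) (I * T), theta_add_I_mul h.T_pos]
    refine mul_ne_zero (neg_ne_zero.2 (Complex.exp_ne_zero _))
      (theta_ne_zero_of_im_mem_Ioo h.T_pos ⟨?_, ?_⟩)
    all_goals simp; linarith

-- Here `X z = x` and `Y z = conj x`, so the kernel equation becomes
-- `E |x|² = 2 Re x (|x|² + 1) + a |x|⁴`, and `Re x ≤ |x|`.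
lemma le_diagonalStep_norm (h : IsRealParameter a T g c)
    (hE : thetaRatio (I * g) (rectTau T) = (c * E : ℝ)) {z x : ℂ} (hx₀ : x ≠ 0)
    (hd : denomX (I * g) (rectTau T) z ≠ 0)
    (hx : numerX c (I * g) (rectTau T) z = x * denomX (I * g) (rectTau T) z)
    (hconj : numerX c (I * g) (rectTau T) (-z) = conj x * denomX (I * g) (rectTau T) (-z)) :
    E ≤ diagonalStep a ‖x‖ := by
  have hr : 0 < ‖x‖ := norm_pos_iff.2 hx₀
  have hc : (c : ℂ) ≠ 0 := Complex.ofReal_ne_zero.2 h.c_pos.ne'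
  have hfactor := h.kernel_factor z (conj x) 1
  rw [hconj, one_mul, sub_self, zero_mul, neg_zero, hE, hx] at hfactor
  have hprod : x * conj x = ((‖x‖ ^ 2 : ℝ) : ℂ) := by
    rw [Complex.mul_conj, Complex.normSq_eq_norm_sq]
  have hsum : x + conj x = ((2 * x.re : ℝ) : ℂ) := Complex.add_conj x
  have hkernel : E * ‖x‖ ^ 2 = 2 * x.re * (‖x‖ ^ 2 + 1) + a * (‖x‖ ^ 2) ^ 2 := by
    rw [← Complex.ofReal_inj]
    push_cast at hprod hsum hfactor ⊢
    rw [← hsum, ← hprod]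
    refine mul_left_cancel₀ (mul_ne_zero hc (pow_ne_zero 2 hd)) ?_
    linear_combination hfactor
  have hstep : diagonalStep a ‖x‖ * ‖x‖ ^ 2 =
      2 * ‖x‖ * (‖x‖ ^ 2 + 1) + a * (‖x‖ ^ 2) ^ 2 := by
    rw [diagonalStep]
    field_simp
  refine le_of_mul_le_mul_right ?_ (sq_pos_of_pos hr)
  rw [hkernel, hstep]
  have := Complex.re_le_norm x
  gcongr

lemma le_diagonalStep_norm_of_real (h : IsRealParameter a T g c)
    (hE : thetaRatio (I * g) (rectTau T) = (c * E : ℝ)) (x : ℝ)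
    (hx : numerX c (I * g) (rectTau T) x / denomX (I * g) (rectTau T) x ≠ 0) :
    E ≤ diagonalStep a ‖numerX c (I * g) (rectTau T) x / denomX (I * g) (rectTau T) x‖ := by
  have hd := (div_ne_zero_iff.1 hx).2
  have hneg : (-x : ℂ) = -conj (x : ℂ) := by rw [Complex.conj_ofReal]
  refine h.le_diagonalStep_norm hE hx hd (div_mul_cancel₀ _ hd).symm ?_
  rw [hneg, numerX_neg_conj, denomX_neg_conj, ← map_mul, div_mul_cancel₀ _ hd]

lemma le_diagonalStep_norm_of_half (h : IsRealParameter a T g c)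
    (hE : thetaRatio (I * g) (rectTau T) = (c * E : ℝ)) {z : ℂ} (hz : z.im = T / 2)
    (hx : numerX c (I * g) (rectTau T) z / denomX (I * g) (rectTau T) z ≠ 0) :
    E ≤ diagonalStep a ‖numerX c (I * g) (rectTau T) z / denomX (I * g) (rectTau T) z‖ := by
  have hd := (div_ne_zero_iff.1 hx).2
  have hneg : -conj z = -z + π * rectTau T := by
    apply Complex.ext <;> simp [hz]
    ring
  refine h.le_diagonalStep_norm hE hx hd (div_mul_cancel₀ _ hd).symm ?_
  have hn := numerX_neg_conj T g c z
  have hd' := denomX_neg_conj T g z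
  rw [hneg, numerX_add_pi_mul (rectTau_im_pos h.T_pos)] at hn
  rw [hneg, denomX_add_pi_mul (rectTau_im_pos h.T_pos)] at hd'
  refine mul_left_cancel₀ (Complex.exp_ne_zero _) (hn.trans ?_)
  rw [mul_left_comm, hd', ← map_mul, div_mul_cancel₀ _ hd]

lemma continuous_norm_numerX_div_denomX (h : IsRealParameter a T g c) {w : ℝ → ℂ}
    (hw : Continuous w) (hd : ∀ x, denomX (I * g) (rectTau T) (w x) ≠ 0) :
    Continuous fun x => ‖numerX c (I * g) (rectTau T) (w x) / denomX (I * g) (rectTau T) (w x)‖ :=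
  have hτ := rectTau_im_pos h.T_pos
  (((differentiable_numerX hτ c (I * g)).continuous.comp hw).div
    ((differentiable_denomX hτ (I * g)).continuous.comp hw) hd).norm

lemma norm_numerX_div_denomX_lt (h : IsRealParameter a T g c)
    (hE : thetaRatio (I * g) (rectTau T) = (c * E : ℝ)) {r : ℝ} (hr : 0 < r)
    (hrE : diagonalStep a r < E) (x : ℝ) :
    ‖numerX c (I * g) (rectTau T) x / denomX (I * g) (rectTau T) x‖ < r := by
  by_contra! hcon
  have hd (x : ℝ) : denomX (I * g) (rectTau T) x ≠ 0 :=
    h.denomX_ne_zero_of_im_mem_Icc (by simpa using h.g_pos.le)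
  have h₀ : ‖numerX c (I * g) (rectTau T) (0 : ℝ) / denomX (I * g) (rectTau T) (0 : ℝ)‖ ≤ r := by
    simpa [numerX_zero] using hr.le
  obtain ⟨y, hy⟩ := mem_range_of_exists_le_of_exists_ge
    (h.continuous_norm_numerX_div_denomX Complex.continuous_ofReal hd) ⟨0, h₀⟩ ⟨x, hcon⟩
  refine hrE.not_ge ?_
  simpa only [hy] using h.le_diagonalStep_norm_of_real hE y (norm_pos_iff.1 (hr.trans_eq hy.symm))

lemma lt_norm_numerX_div_denomX (h : IsRealParameter a T g c)
    (hE : thetaRatio (I * g) (rectTau T) = (c * E : ℝ)) {r : ℝ} (hr : 0 < r)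
    (hrE : diagonalStep a r < E) {z : ℂ} (hz : z.im = T / 2) :
    r < ‖numerX c (I * g) (rectTau T) z / denomX (I * g) (rectTau T) z‖ := by
  by_contra! hcon
  let w (x : ℝ) : ℂ := x + I * (T / 2 : ℝ)
  have hd (x : ℝ) : denomX (I * g) (rectTau T) (w x) ≠ 0 :=
    h.denomX_ne_zero_of_im_eq_half (by simp [w])
  have hzw : z = w z.re := Complex.ext (by simp [w]) (by simp [w, hz])
  have h₀ : r ≤ ‖numerX c (I * g) (rectTau T) (w (π / 2)) /
      denomX (I * g) (rectTau T) (w (π / 2))‖ := by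
    have hne := hd (π / 2)
    have hdiag : diagonalStep a (normX T g (π / 2) 0) = E := by
      rw [h.thetaRatio_eq_normX_zero, Complex.ofReal_inj] at hE
      exact mul_left_cancel₀ h.c_pos.ne' hE
    simp only [w] at hne ⊢
    push_cast at hne ⊢
    have hvalue := h.numerX_pi_div_two (T / 2)
    push_cast at hvalue
    rw [hvalue, mul_div_cancel_right₀ _ hne, Complex.norm_real,
      Real.norm_of_nonneg (h.normX_pi_div_two_pos _).le]
    exact (mem_Ioo_of_diagonalStep_lt h.a_pos (h.normX_pi_div_two_pos _)
      h.normX_zero_lt_normX_half hr h.diagonalStep_normX_half_eq.symm (by rwa [hdiag])).2.le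
  obtain ⟨y, hy⟩ := mem_range_of_exists_le_of_exists_ge
    (h.continuous_norm_numerX_div_denomX (w := w) (by fun_prop) hd) ⟨_, hzw ▸ hcon⟩ ⟨_, h₀⟩
  refine hrE.not_ge ?_
  simpa only [hy] using
    h.le_diagonalStep_norm_of_half hE (by simp [w]) (norm_pos_iff.1 (hr.trans_eq hy.symm))

end IsRealParameter

end LevelCurve

section LevelGraph

variable {a T g c E : ℝ}

namespace IsRealParameter

lemma norm_numerX_lt_of_im_mem_Icc (h : IsRealParameter a T g c)
    (hE : thetaRatio (I * g) (rectTau T) = (c * E : ℝ)) (haE : a + 4 < E) {z : ℂ}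
    (hz : z.im ∈ Set.Icc (-g) 0) :
    ‖numerX c (I * g) (rectTau T) z‖ < ‖denomX (I * g) (rectTau T) z‖ := by
  obtain ⟨δ, hδ, hδ1, hδE, -⟩ := exists_diagonalStep_lt haE
  have hτ := rectTau_im_pos h.T_pos
  have hreal (w : ℂ) (hw : w.im = 0) :
      ‖numerX c (I * g) (rectTau T) w / denomX (I * g) (rectTau T) w‖ ≤ 1 - δ := by
    have hw' : w = (w.re : ℂ) := Complex.ext (by simp) (by simp [hw])
    rw [hw']
    exact (h.norm_numerX_div_denomX_lt hE (sub_pos.2 hδ1) hδE w.re).le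
  have hstrip := norm_le_of_periodic_strip
    (f := fun w => numerX c (I * g) (rectTau T) w / denomX (I * g) (rectTau T) w)
    (neg_lt_zero.2 h.g_pos)
    (fun w hw hw' => (differentiable_numerX hτ c (I * g) w).div
      (differentiable_denomX hτ (I * g) w) (h.denomX_ne_zero_of_im_mem_Icc ⟨hw, hw'⟩))
    (fun w => by simp only [numerX_add_pi, denomX_add_pi])
    (fun w hw => by
      rw [← numerX_reflect, ← denomX_reflect]
      exact hreal _ (by simp [hw]))
    hreal hz.1 hz.2
  have hd := norm_pos_iff.2 (h.denomX_ne_zero_of_im_mem_Icc hz)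
  rw [norm_div, div_le_iff₀ hd] at hstrip
  exact hstrip.trans_lt (mul_lt_of_lt_one_left hd (sub_lt_self 1 hδ))

lemma norm_denomX_lt_of_im_mem_Icc (h : IsRealParameter a T g c)
    (hE : thetaRatio (I * g) (rectTau T) = (c * E : ℝ)) (haE : a + 4 < E) {z : ℂ}
    (hz : z.im ∈ Set.Icc (T / 2 - g) (T / 2)) :
    ‖denomX (I * g) (rectTau T) z‖ < ‖numerX c (I * g) (rectTau T) z‖ := by
  obtain ⟨δ, hδ, -, -, hδE⟩ := exists_diagonalStep_lt haE
  have hδ' : 1 < 1 + δ := lt_add_of_pos_right 1 hδ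
  have hτ := rectTau_im_pos h.T_pos
  have hline (w : ℂ) (hw : w.im = T / 2) :
      ‖denomX (I * g) (rectTau T) w / numerX c (I * g) (rectTau T) w‖ ≤ (1 + δ)⁻¹ := by
    rw [← inv_div, norm_inv]
    exact inv_anti₀ (by linarith) (h.lt_norm_numerX_div_denomX hE (by linarith) hδE hw).le
  have hstrip := norm_le_of_periodic_strip
    (f := fun w => denomX (I * g) (rectTau T) w / numerX c (I * g) (rectTau T) w)
    (sub_lt_self _ h.g_pos)
    (fun w hw hw' => (differentiable_denomX hτ (I * g) w).div
      (differentiable_numerX hτ c (I * g) w) (h.numerX_ne_zero_of_im_mem_Icc ⟨hw, hw'⟩))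
    (fun w => by simp only [numerX_add_pi, denomX_add_pi])
    (fun w hw => by
      rw [← numerX_reflect, ← denomX_reflect, ← mul_div_mul_left _ _ (Complex.exp_ne_zero _),
        ← denomX_add_pi_mul hτ, ← numerX_add_pi_mul hτ]
      exact hline _ (by simp [hw]; ring))
    hline hz.1 hz.2
  have hn := norm_pos_iff.2 (h.numerX_ne_zero_of_im_mem_Icc hz)
  rw [norm_div, div_le_iff₀ hn] at hstrip
  exact hstrip.trans_lt (mul_lt_of_lt_one_left hn (inv_lt_one_of_one_lt₀ hδ'))

lemma gap_neg_of_mem_Icc (h : IsRealParameter a T g c)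
    (hE : thetaRatio (I * g) (rectTau T) = (c * E : ℝ)) (haE : a + 4 < E) (x : ℝ) {y : ℝ}
    (hy : y ∈ Set.Icc (-g) 0) : gap T g x y < 0 :=
  (h.norm_numerX_lt_iff x y).1 (h.norm_numerX_lt_of_im_mem_Icc hE haE (by simpa using hy))

lemma gap_pos_of_mem_Icc (h : IsRealParameter a T g c)
    (hE : thetaRatio (I * g) (rectTau T) = (c * E : ℝ)) (haE : a + 4 < E) (x : ℝ) {y : ℝ}
    (hy : y ∈ Set.Icc (T / 2 - g) (T / 2)) : 0 < gap T g x y :=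
  (h.norm_denomX_lt_iff x y).1 (h.norm_denomX_lt_of_im_mem_Icc hE haE (by simpa using hy))

lemma gap_neg_of_lt (h : IsRealParameter a T g c)
    (hE : thetaRatio (I * g) (rectTau T) = (c * E : ℝ)) (haE : a + 4 < E) {x y e : ℝ}
    (he : e ∈ Set.Icc 0 (T / 2 - g)) (hgap : gap T g x e = 0) (h₀ : -g - e < y) (h₁ : y < e) :
    gap T g x y < 0 := by
  wlog hy : -g / 2 ≤ y generalizing y
  · rw [← gap_reflect]
    exact this (by linarith) (by linarith) (by linarith)
  have := h.g_pos
  rcases le_total y 0 with hy0 | hy0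
  · exact h.gap_neg_of_mem_Icc hE haE x ⟨by linarith, hy0⟩
  · exact hgap ▸ h.gap_strictMonoOn x ⟨hy0, h₁.le.trans he.2⟩ he h₁

lemma gap_pos_of_lt (h : IsRealParameter a T g c)
    (hE : thetaRatio (I * g) (rectTau T) = (c * E : ℝ)) (haE : a + 4 < E) {x y e : ℝ}
    (he : e ∈ Set.Icc 0 (T / 2 - g)) (hgap : gap T g x e = 0) (h₀ : e < y)
    (h₁ : y < T - g - e) : 0 < gap T g x y := by
  wlog hy : y ≤ (T - g) / 2 generalizing y
  · rw [← gap_reflect, ← gap_add h.T_pos]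
    exact this (by linarith) (by linarith) (by linarith)
  have := h.g_pos
  rcases le_total (T / 2 - g) y with hy' | hy'
  · exact h.gap_pos_of_mem_Icc hE haE x ⟨hy', by linarith⟩
  · exact hgap.symm.trans_lt (h.gap_strictMonoOn x he ⟨he.1.trans h₀.le, hy'⟩ h₀)

end IsRealParameter

/-- The component of `|X| = 1` just above the real axis is the graph of `η`. By the symmetry
`gap_reflect` and the period `T`, the graphs of `η` and `-g - η` bound the bands on which
`|X| < 1` and `|X| > 1`. -/
structure IsLevelGraph (T g : ℝ) (η : ℝ → ℝ) : Prop where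
  g_pos : 0 < g
  continuous : Continuous η
  pos : ∀ x, 0 < η x
  lt : ∀ x, η x < T / 2 - g
  neg : ∀ x, η (-x) = η x
  add_pi : ∀ x, η (x + π) = η x
  gap_eq_zero : ∀ x, gap T g x (η x) = 0
  gap_neg : ∀ x y, -g - η x < y → y < η x → gap T g x y < 0
  gap_pos : ∀ x y, η x < y → y < T - g - η x → 0 < gap T g x y

lemma IsRealParameter.exists_isLevelGraph (h : IsRealParameter a T g c)
    (hE : thetaRatio (I * g) (rectTau T) = (c * E : ℝ)) (haE : a + 4 < E) :
    ∃ η, IsLevelGraph T g η := by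
  have hT := h.T_pos
  have hlt : 0 < T / 2 - g := by linarith [h.g_lt]
  obtain ⟨η, hη, hη'⟩ := exists_continuous_zero (gap T g) hlt
    (fun y => continuous_gap hT continuous_id continuous_const)
    (fun x => continuous_gap hT continuous_const continuous_id)
    (fun x => h.gap_neg_of_mem_Icc hE haE x ⟨neg_nonpos.2 h.g_pos.le, le_rfl⟩)
    (fun x => h.gap_pos_of_mem_Icc hE haE x ⟨le_rfl, sub_le_self _ h.g_pos.le⟩)
    h.gap_strictMonoOn
  have hmem (x : ℝ) : η x ∈ Set.Icc 0 (T / 2 - g) := Set.Ioo_subset_Icc_self (hη' x).1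
  have hunique (x x' : ℝ) (hgap : ∀ y, gap T g x y = gap T g x' y) : η x = η x' :=
    (h.gap_strictMonoOn x).injOn (hmem x) (hmem x') (by rw [(hη' x).2, hgap, (hη' x').2])
  exact ⟨η,
    { g_pos := h.g_pos
      continuous := hη
      pos := fun x => (hη' x).1.1
      lt := fun x => (hη' x).1.2
      neg := fun x => hunique _ _ (gap_neg_left x)
      add_pi := fun x => hunique _ _ (gap_add_pi x)
      gap_eq_zero := fun x => (hη' x).2
      gap_neg := fun x _ => h.gap_neg_of_lt hE haE (hmem x) (hη' x).2
      gap_pos := fun x _ => h.gap_pos_of_lt hE haE (hmem x) (hη' x).2 }⟩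

end LevelGraph

section GraphHomeomorph

variable {p q : ℝ → ℝ}

/-- The homeomorphism straightening the region between the graphs of `p` and `q` to the strip
`0 ≤ u ≤ 1`. -/
def straighten (hp : Continuous p) (hq : Continuous q) (hpq : ∀ x, q x - p x ≠ 0) : ℂ ≃ₜ ℝ × ℝ where
  toFun z := (z.re, (z.im - p z.re) / (q z.re - p z.re))
  invFun w := ⟨w.1, p w.1 + w.2 * (q w.1 - p w.1)⟩
  left_inv z := Complex.ext rfl (by simp only [div_mul_cancel₀ _ (hpq _), add_sub_cancel])
  right_inv w := Prod.ext rfl (by simp only [add_sub_cancel_left, mul_div_cancel_right₀ _ (hpq _)])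
  continuous_toFun :=
    Complex.continuous_re.prodMk (Continuous.div (by fun_prop) (by fun_prop) fun _ => hpq _)
  continuous_invFun := by
    refine (show Continuous fun w : ℝ × ℝ =>
      (w.1 : ℂ) + ((p w.1 + w.2 * (q w.1 - p w.1) : ℝ) : ℂ) * I by fun_prop).congr fun w => ?_
    exact (Complex.mk_eq_add_mul_I _ _).symm

lemma simplyConnectedSpace_of_straighten (hp : Continuous p) (hq : Continuous q)
    (hpq : ∀ x, q x - p x ≠ 0) {J : Set ℝ} (hJ : Convex ℝ J) (hne : J.Nonempty) {S : Set ℂ}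
    (hS : ∀ z, z ∈ S ↔ (z.im - p z.re) / (q z.re - p z.re) ∈ J) : SimplyConnectedSpace S := by
  have hpre : S = straighten hp hq hpq ⁻¹' (Set.univ ×ˢ J) := by
    ext z
    simp [hS, straighten]
  have : ContractibleSpace (Set.univ ×ˢ J : Set (ℝ × ℝ)) :=
    (convex_univ.prod hJ).contractibleSpace (Set.univ_nonempty.prod hne)
  have : ContractibleSpace S := ((straighten hp hq hpq).sets hpre).contractibleSpace
  infer_instance

end GraphHomeomorph

section EdgeStack

variable {b : ℤ → ℝ → ℝ} {P : Set ℤ} {r s : ℤ} {z w : ℂ}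

/-- A sequence of pairwise disjoint graphs in `ℂ`, ordered by height and exhausting the plane in
both vertical directions. -/
structure IsEdgeStack (b : ℤ → ℝ → ℝ) : Prop where
  continuous : ∀ s, Continuous (b s)
  strictMono : ∀ x, StrictMono fun s => b s x
  exists_lt : ∀ x y, ∃ s, b s x < y
  exists_gt : ∀ x y, ∃ s, y < b s x

/-- The region above the graph of `b s`, including the graph itself unless `s ∈ P`. -/
def aboveEdge (b : ℤ → ℝ → ℝ) (P : Set ℤ) (s : ℤ) : Set ℂ :=
  {z | b s z.re < z.im ∨ s ∉ P ∧ b s z.re = z.im}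

/-- The band between the consecutive graphs of `b s` and `b (s + 1)`. The set `P` decides to which
of its two neighbouring bands each graph belongs. -/
def stackBand (b : ℤ → ℝ → ℝ) (P : Set ℤ) (s : ℤ) : Set ℂ :=
  aboveEdge b P s \ aboveEdge b P (s + 1)

lemma mem_aboveEdge_of_mem (hs : s ∈ P) : z ∈ aboveEdge b P s ↔ b s z.re < z.im := by
  simp [aboveEdge, hs]

lemma mem_aboveEdge_of_notMem (hs : s ∉ P) : z ∈ aboveEdge b P s ↔ b s z.re ≤ z.im := by
  simp [aboveEdge, hs, le_iff_lt_or_eq]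

lemma mem_aboveEdge_of_lt (h : b s z.re < z.im) : z ∈ aboveEdge b P s := Or.inl h

lemma le_im_of_mem_aboveEdge (hz : z ∈ aboveEdge b P s) : b s z.re ≤ z.im :=
  hz.elim le_of_lt fun h => h.2.le

lemma sub_mem_aboveEdge_iff (hb : b r (w - z).re + b s z.re = w.im) (hP : r ∈ P ↔ s ∉ P) :
    w - z ∈ aboveEdge b P r ↔ z ∉ aboveEdge b P s := by
  by_cases hs : s ∈ P
  · rw [mem_aboveEdge_of_notMem (mt hP.1 (not_not.2 hs)), mem_aboveEdge_of_mem hs, not_lt,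
      Complex.sub_im, le_sub_iff_add_le, ← hb, add_le_add_iff_left]
  · rw [mem_aboveEdge_of_mem (hP.2 hs), mem_aboveEdge_of_notMem hs, not_le,
      Complex.sub_im, lt_sub_iff_add_lt, ← hb, add_lt_add_iff_left]

lemma image_add_stackBand {p : ℝ} (hper : ∀ s x, b s (x + p) = b s x) (s : ℤ) :
    (fun z : ℂ => (p : ℂ) + z) '' stackBand b P s = stackBand b P s := by
  have hpre : (fun z : ℂ => (p : ℂ) + z) ⁻¹' stackBand b P s = stackBand b P s := by
    ext z
    simp [stackBand, aboveEdge, add_comm p, hper]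
  rw [← hpre, Set.image_preimage_eq _ (add_left_surjective _), hpre]

lemma image_sub_aboveEdge_sdiff {y : ℝ} (hsum : ∀ x, b r (-x) + b s x = y) (hP : r ∈ P ↔ s ∉ P) :
    (fun z : ℂ => y * I - z) '' (aboveEdge b P r \ aboveEdge b P s) =
      aboveEdge b P r \ aboveEdge b P s := by
  rw [Set.image_eq_preimage_of_inverse (sub_sub_cancel _) (sub_sub_cancel _)]
  ext z
  have hr : y * I - z ∈ aboveEdge b P r ↔ z ∉ aboveEdge b P s :=
    sub_mem_aboveEdge_iff (by simpa using hsum z.re) hP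
  have hs : y * I - z ∈ aboveEdge b P s ↔ z ∉ aboveEdge b P r :=
    sub_mem_aboveEdge_iff (by simpa [add_comm] using hsum (-z.re)) (by tauto)
  rw [Set.mem_preimage, Set.mem_sdiff, Set.mem_sdiff, hr, hs, not_not, and_comm]

namespace IsEdgeStack

lemma antitone_aboveEdge (hb : IsEdgeStack b) : Antitone (aboveEdge b P) := by
  intro r s hrs z hz
  rcases hrs.eq_or_lt with rfl | hlt
  · exact hz
  · exact mem_aboveEdge_of_lt ((hb.strictMono z.re hlt).trans_le (le_im_of_mem_aboveEdge hz))

lemma pairwise_disjoint_stackBand (hb : IsEdgeStack b) :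
    Pairwise fun r s => Disjoint (stackBand b P r) (stackBand b P s) := by
  refine (pairwise_disjoint_on _).2 fun r s hrs => Set.disjoint_left.2 fun z hr hs => ?_
  exact hr.2 (hb.antitone_aboveEdge (Int.add_one_le_of_lt hrs) hs.1)

lemma iUnion_stackBand (hb : IsEdgeStack b) : ⋃ s, stackBand b P s = Set.univ := by
  refine Set.eq_univ_of_forall fun z => Set.mem_iUnion.2 ?_
  obtain ⟨r, hr⟩ := hb.exists_lt z.re z.im
  obtain ⟨m, hm⟩ := hb.exists_gt z.re z.im
  have hbound (s : ℤ) (hs : z ∈ aboveEdge b P s) : s ≤ m := by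
    by_contra! hlt
    exact (le_im_of_mem_aboveEdge (hb.antitone_aboveEdge hlt.le hs)).not_gt hm
  obtain ⟨s, hs, hmax⟩ := Int.exists_greatest_of_bdd ⟨m, hbound⟩ ⟨r, mem_aboveEdge_of_lt hr⟩
  exact ⟨s, hs, fun h => (hmax _ h).not_gt (lt_add_one s)⟩

lemma stackBand_union_stackBand (hb : IsEdgeStack b) (s : ℤ) :
    stackBand b P s ∪ stackBand b P (s + 1) = aboveEdge b P s \ aboveEdge b P (s + 2) := by
  have h₁ : aboveEdge b P (s + 1) ⊆ aboveEdge b P s := hb.antitone_aboveEdge (by omega)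
  have h₂ : aboveEdge b P (s + 2) ⊆ aboveEdge b P (s + 1) := hb.antitone_aboveEdge (by omega)
  rw [stackBand, stackBand, add_assoc, one_add_one_eq_two, Set.sdiff_union_sdiff_cancel h₁ h₂]

lemma range_midline_subset (hb : IsEdgeStack b) {y : ℝ} (hrs : r < s)
    (hsum : ∀ x, b r x + b s x = y) :
    Set.range (fun x : ℝ => y * I / 2 + x) ⊆ aboveEdge b P r \ aboveEdge b P s := by
  rintro _ ⟨x, rfl⟩
  have hre : (y * I / 2 + x : ℂ).re = x := by simp
  have him : (y * I / 2 + x : ℂ).im = y / 2 := by simp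
  have hlt := hb.strictMono x hrs
  have hx := hsum x
  refine ⟨mem_aboveEdge_of_lt ?_, fun h => ?_⟩
  · rw [hre, him]
    linarith
  · have := le_im_of_mem_aboveEdge h
    rw [hre, him] at this
    linarith

lemma simplyConnectedSpace_stackBand (hb : IsEdgeStack b) (s : ℤ) :
    SimplyConnectedSpace (stackBand b P s) := by
  have hlt (x : ℝ) : 0 < b (s + 1) x - b s x := sub_pos.2 (hb.strictMono x (lt_add_one s))
  refine simplyConnectedSpace_of_straighten (hb.continuous s) (hb.continuous (s + 1))
    (fun x => (hlt x).ne')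
    (J := {u | (0 < u ∨ s ∉ P ∧ u = 0) ∧ ¬ (1 < u ∨ s + 1 ∉ P ∧ u = 1)}) ?_ ⟨1 / 2, ?_⟩ fun z => ?_
  · refine Set.OrdConnected.convex (Set.ordConnected_of_Ioo fun u hu v hv _ y hy => ?_)
    simp only [Set.mem_ofPred_eq] at hu hv ⊢
    grind
  · norm_num
  · simp only [stackBand, aboveEdge, Set.mem_sdiff, Set.mem_ofPred_eq,
      div_pos_iff_of_pos_right (hlt z.re), div_eq_zero_iff, (hlt z.re).ne', or_false,
      one_lt_div (hlt z.re), div_eq_one_iff_eq (hlt z.re).ne', sub_pos, sub_eq_zero,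
      sub_lt_sub_iff_right, sub_left_inj, eq_comm]

lemma closure_stackBand (hb : IsEdgeStack b) (s : ℤ) :
    closure (stackBand b P s) = {z | b s z.re ≤ z.im ∧ z.im ≤ b (s + 1) z.re} := by
  refine Set.Subset.antisymm (closure_minimal (fun z hz => ?_) ?_) fun z hz => ?_
  · exact ⟨le_im_of_mem_aboveEdge hz.1, not_lt.1 fun h => hz.2 (mem_aboveEdge_of_lt h)⟩
  · exact (isClosed_le ((hb.continuous s).comp Complex.continuous_re)
      Complex.continuous_im).inter (isClosed_le Complex.continuous_im
        ((hb.continuous (s + 1)).comp Complex.continuous_re))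
  · have hvertical : Continuous fun y : ℝ => (z.re + y * I : ℂ) := by fun_prop
    have hsubset : (fun y : ℝ => (z.re + y * I : ℂ)) '' Set.Ioo (b s z.re) (b (s + 1) z.re) ⊆
        stackBand b P s := by
      rintro _ ⟨y, ⟨hy, hy'⟩, rfl⟩
      exact ⟨mem_aboveEdge_of_lt (by simpa using hy),
        fun h => hy'.not_ge (by simpa using le_im_of_mem_aboveEdge h)⟩
    refine closure_mono hsubset (image_closure_subset_closure_image hvertical
      ⟨z.im, ?_, Complex.re_add_im z⟩)
    rwa [closure_Ioo (hb.strictMono z.re (lt_add_one s)).ne]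

lemma disjoint_closure_stackBand (hb : IsEdgeStack b) (hrs : r + 1 < s) :
    Disjoint (closure (stackBand b P r)) (closure (stackBand b P s)) := by
  rw [hb.closure_stackBand, hb.closure_stackBand]
  exact Set.disjoint_left.2 fun z hr hs =>
    ((hb.strictMono z.re hrs).trans_le hs.1).not_ge hr.2

lemma mem_closure_stackBand_inter_iff (hb : IsEdgeStack b) (s : ℤ) (z : ℂ) :
    z ∈ closure (stackBand b P s) ∩ closure (stackBand b P (s + 1)) ↔
      z.im = b (s + 1) z.re := by
  rw [hb.closure_stackBand, hb.closure_stackBand]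
  have hmono := hb.strictMono z.re
  exact ⟨fun ⟨hr, hs⟩ => le_antisymm hr.2 hs.1, fun h =>
    ⟨⟨h ▸ (hmono (lt_add_one s)).le, h.le⟩, h.ge, h ▸ (hmono (lt_add_one (s + 1))).le⟩⟩

end IsEdgeStack

end EdgeStack

section OmegaBands

/-- The boundary curves of the bands `Ω s`. Those of even index lie on `|Y| = 1` and those of odd
index on `|X| = 1`, where `η` is as in `IsLevelGraph`. -/
def edge (T g : ℝ) (η : ℝ → ℝ) (s : ℤ) (x : ℝ) : ℝ :=
  (s / 4 : ℤ) * T +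
    if s % 4 = 0 then -η x else if s % 4 = 1 then η x
    else if s % 4 = 2 then g + η x else T - g - η x

/-- The indices of the boundary curves that belong to the band below them: the sets `|X| < 1` and
`|Y| < 1` are open, so these are the curves with such a set above them. -/
def openEdges : Set ℤ := {s | s % 4 = 0 ∨ s % 4 = 3}

/-- The bands `Ω s`: the conditions `|X| < 1` and `|Y| < 1` each hold throughout a band or fail
throughout it, and the band `Ω 0`, on which both hold, contains the real axis. -/
def omegaBand (T g : ℝ) (η : ℝ → ℝ) (s : ℤ) : Set ℂ := stackBand (edge T g η) openEdges s

variable {T g : ℝ} {η : ℝ → ℝ}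

lemma edge_four_mul (k : ℤ) (x : ℝ) : edge T g η (4 * k) x = k * T - η x := by
  simp [edge, sub_eq_add_neg]

lemma edge_four_mul_add_one (k : ℤ) (x : ℝ) : edge T g η (4 * k + 1) x = k * T + η x := by
  simp [edge, show (4 * k + 1) % 4 = 1 by lia, show (4 * k + 1) / 4 = k by lia]

lemma edge_four_mul_add_two (k : ℤ) (x : ℝ) : edge T g η (4 * k + 2) x = k * T + (g + η x) := by
  simp [edge, show (4 * k + 2) % 4 = 2 by lia, show (4 * k + 2) / 4 = k by lia]

lemma edge_four_mul_add_three (k : ℤ) (x : ℝ) :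
    edge T g η (4 * k + 3) x = k * T + (T - g - η x) := by
  simp [edge, show (4 * k + 3) % 4 = 3 by lia, show (4 * k + 3) / 4 = k by lia]

lemma edge_four_mul_sub_one (k : ℤ) (x : ℝ) : edge T g η (4 * k - 1) x = k * T - g - η x := by
  rw [show 4 * k - 1 = 4 * (k - 1) + 3 by ring, edge_four_mul_add_three]
  push_cast
  ring

lemma exists_eq_four_mul_add (s : ℤ) :
    ∃ k, s = 4 * k ∨ s = 4 * k + 1 ∨ s = 4 * k + 2 ∨ s = 4 * k + 3 :=
  ⟨s / 4, by lia⟩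

lemma edge_one_sub (s : ℤ) (x : ℝ) : edge T g η (1 - s) x + edge T g η s x = 0 := by
  obtain ⟨k, rfl | rfl | rfl | rfl⟩ := exists_eq_four_mul_add s
  · rw [show 1 - 4 * k = 4 * (-k) + 1 by ring, edge_four_mul, edge_four_mul_add_one]
    push_cast
    ring
  · rw [show 1 - (4 * k + 1) = 4 * (-k) by ring, edge_four_mul, edge_four_mul_add_one]
    push_cast
    ring
  · rw [show 1 - (4 * k + 2) = 4 * (-k) - 1 by ring, edge_four_mul_sub_one, edge_four_mul_add_two]
    push_cast
    ring
  · rw [show 1 - (4 * k + 3) = 4 * (-k - 1) + 2 by ring, edge_four_mul_add_two,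
      edge_four_mul_add_three]
    push_cast
    ring

lemma edge_two_mul_add_edge (s : ℤ) (x : ℝ) :
    edge T g η (2 * s) x + edge T g η (2 * s + 2) x = s * T + g := by
  obtain ⟨k, rfl | rfl⟩ := Int.even_or_odd' s
  · rw [show 2 * (2 * k) = 4 * k by ring, edge_four_mul, edge_four_mul_add_two]
    push_cast
    ring
  · rw [show 2 * (2 * k + 1) = 4 * k + 2 by ring, show 4 * k + 2 + 2 = 4 * (k + 1) by ring,
      edge_four_mul, edge_four_mul_add_two]
    push_cast
    ring

lemma edge_two_mul_sub_one_add_edge (s : ℤ) (x : ℝ) :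
    edge T g η (2 * s - 1) x + edge T g η (2 * s - 1 + 2) x = s * T - g := by
  obtain ⟨k, rfl | rfl⟩ := Int.even_or_odd' s
  · rw [show 2 * (2 * k) - 1 = 4 * k - 1 by ring, show 4 * k - 1 + 2 = 4 * k + 1 by ring,
      edge_four_mul_sub_one, edge_four_mul_add_one]
    push_cast
    ring
  · rw [show 2 * (2 * k + 1) - 1 = 4 * k + 1 by ring, show 4 * k + 1 + 2 = 4 * k + 3 by ring,
      edge_four_mul_add_one, edge_four_mul_add_three]
    push_cast
    ring

lemma one_sub_mem_openEdges_iff {s : ℤ} : 1 - s ∈ openEdges ↔ s ∉ openEdges := by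
  simp only [openEdges, Set.mem_ofPred_eq]
  lia

lemma mem_openEdges_iff_add_two {s : ℤ} : s ∈ openEdges ↔ s + 2 ∉ openEdges := by
  simp only [openEdges, Set.mem_ofPred_eq]
  lia

namespace IsLevelGraph

variable (hη : IsLevelGraph T g η)
include hη

lemma period_pos : 0 < T := by linarith [hη.g_pos, hη.pos 0, hη.lt 0]

lemma isEdgeStack_edge : IsEdgeStack (edge T g η) where
  continuous s := by
    have := hη.continuous
    obtain ⟨k, rfl | rfl | rfl | rfl⟩ := exists_eq_four_mul_add s <;>
      simp only [funext (edge_four_mul k), funext (edge_four_mul_add_one k),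
        funext (edge_four_mul_add_two k), funext (edge_four_mul_add_three k)] <;> fun_prop
  strictMono x := strictMono_int_of_lt_succ fun s => by
    have := hη.g_pos
    have := hη.pos x
    have := hη.lt x
    obtain ⟨k, rfl | rfl | rfl | rfl⟩ := exists_eq_four_mul_add s
    · rw [edge_four_mul, edge_four_mul_add_one]
      linarith
    · rw [show 4 * k + 1 + 1 = 4 * k + 2 by ring, edge_four_mul_add_one, edge_four_mul_add_two]
      linarith
    · rw [show 4 * k + 2 + 1 = 4 * k + 3 by ring, edge_four_mul_add_two, edge_four_mul_add_three]
      linarith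
    · rw [show 4 * k + 3 + 1 = 4 * (k + 1) by ring, edge_four_mul, edge_four_mul_add_three]
      push_cast
      linarith
  exists_lt x y := by
    obtain ⟨k, hk⟩ := exists_int_lt ((y + η x) / T)
    exact ⟨4 * k, by rwa [edge_four_mul, sub_lt_iff_lt_add, ← lt_div_iff₀ hη.period_pos]⟩
  exists_gt x y := by
    obtain ⟨k, hk⟩ := exists_int_gt ((y + η x) / T)
    exact ⟨4 * k, by rwa [edge_four_mul, lt_sub_iff_add_lt, ← div_lt_iff₀ hη.period_pos]⟩

lemma edge_neg (s : ℤ) (x : ℝ) : edge T g η s (-x) = edge T g η s x := by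
  simp only [edge, hη.neg]

lemma edge_add_pi (s : ℤ) (x : ℝ) : edge T g η s (x + π) = edge T g η s x := by
  simp only [edge, hη.add_pi]

lemma neg_mem_omegaBand_iff {s : ℤ} {z : ℂ} :
    -z ∈ omegaBand T g η s ↔ z ∈ omegaBand T g η (-s) := by
  have hflip (r : ℤ) : -z ∈ aboveEdge (edge T g η) openEdges (1 - r) ↔
      z ∉ aboveEdge (edge T g η) openEdges r := by
    rw [← zero_sub z]
    refine sub_mem_aboveEdge_iff ?_ one_sub_mem_openEdges_iff
    rw [zero_sub, Complex.neg_re, hη.edge_neg, edge_one_sub, Complex.zero_im]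
  have hs := hflip (-s)
  have hs' := hflip (-s + 1)
  rw [show 1 - -s = s + 1 by ring] at hs
  rw [show 1 - (-s + 1) = s by ring] at hs'
  rw [omegaBand, omegaBand, stackBand, stackBand, Set.mem_sdiff, Set.mem_sdiff, hs, hs', not_not,
    and_comm]

lemma omegaBand_union_omegaBand (s : ℤ) : omegaBand T g η s ∪ omegaBand T g η (s + 1) =
    aboveEdge (edge T g η) openEdges s \ aboveEdge (edge T g η) openEdges (s + 2) :=
  hη.isEdgeStack_edge.stackBand_union_stackBand s

lemma gap_add_int_mul (k : ℤ) (x y : ℝ) : gap T g x (k * T + y) = gap T g x y := by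
  have hper : Function.Periodic (gap T g x) T := gap_add hη.period_pos x
  rw [add_comm]
  exact hper.int_mul k y

lemma mem_omegaBand_sub_one_union_iff {k : ℤ} {z : ℂ} :
    z ∈ omegaBand T g η (4 * k - 1) ∪ omegaBand T g η (4 * k) ↔
      z.im ∈ Set.Ioo (k * T - g - η z.re) (k * T + η z.re) := by
  have hunion := hη.omegaBand_union_omegaBand (4 * k - 1)
  rw [sub_add_cancel, show 4 * k - 1 + 2 = 4 * k + 1 by ring] at hunion
  have hlower : 4 * k - 1 ∈ openEdges := by
    rw [openEdges, Set.mem_ofPred_eq]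
    lia
  have hupper : 4 * k + 1 ∉ openEdges := by
    rw [openEdges, Set.mem_ofPred_eq]
    lia
  rw [hunion, Set.mem_sdiff, mem_aboveEdge_of_mem hlower, mem_aboveEdge_of_notMem hupper, not_le,
    edge_four_mul_sub_one, edge_four_mul_add_one, Set.mem_Ioo]

lemma mem_omegaBand_add_one_union_iff {k : ℤ} {z : ℂ} :
    z ∈ omegaBand T g η (4 * k + 1) ∪ omegaBand T g η (4 * k + 2) ↔
      z.im ∈ Set.Icc (k * T + η z.re) (k * T + (T - g - η z.re)) := by
  have hunion := hη.omegaBand_union_omegaBand (4 * k + 1)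
  rw [show 4 * k + 1 + 1 = 4 * k + 2 by ring, show 4 * k + 1 + 2 = 4 * k + 3 by ring] at hunion
  have hlower : 4 * k + 1 ∉ openEdges := by
    rw [openEdges, Set.mem_ofPred_eq]
    lia
  have hupper : 4 * k + 3 ∈ openEdges := by
    rw [openEdges, Set.mem_ofPred_eq]
    lia
  rw [hunion, Set.mem_sdiff, mem_aboveEdge_of_notMem hlower, mem_aboveEdge_of_mem hupper, not_lt,
    edge_four_mul_add_one, edge_four_mul_add_three, Set.mem_Icc]

lemma gap_neg_of_mem_Ioo {k : ℤ} {x y : ℝ} (hy : y ∈ Set.Ioo (k * T - g - η x) (k * T + η x)) :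
    gap T g x y < 0 := by
  rw [← add_sub_cancel (k * T) y, hη.gap_add_int_mul]
  exact hη.gap_neg x _ (by linarith [hy.1]) (by linarith [hy.2])

lemma gap_edge_eq_zero (s : ℤ) (x : ℝ) : gap T g x (edge T g η (2 * s + 1) x) = 0 := by
  obtain ⟨k, rfl | rfl⟩ := Int.even_or_odd' s
  · rw [show 2 * (2 * k) + 1 = 4 * k + 1 by ring, edge_four_mul_add_one, hη.gap_add_int_mul,
      hη.gap_eq_zero]
  · rw [show 2 * (2 * k + 1) + 1 = 4 * k + 3 by ring, edge_four_mul_add_three, hη.gap_add_int_mul,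
      show T - g - η x = -g - η x + T by ring, gap_add hη.period_pos, gap_reflect, hη.gap_eq_zero]

lemma gap_pos_or_eq_edge_of_mem_Icc {k : ℤ} {x y : ℝ}
    (hy : y ∈ Set.Icc (k * T + η x) (k * T + (T - g - η x))) :
    0 < gap T g x y ∨ ∃ s, y = edge T g η (2 * s + 1) x := by
  rcases hy.1.eq_or_lt with hlower | hlower
  · refine .inr ⟨2 * k, ?_⟩
    rw [show 2 * (2 * k) + 1 = 4 * k + 1 by ring, edge_four_mul_add_one, hlower]
  rcases hy.2.eq_or_lt with hupper | hupper
  · refine .inr ⟨2 * k + 1, ?_⟩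
    rw [show 2 * (2 * k + 1) + 1 = 4 * k + 3 by ring, edge_four_mul_add_three, hupper]
  · refine .inl ?_
    rw [← add_sub_cancel (k * T) y, hη.gap_add_int_mul]
    exact hη.gap_pos x _ (by linarith) (by linarith)

lemma exists_mem_Ioo_or_mem_Icc (x y : ℝ) : ∃ k : ℤ,
    y ∈ Set.Ioo (k * T - g - η x) (k * T + η x) ∨
      y ∈ Set.Icc (k * T + η x) (k * T + (T - g - η x)) := by
  obtain ⟨k, ⟨hk, hk'⟩, -⟩ := existsUnique_sub_zsmul_mem_Ioc hη.period_pos y (-g - η x)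
  rw [zsmul_eq_mul] at hk hk'
  refine ⟨k, ?_⟩
  rcases lt_or_ge y (k * T + η x) with hlt | hle
  · exact .inl ⟨by linarith, hlt⟩
  · exact .inr ⟨hle, by linarith⟩

lemma gap_lt_zero_iff {z : ℂ} : gap T g z.re z.im < 0 ↔
    z ∈ ⋃ k : ℤ, omegaBand T g η (4 * k - 1) ∪ omegaBand T g η (4 * k) := by
  simp only [Set.mem_iUnion, hη.mem_omegaBand_sub_one_union_iff]
  refine ⟨fun hneg => ?_, fun ⟨k, hk⟩ => hη.gap_neg_of_mem_Ioo hk⟩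
  obtain ⟨k, hk | hk⟩ := hη.exists_mem_Ioo_or_mem_Icc z.re z.im
  · exact ⟨k, hk⟩
  · rcases hη.gap_pos_or_eq_edge_of_mem_Icc hk with hpos | ⟨s, hs⟩
    · exact absurd hpos hneg.not_gt
    · exact absurd (hs ▸ hη.gap_edge_eq_zero s z.re) hneg.ne

lemma zero_le_gap_iff {z : ℂ} : 0 ≤ gap T g z.re z.im ↔
    z ∈ ⋃ k : ℤ, omegaBand T g η (4 * k + 1) ∪ omegaBand T g η (4 * k + 2) := by
  simp only [Set.mem_iUnion, hη.mem_omegaBand_add_one_union_iff]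
  refine ⟨fun hnonneg => ?_, fun ⟨k, hk⟩ => ?_⟩
  · obtain ⟨k, hk | hk⟩ := hη.exists_mem_Ioo_or_mem_Icc z.re z.im
    · exact absurd (hη.gap_neg_of_mem_Ioo hk) hnonneg.not_gt
    · exact ⟨k, hk⟩
  · rcases hη.gap_pos_or_eq_edge_of_mem_Icc hk with hpos | ⟨s, hs⟩
    · exact hpos.le
    · exact hs ▸ (hη.gap_edge_eq_zero s z.re).ge

lemma gap_eq_zero_iff {x y : ℝ} : gap T g x y = 0 ↔ ∃ s, y = edge T g η (2 * s + 1) x := by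
  refine ⟨fun hzero => ?_, fun ⟨s, hs⟩ => hs ▸ hη.gap_edge_eq_zero s x⟩
  obtain ⟨k, hk | hk⟩ := hη.exists_mem_Ioo_or_mem_Icc x y
  · exact absurd hzero (hη.gap_neg_of_mem_Ioo hk).ne
  · exact (hη.gap_pos_or_eq_edge_of_mem_Icc hk).resolve_left hzero.not_gt

lemma gap_neg_lt_zero_iff {z : ℂ} : gap T g (-z).re (-z).im < 0 ↔
    z ∈ ⋃ k : ℤ, omegaBand T g η (4 * k) ∪ omegaBand T g η (4 * k + 1) := by
  simp only [hη.gap_lt_zero_iff, Set.mem_iUnion, Set.mem_union, hη.neg_mem_omegaBand_iff]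
  refine neg_surjective.exists.trans (exists_congr fun k => ?_)
  rw [show -(4 * -k - 1) = 4 * k + 1 by ring, show -(4 * -k) = 4 * k by ring, or_comm]

lemma zero_le_gap_neg_iff {z : ℂ} : 0 ≤ gap T g (-z).re (-z).im ↔
    z ∈ ⋃ k : ℤ, omegaBand T g η (4 * k - 2) ∪ omegaBand T g η (4 * k - 1) := by
  simp only [hη.zero_le_gap_iff, Set.mem_iUnion, Set.mem_union, hη.neg_mem_omegaBand_iff]
  refine neg_surjective.exists.trans (exists_congr fun k => ?_)
  rw [show -(4 * -k + 1) = 4 * k - 1 by ring, show -(4 * -k + 2) = 4 * k - 2 by ring, or_comm]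

lemma gap_neg_eq_zero_iff {x y : ℝ} :
    gap T g (-x) (-y) = 0 ↔ ∃ s, y = edge T g η (2 * s) x := by
  rw [hη.gap_eq_zero_iff]
  refine neg_surjective.exists.trans (exists_congr fun s => ?_)
  have hflip := edge_one_sub (T := T) (g := g) (η := η) (2 * s) x
  rw [hη.edge_neg, show 2 * -s + 1 = 1 - 2 * s by ring, eq_neg_of_add_eq_zero_left hflip, neg_inj]

lemma image_sub_omegaBand_even (s : ℤ) :
    (fun z : ℂ => ((s * T + g : ℝ) : ℂ) * I - z) ''
      (omegaBand T g η (2 * s) ∪ omegaBand T g η (2 * s + 1)) =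
        omegaBand T g η (2 * s) ∪ omegaBand T g η (2 * s + 1) := by
  rw [hη.omegaBand_union_omegaBand]
  refine image_sub_aboveEdge_sdiff (fun x => ?_) mem_openEdges_iff_add_two
  rw [hη.edge_neg, edge_two_mul_add_edge]

lemma range_midline_subset_even (s : ℤ) :
    Set.range (fun x : ℝ => ((s * T + g : ℝ) : ℂ) * I / 2 + x) ⊆
      omegaBand T g η (2 * s) ∪ omegaBand T g η (2 * s + 1) := by
  rw [hη.omegaBand_union_omegaBand]
  exact hη.isEdgeStack_edge.range_midline_subset (by lia) (edge_two_mul_add_edge s)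

lemma omegaBand_union_sub_one (s : ℤ) : omegaBand T g η (2 * s) ∪ omegaBand T g η (2 * s - 1) =
    aboveEdge (edge T g η) openEdges (2 * s - 1) \
      aboveEdge (edge T g η) openEdges (2 * s - 1 + 2) := by
  rw [Set.union_comm, ← hη.omegaBand_union_omegaBand, sub_add_cancel]

lemma image_sub_omegaBand_odd (s : ℤ) :
    (fun z : ℂ => ((s * T - g : ℝ) : ℂ) * I - z) ''
      (omegaBand T g η (2 * s) ∪ omegaBand T g η (2 * s - 1)) =
        omegaBand T g η (2 * s) ∪ omegaBand T g η (2 * s - 1) := by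
  rw [hη.omegaBand_union_sub_one]
  refine image_sub_aboveEdge_sdiff (fun x => ?_) mem_openEdges_iff_add_two
  rw [hη.edge_neg, edge_two_mul_sub_one_add_edge]

lemma range_midline_subset_odd (s : ℤ) :
    Set.range (fun x : ℝ => ((s * T - g : ℝ) : ℂ) * I / 2 + x) ⊆
      omegaBand T g η (2 * s) ∪ omegaBand T g η (2 * s - 1) := by
  rw [hη.omegaBand_union_sub_one]
  exact hη.isEdgeStack_edge.range_midline_subset (by lia) (edge_two_mul_sub_one_add_edge s)

end IsLevelGraph

end OmegaBands

section Main

variable {a t T g c : ℝ} {η : ℝ → ℝ}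

namespace IsRealParameter

lemma modulus_Xfun_lt_one_iff (h : IsRealParameter a T g c) (z : ℂ) :
    modulus (Xfun c (I * g) (rectTau T) z) < 1 ↔ gap T g z.re z.im < 0 := by
  rw [Xfun_eq_projPoint, modulus_projPoint_lt_one_iff, ← h.norm_numerX_lt_iff,
    mul_comm I (z.im : ℂ), Complex.re_add_im]

lemma modulus_Xfun_eq_one_iff (h : IsRealParameter a T g c) (z : ℂ) :
    modulus (Xfun c (I * g) (rectTau T) z) = 1 ↔ gap T g z.re z.im = 0 := by
  rw [Xfun_eq_projPoint, modulus_projPoint_eq_one_iff h.denomX_ne_zero, ← h.norm_numerX_eq_iff,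
    mul_comm I (z.im : ℂ), Complex.re_add_im]

lemma iUnion_closure_inter_eq_modulus_Xfun (h : IsRealParameter a T g c)
    (hη : IsLevelGraph T g η) :
    ⋃ s : ℤ, closure (omegaBand T g η (2 * s)) ∩ closure (omegaBand T g η (2 * s + 1)) =
      {z | modulus (Xfun c (I * g) (rectTau T) z) = 1} := by
  ext z
  rw [Set.mem_ofPred_eq, h.modulus_Xfun_eq_one_iff, hη.gap_eq_zero_iff, Set.mem_iUnion]
  exact exists_congr fun s => hη.isEdgeStack_edge.mem_closure_stackBand_inter_iff (2 * s) z

lemma iUnion_closure_inter_eq_modulus_Yfun (h : IsRealParameter a T g c)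
    (hη : IsLevelGraph T g η) :
    ⋃ s : ℤ, closure (omegaBand T g η (2 * s - 1)) ∩ closure (omegaBand T g η (2 * s)) =
      {z | modulus (Yfun c (I * g) (rectTau T) z) = 1} := by
  ext z
  rw [Set.mem_ofPred_eq, Yfun_eq_Xfun_neg, h.modulus_Xfun_eq_one_iff, Complex.neg_re,
    Complex.neg_im, hη.gap_neg_eq_zero_iff, Set.mem_iUnion]
  refine exists_congr fun s => ?_
  have hline :=
    hη.isEdgeStack_edge.mem_closure_stackBand_inter_iff (P := openEdges) (2 * s - 1) z
  rwa [sub_add_cancel] at hline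

lemma isOmegaPartition (h : IsRealParameter a T g c) (hη : IsLevelGraph T g η) :
    IsOmegaPartition (I * g) (rectTau T) (Xfun c (I * g) (rectTau T)) (Yfun c (I * g) (rectTau T))
      (omegaBand T g η) := by
  have hstack := hη.isEdgeStack_edge
  have hplus (s : ℤ) : (s * π * rectTau T + I * g : ℂ) = (s * T + g : ℝ) * I := by
    rw [mul_pi_mul_rectTau, Complex.ofReal_add, add_mul, mul_comm I]
  have hminus (s : ℤ) : (s * π * rectTau T - I * g : ℂ) = (s * T - g : ℝ) * I := by
    rw [mul_pi_mul_rectTau, Complex.ofReal_sub, sub_mul, mul_comm I]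
  exact
  { disjoint := hstack.pairwise_disjoint_stackBand
    cover := hstack.iUnion_stackBand
    simplyConnected := hstack.simplyConnectedSpace_stackBand
    closure_disjoint := fun _ _ => hstack.disjoint_closure_stackBand
    lines_X := h.iUnion_closure_inter_eq_modulus_Xfun hη
    lines_Y := h.iUnion_closure_inter_eq_modulus_Yfun hη
    Y_lt := by
      ext z
      rw [Set.mem_ofPred_eq, Yfun_eq_Xfun_neg, h.modulus_Xfun_lt_one_iff, hη.gap_neg_lt_zero_iff]
    Y_ge := by
      ext z
      rw [Set.mem_ofPred_eq, Yfun_eq_Xfun_neg, ← not_lt, h.modulus_Xfun_lt_one_iff, not_lt,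
        hη.zero_le_gap_neg_iff]
    X_lt := by
      ext z
      rw [Set.mem_ofPred_eq, h.modulus_Xfun_lt_one_iff, hη.gap_lt_zero_iff]
    X_ge := by
      ext z
      rw [Set.mem_ofPred_eq, ← not_lt, h.modulus_Xfun_lt_one_iff, not_lt, hη.zero_le_gap_iff]
    add_pi := image_add_stackBand hη.edge_add_pi
    reflect_Y := fun s => hplus s ▸ hη.image_sub_omegaBand_even s
    line_Y := fun s => hplus s ▸ hη.range_midline_subset_even s
    reflect_X := fun s => hminus s ▸ hη.image_sub_omegaBand_odd s
    line_X := fun s => hminus s ▸ hη.range_midline_subset_odd s }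

lemma modulus_Xfun_neg_half_lt_one (h : IsRealParameter a T g c) (hat : a + 4 < 1 / t)
    (hct : thetaRatio (I * g) (rectTau T) = c / t) :
    modulus (Xfun c (I * g) (rectTau T) (-(I * g) / 2)) < 1 := by
  have hratio : thetaRatio (I * g) (rectTau T) = (c * (1 / t) : ℝ) := by
    rw [hct, mul_one_div, Complex.ofReal_div]
  have him : (-(I * g) / 2).im = -g / 2 := by simp
  rw [Xfun_eq_projPoint, modulus_projPoint_lt_one_iff]
  refine h.norm_numerX_lt_of_im_mem_Icc hratio hat ?_
  rw [him]
  exact ⟨by linarith [h.g_pos], by linarith [h.g_pos]⟩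

lemma parametrisesKernel (h : IsRealParameter a T g c) (ht : t ≠ 0) (hat : a + 4 < 1 / t)
    (hct : thetaRatio (I * g) (rectTau T) = c / t) :
    ParametrisesKernel a t (I * g) (rectTau T) (Xfun c (I * g) (rectTau T))
      (Yfun c (I * g) (rectTau T)) := by
  have htC : (t : ℂ) ≠ 0 := Complex.ofReal_ne_zero.2 ht
  have hY : Yfun c (I * g) (rectTau T) = Xfun c (-(I * g)) (rectTau T) :=
    funext (Yfun_eq_Xfun_neg_param _ _ _)
  have hsmall := h.modulus_Xfun_neg_half_lt_one hat hct
  exact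
  { meromorphic_X := h.isMeromorphic_Xfun
    meromorphic_Y := hY ▸ h.neg.isMeromorphic_Xfun
    curve_eq := h.kernelCurve_eq_range htC hct
    gamma_re := by simp
    tau_re := by simp [rectTau]
    gamma_pos := by simpa using h.g_pos
    gamma_lt := by
      rw [pi_mul_rectTau, mul_left_comm, Complex.I_mul_im, Complex.I_mul_im,
        Complex.re_mul_ofReal, Complex.re_ofNat, Complex.ofReal_re]
      linarith [h.g_lt, h.T_pos]
    kernel_zero := h.kernelExt_Xfun_Yfun htC hct
    X_add_pi := Xfun_add_pi _ _ _
    X_add_pi_tau := Xfun_add_pi_mul h.im_pos _ _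
    X_reflect := Xfun_reflect _ _ _
    Y_add_pi := hY ▸ Xfun_add_pi _ _ _
    Y_add_pi_tau := hY ▸ Xfun_add_pi_mul h.im_pos _ _
    Y_reflect := by
      have hreflect := Xfun_reflect c (-(I * g)) (rectTau T)
      rwa [neg_neg, ← hY] at hreflect
    X_small := hsmall
    Y_small := by rwa [Yfun_eq_Xfun_neg, ← neg_div]
    roots_X := h.rootCount_Xfun
    poles_X := h.poleCount_Xfun
    roots_Y := hY ▸ h.neg.rootCount_Xfun
    poles_Y := hY ▸ h.neg.poleCount_Xfun }

end IsRealParameter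

end Main

end

end AModel

theorem mainTheorem5 (a t : ℝ) (ha : 0 < a) (ht : 0 < t) (ht' : t < 1 / (a + 4)) :
    ∃ c γ τ : ℂ,
      γ.re = 0 ∧ τ.re = 0 ∧ 0 < (2 * γ).im ∧ (2 * γ).im < ((Real.pi : ℂ) * τ).im ∧
      (a : ℂ) * c ^ 3 = -(AModel.theta (4 * γ) τ / AModel.theta (2 * γ) τ) ∧
      c ^ 2 = AModel.theta (3 * γ) τ / AModel.theta γ τ ∧
      c / (t : ℂ) =
        4 * (AModel.thetaDeriv γ τ * AModel.theta (2 * γ) τ /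
          (AModel.thetaDeriv 0 τ * AModel.theta γ τ)) -
        2 * (AModel.thetaDeriv (2 * γ) τ / AModel.thetaDeriv 0 τ) ∧
      (∀ z, AModel.Yfun c γ τ z = AModel.Xfun c γ τ (-z)) ∧
      AModel.ParametrisesKernel a t γ τ (AModel.Xfun c γ τ) (AModel.Yfun c γ τ) ∧
      ∃ Ω : ℤ → Set ℂ,
        AModel.IsOmegaPartition γ τ (AModel.Xfun c γ τ) (AModel.Yfun c γ τ) Ω := by
  have hE : a + 4 < 1 / t := by rwa [lt_div_iff₀' (by linarith), ← lt_div_iff₀ ht] at ht'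
  obtain ⟨T, g, c, h, hratio⟩ := AModel.exists_isRealParameter_thetaRatio_eq ha hE
  obtain ⟨η, hη⟩ := h.exists_isLevelGraph hratio hE
  have hct : AModel.thetaRatio (Complex.I * g) (AModel.rectTau T) = c / t := by
    rw [hratio, mul_one_div, Complex.ofReal_div]
  have hpar := h.parametrisesKernel ht.ne' hE hct
  exact ⟨c, Complex.I * g, AModel.rectTau T, hpar.gamma_re, hpar.tau_re, hpar.gamma_pos,
    hpar.gamma_lt, h.mul_cube_eq, h.sq_eq, hct.symm, AModel.Yfun_eq_Xfun_neg _ _ _, hpar,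
    AModel.omegaBand T g η, h.isOmegaPartition hη⟩
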